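/- **Proposition (Discrete Cauchy–Riemann equations).** Let $\delta>0$ and let $\Omega_\delta$ be a finite connected set of faces of the regular hexagonal lattice of mesh size $\delta$ whose boundary $\partial\Omega_\delta$, oriented counterclockwise, is a single simple closed lattice path (so the union of the closed faces is simply connected). Let $l\neq r$ be vertices of $\partial\Omega_\delta$, each of which belongs to exactly one face of $\Omega_\delta$; let $u$ and $d$ be the parts of $\partial\Omega_\delta$ from $r$ to $l$ and from $l$ to $r$ respectively, following the orientation, and let $w$ be a vertex of $u$. Color each face of $\Omega_\delta$ white or black with probability $1/2$, independently. *Paths and separation.* A simple path of hexagons is a sequence of distinct faces of $\Omega_\delta$, each adjacent to the next. It goes from an arc $A\subset\partial\Omega_\delta$ to an arc $B$ if its first face has a boundary edge in $A$ and its last face has a boundary edge in $B$; these two edges are fixed as part of the path, and the path is viewed as the curve that enters through the first edge, runs through the centers of its faces, and leaves through the last edge. It separates two sets of vertices if every path along edges of $\Omega_\delta$ from one set to the other uses an edge crossed by this curve. A white cluster is a connected component of the set of white faces. If a white cluster contains a path from $u$ to $d$, its left (resp. right) boundary is the left-most (resp. right-most) simple path from $u$ to $d$ contained in it, i.e. the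 one that separates from $l$ (resp. from $r$) every vertex that is separated from it by some simple path from $u$ to $d$ in the cluster. *Observables.* For a vertex $z$ of $\Omega_\delta$ let $N^l_\delta(z)$ be the number of left boundaries of white clusters separating $l$ and $w$ from $z$ and $r$, minus the number of those separating $l$ and $z$ from $w$ and $r$; let $N^r_\delta(z)$ be the same with right boundaries. Let $Q^u_\delta(z)$ be the event that there is a white simple path from $d$ to $d$ that separates $z$ from $l$ and $r$ and is connected to $u$ by a white path (a path of white faces, one of which has an edge in $u$), and let $Q^d_\delta(z)$ be the same event with $u$ and $d$ exchanged. Put $H^l_\delta=\mathbb E[N^l_\delta]$, $H^r_\delta=\mathbb E[N^r_\delta]$, $H^u_\delta=\mathbb P[Q^u_\delta]$, $H^d_\delta=\mathbb P[Q^d_\delta]$. For an oriented edge $\vec e=\langle x,y\rangle$ of $\Omega_\delta$ let $$\partial^{\pm}_{\vec e}H^{l}_\delta=\mathbb P[N^{l}_\delta(y)=N^{l}_\delta(x)\pm1],\quad \partial^{\pm}_{\vec e}H^{r}_\delta=\mathbb P[N^{r}_\delta(y)=N^{r}_\delta(x)\pm1],$$ $$\partial^{+}_{\vec e}H^{u}_\delta=\mathbb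 P[Q^{u}_\delta(y)\setminus Q^{u}_\delta(x)],\quad \partial^{+}_{\vec e}H^{d}_\delta=\mathbb P[Q^{d}_\delta(y)\setminus Q^{d}_\delta(x)],$$ with $\partial^+_{\vec e}(H^d_\delta-H^u_\delta)=\partial^+_{\vec e}H^d_\delta-\partial^+_{\vec e}H^u_\delta$. *Claim.* Let $\vec e=\langle x,y\rangle$ be an oriented edge of $\Omega_\delta$ in the interior, in the sense that its origin $x$ does not lie on $\partial\Omega_\delta$, and let $\tau\vec e$, $\tau^2\vec e$ be the edges obtained by rotating $\vec e$ counterclockwise around $x$ by $2\pi/3$ and $4\pi/3$. Then $$2\left(\partial^+_{\vec e}H^l_\delta-\partial^-_{\vec e}H^r_\delta\right)=\left(\partial^+_{\tau\vec e}-\partial^+_{\tau^2\vec e}\right)\left(H^d_\delta-H^u_\delta\right).$$ -/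

import Mathlib

namespace HexPerc

noncomputable section

/-! ## The honeycomb lattice -/

/-- Hexagonal faces of the honeycomb lattice, indexed by the triangular lattice of their centres. -/
abbrev Face := ℤ × ℤ

/-- Vertices of the honeycomb lattice. `(a, b, true)` is the corner of the face `(a, b)` in the
direction `π / 6`, and `(a, b, false)` is its corner in the opposite direction; every vertex of the
lattice is of exactly one of these forms. -/
abbrev Vertex := ℤ × ℤ × Bool

/-- The centre of a face, in the honeycomb lattice of mesh size (side length of a hexagon) `δ`. -/
def center (δ : ℝ) (f : Face) : ℂ :=
  √3 * δ * (f.1 + f.2 * Complex.exp (Real.pi * Complex.I / 3))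

/-- The position of a vertex, in the honeycomb lattice of mesh size `δ`. -/
def pos (δ : ℝ) (v : Vertex) : ℂ :=
  center δ (v.1, v.2.1) + (if v.2.2 then 1 else -1) * (δ * Complex.exp (Real.pi * Complex.I / 6))

/-- The six corners of a face in counterclockwise order: the `k`-th one lies in the direction
`π / 6 + k * (π / 3)` from the centre. -/
def corner (f : Face) (k : Fin 6) : Vertex :=
  ![(f.1, f.2, true), (f.1, f.2 + 1, false), (f.1 - 1, f.2, true),
    (f.1, f.2, false), (f.1, f.2 - 1, true), (f.1 + 1, f.2, false)] k

/-- The face `f` lies immediately to the left of the oriented edge `⟨x, y⟩` of the lattice. -/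
def LeftOf (f : Face) (x y : Vertex) : Prop :=
  ∃ k : Fin 6, x = corner f k ∧ y = corner f (k + 1)

/-- Two faces are adjacent if they lie on the two sides of an edge. -/
def FaceAdj (f g : Face) : Prop := ∃ x y, LeftOf f x y ∧ LeftOf g y x

/-- A path of hexagons: a nonempty sequence of faces, each adjacent to the next. -/
def IsPath (γ : List Face) : Prop := γ ≠ [] ∧ γ.IsChain FaceAdj

/-! ## Discrete domains -/

/-- A discrete domain: a finite connected set of faces whose boundary is one simple closed lattice
path (so that the union of the closed faces is simply connected). The boundary path is
`bdry 0, bdry 1, …, bdry (len - 1), bdry 0`; its oriented edges are exactly the oriented edges of the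
lattice with a face of the domain on the left and none on the right, that is, it runs
counterclockwise. The points `l ≠ r` and `w` are vertices of this path, and `w` lies on the
part from `r` to `l`. -/
structure Domain where
  faces : Finset Face
  connected : ∀ f ∈ faces, ∀ g ∈ faces,
    ∃ γ : List Face, IsPath γ ∧ (∀ h ∈ γ, h ∈ faces) ∧ f ∈ γ ∧ g ∈ γ
  len : ℕ
  bdry : ZMod len → Vertex
  bdry_injective : Function.Injective bdry
  bdry_edges : ∀ x y, (∃ t, x = bdry t ∧ y = bdry (t + 1)) ↔
    (∃ f ∈ faces, LeftOf f x y) ∧ ¬ ∃ g ∈ faces, LeftOf g y x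
  l : ZMod len
  r : ZMod len
  w : ZMod len
  l_ne_r : l ≠ r
  w_mem : (w - r).val ≤ (l - r).val

namespace Domain

variable (D : Domain)

/-- The graph formed by the vertices and edges of the faces of the domain (vertices of the lattice
which are on no face of the domain are isolated). -/
def graph : SimpleGraph Vertex :=
  SimpleGraph.fromRel fun x y => ∃ f ∈ D.faces, LeftOf f x y

/-- The marked boundary vertices. -/
def ptL : Vertex := D.bdry D.l
def ptR : Vertex := D.bdry D.r
def ptW : Vertex := D.bdry D.w

/-- The vertex `v` belongs to exactly one face of the domain. -/
def IsCorner (v : Vertex) : Prop := ∃! f : Face, f ∈ D.faces ∧ ∃ k, v = corner f k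

/-- The `t`-th boundary edge is the one from `bdry t` to `bdry (t + 1)`. The arc `u` consists of
the boundary edges from `r` to `l`, counterclockwise. -/
def u : Set (ZMod D.len) := {t | (t - D.r).val < (D.l - D.r).val}

/-- The arc `d` consists of the boundary edges from `l` to `r`, counterclockwise. -/
def d : Set (ZMod D.len) := {t | (t - D.l).val < (D.r - D.l).val}

/-- The `t`-th boundary edge is an edge of the face `f`. -/
def HasBdryEdge (f : Face) (t : ZMod D.len) : Prop := LeftOf f (D.bdry t) (D.bdry (t + 1))

/-! ## Paths joining boundary arcs, and separation -/

/-- A path of hexagons together with a boundary edge at which it starts and a boundary edge at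
which it ends. It is thought of as the curve in the domain which crosses the edge `first`, runs
through the centres of the successive hexagons of `path`, crossing the edges between them, and
leaves through the edge `last`. -/
structure Crosscut where
  path : List Face
  first : ZMod D.len
  last : ZMod D.len

variable {D}

/-- `c` is a simple path of hexagons of the domain from the boundary arc `A` to the boundary
arc `B`. -/
def Crosscut.Joins (c : D.Crosscut) (A B : Set (ZMod D.len)) : Prop :=
  IsPath c.path ∧ c.path.Nodup ∧ (∀ f ∈ c.path, f ∈ D.faces) ∧ c.first ∈ A ∧ c.last ∈ B ∧
    (∃ f, c.path.head? = some f ∧ D.HasBdryEdge f c.first) ∧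
    (∃ g, c.path.getLast? = some g ∧ D.HasBdryEdge g c.last)

/-- The lattice edges crossed by `c`: the two end edges and the edges between consecutive
hexagons. -/
def Crosscut.crossed (c : D.Crosscut) : Set (Sym2 Vertex) :=
  {e | e = s(D.bdry c.first, D.bdry (c.first + 1)) ∨ e = s(D.bdry c.last, D.bdry (c.last + 1)) ∨
    ∃ f g x y, [f, g] <:+: c.path ∧ LeftOf f x y ∧ LeftOf g y x ∧ e = s(x, y)}

/-- `c` separates two sets of vertices if every lattice path in the domain from the one to the
other crosses `c`. -/
def Crosscut.Separates (c : D.Crosscut) (A B : Set Vertex) : Prop :=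
  ∀ a ∈ A, ∀ b ∈ B, ∀ p : D.graph.Walk a b, ∃ e ∈ p.edges, e ∈ c.crossed

variable (D)

/-! ## Percolation -/

/-- A configuration: a colouring of the faces of the domain (`true` is white). -/
abbrev Config := D.faces → Bool

/-- The probability of an event when every face is white or black with probability `1 / 2`
independently of the others, so that each configuration has probability `2 ^ (-n)`, where `n` is the
number of faces. -/
def prob (A : Set D.Config) : ℝ := A.ncard / 2 ^ D.faces.card

variable {D}

def White (ω : D.Config) (f : Face) : Prop := ∃ h : f ∈ D.faces, ω ⟨f, h⟩ = true

/-- The faces `f` and `g` lie on a common path of white hexagons. -/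
def WhiteConnected (ω : D.Config) (f g : Face) : Prop :=
  ∃ γ : List Face, IsPath γ ∧ (∀ h ∈ γ, White ω h) ∧ f ∈ γ ∧ g ∈ γ

/-- The face `f` is connected by a white path to the boundary arc `A`. -/
def WhiteConnectedTo (ω : D.Config) (f : Face) (A : Set (ZMod D.len)) : Prop :=
  ∃ g, ∃ t ∈ A, WhiteConnected ω f g ∧ D.HasBdryEdge g t

/-- White clusters: connected components of the set of white faces. -/
def IsWhiteCluster (ω : D.Config) (K : Set Face) : Prop :=
  ∃ f, White ω f ∧ K = {g | WhiteConnected ω f g}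

/-- `c` is a simple path from `u` to `d` contained in `K`. -/
def CrossesIn (K : Set Face) (c : D.Crosscut) : Prop :=
  c.Joins D.u D.d ∧ ∀ f ∈ c.path, f ∈ K

/-- The left boundary of `K` is the left-most simple path in `K` from `u` to `d`: whatever is
separated from `l` by some such path in `K` is separated from `l` by this one. -/
def IsLeftBoundary (K : Set Face) (c : D.Crosscut) : Prop :=
  CrossesIn K c ∧ ∀ c' : D.Crosscut, CrossesIn K c' →
    ∀ z, c'.Separates {D.ptL} {z} → c.Separates {D.ptL} {z}

/-- The right boundary of `K`, with `r` in place of `l`. -/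
def IsRightBoundary (K : Set Face) (c : D.Crosscut) : Prop :=
  CrossesIn K c ∧ ∀ c' : D.Crosscut, CrossesIn K c' →
    ∀ z, c'.Separates {D.ptR} {z} → c.Separates {D.ptR} {z}

def leftBoundaries (ω : D.Config) : Set D.Crosscut :=
  {c | ∃ K, IsWhiteCluster ω K ∧ IsLeftBoundary K c}

def rightBoundaries (ω : D.Config) : Set D.Crosscut :=
  {c | ∃ K, IsWhiteCluster ω K ∧ IsRightBoundary K c}

/-- The number of elements of `B` separating `l` and `w` from `z` and `r`, minus the number of those
separating `l` and `z` from `w` and `r`. -/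
def signedCount (B : Set D.Crosscut) (z : Vertex) : ℤ :=
  ({c ∈ B | c.Separates {D.ptL, D.ptW} {z, D.ptR}}.ncard : ℤ) -
    ({c ∈ B | c.Separates {D.ptL, z} {D.ptW, D.ptR}}.ncard : ℤ)

/-! ## Observables and their discrete derivatives -/

/-- The random variable `N^l(z)`. -/
def Nl (ω : D.Config) (z : Vertex) : ℤ := signedCount (leftBoundaries ω) z

/-- The random variable `N^r(z)`. -/
def Nr (ω : D.Config) (z : Vertex) : ℤ := signedCount (rightBoundaries ω) z

/-- There is a white simple path from the arc `A` to the arc `A` which separates `z` from `l` and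
`r` and which is connected to the arc `B` by a white path. -/
def QEvent (A B : Set (ZMod D.len)) (z : Vertex) : Set D.Config :=
  {ω | ∃ c : D.Crosscut, c.Joins A A ∧ (∀ f ∈ c.path, White ω f) ∧
    c.Separates {z} {D.ptL, D.ptR} ∧ ∃ f ∈ c.path, WhiteConnectedTo ω f B}

variable (D)

/-- The event `Q^u(z)`. -/
def Qu (z : Vertex) : Set D.Config := QEvent D.d D.u z

/-- The event `Q^d(z)`. -/
def Qd (z : Vertex) : Set D.Config := QEvent D.u D.d z

/-- `∂⁺H^l` along the oriented edge `⟨x, y⟩`. -/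
def dPlusHl (x y : Vertex) : ℝ := D.prob {ω | Nl ω y = Nl ω x + 1}

/-- `∂⁻H^r` along the oriented edge `⟨x, y⟩`. -/
def dMinusHr (x y : Vertex) : ℝ := D.prob {ω | Nr ω y = Nr ω x - 1}

/-- `∂⁺H^u` along the oriented edge `⟨x, y⟩`. -/
def dPlusHu (x y : Vertex) : ℝ := D.prob (D.Qu y \ D.Qu x)

/-- `∂⁺H^d` along the oriented edge `⟨x, y⟩`. -/
def dPlusHd (x y : Vertex) : ℝ := D.prob (D.Qd y \ D.Qd x)

end Domain

end

end HexPerc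

/-! All four derivatives count objects of one kind, namely three disjoint lattice paths ("legs")
from `x` to the boundary, together with loops; the identity then holds for each such object
separately.

Encode a colouring by its interfaces, an edge set of even degree at interior vertices. Let `i` be
the direction of the edge at `x`. If `Nl` increases by one along it, exactly one left boundary
passes between `x` and its neighbour. Since it is left-most, the face `fc x i` is black, the
interfaces leaving `x` in the directions `i + 1` and `i + 2` end on `u` and on `d`, and they share
no white face: this is a `Tripod`. Indeed, if an interface returned to `x`, shared a white face with
the other one, or ended on the wrong arc, the path could be rerouted along it with `x` on the other
side (`surgery_bridge`, `surgery_exit`, `surgery_entrance`). Conversely the path along the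
interfaces of a tripod is a left boundary (`leftBoundary_iff`).

Colour switching: turn black the white faces lining the interface `i + 1`. A new interface appears
in the direction `i`; keeping the old one as a bare path gives three legs (`toSrc`, `Src`). This is
reversible. Removing one leg from the triple leaves an even edge set, which is the interface of a
colouring because the boundary is a single closed path (`exists_coloring`); the colourings obtained
by removing the legs `i` and `i + 1` determine the tripod (`exists_tripod`, `tripod_injective`).

The event `Qd` for the neighbour but not for `x` is also a tripod, for the boundary condition in
which the outside of `d` is black: an interface meeting `d` runs along it until it reaches `u`. The
connection of the white path to `d` means that one interface does run along `d` with the outside on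
its black side (`Norm`, `mem_Qd_diff_iff`). After colour switching, forgetting the boundary edges is
a bijection onto the triples with free boundary in which the leg `i` ends on `u` and the other two
do not both end there (`bijOn_inner`). Exchanging `l` and `r` treats `Nr` and `Qu`.

Let `a`, `b`, `c` be the indicators that the legs `i`, `i + 1`, `i + 2` end on `u`. In the direction
`i` the four derivatives count `b(1-c)` for `dPlusHl`, `(1-b)c` for `dMinusHr`, `a(1-bc)` for
`dPlusHd` and `(1-a)(1-(1-b)(1-c))` for `dPlusHu`. In the difference of the directions `i + 1` and
`i + 2` the terms `abc` and `(1-a)(1-b)(1-c)` cancel by cyclic symmetry, and `(2b-1) - (2c-1) =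
2(b-c)` remains, which is twice `b(1-c) - (1-b)c`.

The planar topology is handled by parity: `Crosscut.Joins.cover` and `Crosscut.Joins.not_reachable`
say that a path of hexagons has exactly two sides. -/

namespace HexPerc

/-! ### Local coordinates at a vertex of the honeycomb lattice. -/

/-- The neighbour of a vertex in the `i`-th direction (counterclockwise order). -/
def nbr : Vertex → Fin 3 → Vertex
  | (a, b, true), i => ![(a + 1, b + 1, false), (a, b + 1, false), (a + 1, b, false)] i
  | (a, b, false), i => ![(a - 1, b - 1, true), (a, b - 1, true), (a - 1, b, true)] i

/-- The face at a vertex which is opposite to the `i`-th neighbour. The dart from `v` to `nbr v i`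
has `fc v (i + 2)` on its left and `fc v (i + 1)` on its right. -/
def fc : Vertex → Fin 3 → Face
  | (a, b, true), i => ![(a, b), (a + 1, b), (a, b + 1)] i
  | (a, b, false), i => ![(a, b), (a - 1, b), (a, b - 1)] i

lemma add_one_one (i : Fin 3) : i + 1 + 1 = i + 2 := by revert i; decide
lemma add_one_two (i : Fin 3) : i + 1 + 2 = i := by revert i; decide
lemma add_two_one (i : Fin 3) : i + 2 + 1 = i := by revert i; decide
lemma add_two_two (i : Fin 3) : i + 2 + 2 = i + 1 := by revert i; decide
lemma add_one_ne (i : Fin 3) : i + 1 ≠ i := by revert i; decide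
lemma add_two_ne (i : Fin 3) : i + 2 ≠ i := by revert i; decide
lemma add_two_ne_add_one (i : Fin 3) : i + 2 ≠ i + 1 := by revert i; decide
lemma fin3_cases (i j : Fin 3) : j = i ∨ j = i + 1 ∨ j = i + 2 := by revert i j; decide

lemma nbr_nbr (v : Vertex) (i : Fin 3) : nbr (nbr v i) i = v := by
  rcases v with ⟨a, b, _ | _⟩ <;> fin_cases i <;> simp [nbr]

lemma fc_nbr_add_one (v : Vertex) (i : Fin 3) : fc (nbr v i) (i + 1) = fc v (i + 2) := by
  rcases v with ⟨a, b, _ | _⟩ <;> fin_cases i <;> simp [nbr, fc]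

lemma fc_nbr_add_two (v : Vertex) (i : Fin 3) : fc (nbr v i) (i + 2) = fc v (i + 1) := by
  rcases v with ⟨a, b, _ | _⟩ <;> fin_cases i <;> simp [nbr, fc]

lemma nbr_inj {v : Vertex} {i j : Fin 3} (h : nbr v i = nbr v j) : i = j := by
  rcases v with ⟨a, b, _ | _⟩ <;> fin_cases i <;> fin_cases j <;> simp [nbr] at h ⊢ <;> omega

lemma fc_inj {v : Vertex} {i j : Fin 3} (h : fc v i = fc v j) : i = j := by
  rcases v with ⟨a, b, _ | _⟩ <;> fin_cases i <;> fin_cases j <;> simp [fc] at h ⊢ <;> omega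

lemma nbr_ne (v : Vertex) (i : Fin 3) : nbr v i ≠ v := by
  rcases v with ⟨a, b, _ | _⟩ <;> fin_cases i <;> simp [nbr]

lemma corner_iff (f : Face) (v : Vertex) : (∃ k, v = corner f k) ↔ ∃ j, f = fc v j := by
  constructor
  · rintro ⟨k, rfl⟩
    -- The table lists, for each corner, the direction of its edge pointing away from `f`.
    refine ⟨![0, 2, 1, 0, 2, 1] k, ?_⟩
    rcases f with ⟨a, b⟩
    fin_cases k <;> simp [corner, fc]
  · rintro ⟨j, rfl⟩
    rcases v with ⟨a, b, _ | _⟩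
    · refine ⟨![3, 5, 1] j, ?_⟩
      fin_cases j <;> simp [corner, fc]
    · refine ⟨![0, 2, 4] j, ?_⟩
      fin_cases j <;> simp [corner, fc]

lemma corner_next (f : Face) (k : Fin 6) :
    ∃ i, corner f (k + 1) = nbr (corner f k) i ∧ f = fc (corner f k) (i + 2) := by
  refine ⟨![1, 0, 2, 1, 0, 2] k, ?_⟩
  rcases f with ⟨a, b⟩
  fin_cases k <;> simp [corner, fc, nbr]

/-- Replaces corners of faces by a vertex and a direction in `Fin 3`, where rotation about the
vertex is addition modulo 3. -/
lemma leftOf_iff {f : Face} {x y : Vertex} :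
    LeftOf f x y ↔ ∃ i, y = nbr x i ∧ f = fc x (i + 2) := by
  constructor
  · rintro ⟨k, rfl, rfl⟩
    exact corner_next f k
  · rintro ⟨i, rfl, rfl⟩
    obtain ⟨k, hk⟩ := (corner_iff (fc x (i + 2)) x).2 ⟨_, rfl⟩
    refine ⟨k, hk, ?_⟩
    obtain ⟨j, h1, h2⟩ := corner_next (fc x (i + 2)) k
    rw [← hk] at h1 h2
    have := fc_inj h2
    have hij : i = j := add_right_cancel this
    rw [h1, hij]

lemma leftOf_nbr (v : Vertex) (i : Fin 3) : LeftOf (fc v (i + 2)) v (nbr v i) :=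
  leftOf_iff.2 ⟨i, rfl, rfl⟩

lemma leftOf_nbr_rev (v : Vertex) (i : Fin 3) : LeftOf (fc v (i + 1)) (nbr v i) v :=
  leftOf_iff.2 ⟨i, (nbr_nbr v i).symm, (fc_nbr_add_two v i).symm⟩

lemma leftOf_nbr_iff {f : Face} {v : Vertex} {i : Fin 3} :
    LeftOf f v (nbr v i) ↔ f = fc v (i + 2) := by
  rw [leftOf_iff]
  constructor
  · rintro ⟨j, h, rfl⟩; rw [nbr_inj h]
  · rintro rfl; exact ⟨i, rfl, rfl⟩

lemma leftOf_nbr_rev_iff {f : Face} {v : Vertex} {i : Fin 3} :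
    LeftOf f (nbr v i) v ↔ f = fc v (i + 1) := by
  have := leftOf_nbr_iff (f := f) (v := nbr v i) (i := i)
  rwa [nbr_nbr, fc_nbr_add_two] at this

lemma LeftOf.unique {f g : Face} {x y : Vertex} (h : LeftOf f x y) (h' : LeftOf g x y) :
    f = g := by
  obtain ⟨i, rfl, rfl⟩ := leftOf_iff.1 h
  exact (leftOf_nbr_iff.1 h').symm

lemma faceAdj_iff {f g : Face} : FaceAdj f g ↔ ∃ v i, f = fc v (i + 1) ∧ g = fc v (i + 2) := by
  constructor
  · rintro ⟨x, y, h1, h2⟩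
    obtain ⟨i, rfl, rfl⟩ := leftOf_iff.1 h1
    refine ⟨nbr x i, i, (fc_nbr_add_one x i).symm, ?_⟩
    rw [fc_nbr_add_two]
    exact leftOf_nbr_rev_iff.1 h2
  · rintro ⟨v, i, rfl, rfl⟩
    exact ⟨nbr v i, v, leftOf_nbr_rev v i, leftOf_nbr v i⟩

lemma faceAdj_ccw (v : Vertex) (i : Fin 3) : FaceAdj (fc v (i + 1)) (fc v (i + 2)) :=
  faceAdj_iff.2 ⟨v, i, rfl, rfl⟩

lemma FaceAdj.symm {f g : Face} (h : FaceAdj f g) : FaceAdj g f := by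
  obtain ⟨x, y, h1, h2⟩ := h
  exact ⟨y, x, h2, h1⟩

/-- Two hexagons share at most one edge. This identifies a crossed edge from the hexagons on its two
sides. -/
lemma ccw_unique {v v' : Vertex} {i i' : Fin 3} (h1 : fc v (i + 1) = fc v' (i' + 1))
    (h2 : fc v (i + 2) = fc v' (i' + 2)) : v = v' ∧ i = i' := by
  rcases v with ⟨a, b, _ | _⟩ <;> rcases v' with ⟨a', b', _ | _⟩ <;> fin_cases i <;>
    fin_cases i' <;> simp [fc, Prod.ext_iff] at h1 h2 ⊢ <;> omega

lemma leftOf_unique_edge {f g : Face} {x y x' y' : Vertex} (h1 : LeftOf f x y)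
    (h2 : LeftOf g y x) (h1' : LeftOf f x' y') (h2' : LeftOf g y' x') : x = x' ∧ y = y' := by
  obtain ⟨i, rfl, rfl⟩ := leftOf_iff.1 h1
  obtain ⟨j, rfl, hj⟩ := leftOf_iff.1 h1'
  have e1 := leftOf_nbr_rev_iff.1 h2
  have e2 := leftOf_nbr_rev_iff.1 h2'
  have := ccw_unique (e1.symm.trans e2) hj
  obtain ⟨rfl, rfl⟩ := this
  exact ⟨rfl, rfl⟩

/-! ### Positions -/

lemma exp_pi_div_three : Complex.exp (Real.pi * Complex.I / 3) = 1 / 2 + √3 / 2 * Complex.I := by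
  rw [show (Real.pi * Complex.I / 3 : ℂ) = ((Real.pi / 3 : ℝ) : ℂ) * Complex.I by push_cast; ring,
    Complex.exp_mul_I, ← Complex.ofReal_cos, ← Complex.ofReal_sin, Real.cos_pi_div_three,
    Real.sin_pi_div_three]
  push_cast; ring

lemma exp_pi_div_six : Complex.exp (Real.pi * Complex.I / 6) = √3 / 2 + 1 / 2 * Complex.I := by
  rw [show (Real.pi * Complex.I / 6 : ℂ) = ((Real.pi / 6 : ℝ) : ℂ) * Complex.I by push_cast; ring,
    Complex.exp_mul_I, ← Complex.ofReal_cos, ← Complex.ofReal_sin, Real.cos_pi_div_six,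
    Real.sin_pi_div_six]
  push_cast; ring

lemma exp_two_pi_div_three :
    Complex.exp (2 * Real.pi * Complex.I / 3) = -1 / 2 + √3 / 2 * Complex.I := by
  rw [show (2 * Real.pi * Complex.I / 3 : ℂ) = Real.pi * Complex.I / 3 + Real.pi * Complex.I / 3 by
    ring, Complex.exp_add, exp_pi_div_three]
  have h : (√3 : ℂ) * √3 = 3 := by exact_mod_cast Real.mul_self_sqrt (by norm_num : (0 : ℝ) ≤ 3)
  linear_combination (1 / 4 * √3 * √3) * Complex.I_mul_I - 1 / 4 * h

lemma pos_re (δ : ℝ) (v : Vertex) :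
    (pos δ v).re = √3 * δ * (v.1 + v.2.1 / 2 + if v.2.2 then 1 / 2 else -1 / 2) := by
  rcases v with ⟨a, b, _ | _⟩ <;>
    simp [pos, center, exp_pi_div_three, exp_pi_div_six, Complex.normSq] <;> ring

lemma pos_im (δ : ℝ) (v : Vertex) :
    (pos δ v).im = δ * (3 / 2 * v.2.1 + if v.2.2 then 1 / 2 else -1 / 2) := by
  have h : √3 * √3 = 3 := Real.mul_self_sqrt (by norm_num : (0 : ℝ) ≤ 3)
  rcases v with ⟨a, b, _ | _⟩ <;>
    simp [pos, center, exp_pi_div_three, exp_pi_div_six, Complex.normSq] <;>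
    linear_combination (δ * b / 2) * h

lemma pos_injective {δ : ℝ} (hδ : 0 < δ) : Function.Injective (pos δ) := by
  intro v w h
  have h3 : 0 < √3 * δ := by positivity
  have h1 := congrArg Complex.re h
  have h2 := congrArg Complex.im h
  rw [pos_re, pos_re] at h1
  rw [pos_im, pos_im] at h2
  have h1 := mul_left_cancel₀ h3.ne' h1
  have h2 := mul_left_cancel₀ hδ.ne' h2
  rcases v with ⟨a, b, _ | _⟩ <;> rcases w with ⟨a', b', _ | _⟩ <;> simp at h1 h2 ⊢
  · subst h2; simpa using h1
  -- In units of `δ / 2` the two kinds of vertices lie at heights congruent to 1 and 2 modulo 3.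
  · have : 3 * b = 3 * b' + 2 := by
      have : (3 * b : ℝ) = 3 * b' + 2 := by linarith
      exact_mod_cast this
    omega
  · have : 3 * b + 2 = 3 * b' := by
      have : (3 * b + 2: ℝ) = 3 * b' := by linarith
      exact_mod_cast this
    omega
  · subst h2; simpa using h1

lemma pos_nbr_add_one (δ : ℝ) (v : Vertex) (i : Fin 3) :
    pos δ (nbr v (i + 1)) - pos δ v =
      Complex.exp (2 * Real.pi * Complex.I / 3) * (pos δ (nbr v i) - pos δ v) := by
  have h : √3 * √3 = 3 := Real.mul_self_sqrt (by norm_num : (0 : ℝ) ≤ 3)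
  rw [exp_two_pi_div_three]
  apply Complex.ext
  · simp only [Complex.sub_re, Complex.mul_re, Complex.add_re, Complex.add_im, Complex.sub_im,
      pos_re, pos_im]
    rcases v with ⟨a, b, _ | _⟩ <;> fin_cases i <;> simp [nbr] <;> ring
  · simp only [Complex.sub_im, Complex.mul_im, Complex.add_re, Complex.add_im, Complex.sub_re,
      pos_re, pos_im]
    rcases v with ⟨a, b, _ | _⟩ <;> fin_cases i <;> simp [nbr] <;>
      ring_nf <;> rw [show √3 ^ 2 = 3 by rw [sq, h]] <;> ring

lemma pos_nbr_add_two (δ : ℝ) (v : Vertex) (i : Fin 3) :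
    pos δ (nbr v (i + 2)) - pos δ v =
      Complex.exp (4 * Real.pi * Complex.I / 3) * (pos δ (nbr v i) - pos δ v) := by
  rw [← add_one_one, pos_nbr_add_one, pos_nbr_add_one, ← mul_assoc, ← Complex.exp_add]
  congr 2
  ring

/-! ### Discrete domains -/

namespace Domain

variable (D : Domain)

lemma graph_adj {x y : Vertex} : D.graph.Adj x y ↔
    ∃ i, y = nbr x i ∧ (fc x (i + 1) ∈ D.faces ∨ fc x (i + 2) ∈ D.faces) := by
  unfold graph
  rw [SimpleGraph.fromRel_adj]
  constructor
  · rintro ⟨-, ⟨f, hf, h⟩ | ⟨f, hf, h⟩⟩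
    · obtain ⟨i, rfl, rfl⟩ := leftOf_iff.1 h
      exact ⟨i, rfl, Or.inr hf⟩
    · obtain ⟨i, rfl, rfl⟩ := leftOf_iff.1 h
      exact ⟨i, (nbr_nbr y i).symm, Or.inl (by rwa [fc_nbr_add_one])⟩
  · rintro ⟨i, rfl, h | h⟩
    · exact ⟨(nbr_ne x i).symm, Or.inr ⟨_, h, leftOf_nbr_rev x i⟩⟩
    · exact ⟨(nbr_ne x i).symm, Or.inl ⟨_, h, leftOf_nbr x i⟩⟩

lemma bdry_step (t : ZMod D.len) : ∃ i, D.bdry (t + 1) = nbr (D.bdry t) i ∧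
    fc (D.bdry t) (i + 2) ∈ D.faces ∧ fc (D.bdry t) (i + 1) ∉ D.faces := by
  obtain ⟨⟨f, hf, h⟩, h2⟩ := (D.bdry_edges _ _).1 ⟨t, rfl, rfl⟩
  obtain ⟨i, hi, rfl⟩ := leftOf_iff.1 h
  refine ⟨i, hi, hf, fun h3 => h2 ⟨_, h3, ?_⟩⟩
  rw [hi]
  exact leftOf_nbr_rev _ _

lemma exists_bdry {v : Vertex} {i : Fin 3} (h1 : fc v (i + 2) ∈ D.faces)
    (h2 : fc v (i + 1) ∉ D.faces) : ∃ t, v = D.bdry t ∧ nbr v i = D.bdry (t + 1) := by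
  refine (D.bdry_edges v (nbr v i)).2 ⟨⟨_, h1, leftOf_nbr v i⟩, ?_⟩
  rintro ⟨g, hg, h⟩
  rw [leftOf_nbr_rev_iff] at h
  exact h2 (h ▸ hg)

lemma exists_bdry_rev {v : Vertex} {i : Fin 3} (h1 : fc v (i + 1) ∈ D.faces)
    (h2 : fc v (i + 2) ∉ D.faces) : ∃ t, nbr v i = D.bdry t ∧ v = D.bdry (t + 1) := by
  have := D.exists_bdry (v := nbr v i) (i := i) (by rwa [fc_nbr_add_two])
    (by rwa [fc_nbr_add_one])
  rwa [nbr_nbr] at this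

/-- Going around the three faces at the vertex, one must pass from outside to inside somewhere, and
the edge crossed there is a boundary edge. -/
lemma mem_range_bdry {v : Vertex} : v ∈ Set.range D.bdry ↔
    (∃ i, fc v i ∈ D.faces) ∧ ∃ i, fc v i ∉ D.faces := by
  constructor
  · rintro ⟨t, rfl⟩
    obtain ⟨i, -, h1, h2⟩ := D.bdry_step t
    exact ⟨⟨_, h1⟩, ⟨_, h2⟩⟩
  · rintro ⟨⟨i, hi⟩, ⟨j, hj⟩⟩
    rcases fin3_cases i j with rfl | rfl | rfl
    · exact absurd hi hj
    · by_cases h : fc v (i + 2) ∈ D.faces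
      · obtain ⟨t, ht, -⟩ := D.exists_bdry h hj
        exact ⟨t, ht.symm⟩
      · obtain ⟨t, ht, -⟩ := D.exists_bdry (v := v) (i := i + 1) (by rwa [add_one_two])
          (by rwa [add_one_one])
        exact ⟨t, ht.symm⟩
    · obtain ⟨t, ht, -⟩ := D.exists_bdry (v := v) (i := i + 1) (by rwa [add_one_two])
        (by rwa [add_one_one])
      exact ⟨t, ht.symm⟩

end Domain
end HexPerc

/-! ### Even edge sets are boundaries of sets of faces. -/

namespace HexPerc

/-- Sets of (unoriented) edges of the lattice, as functions on darts. -/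
abbrev EdgeSet := Vertex → Fin 3 → Bool

/-- The edge set does not depend on the orientation of the edges. -/
def IsSym (X : EdgeSet) : Prop := ∀ v i, X (nbr v i) i = X v i

/-- The parity of the degree of a vertex. -/
def par (X : EdgeSet) (v : Vertex) : Bool := X v 0 ^^ (X v 1 ^^ X v 2)

/-- The edges separating faces of different colours. -/
def bd (σ : Face → Bool) : EdgeSet := fun v i => σ (fc v (i + 1)) ^^ σ (fc v (i + 2))

lemma par_eq (X : EdgeSet) (v : Vertex) (i : Fin 3) :
    par X v = (X v i ^^ (X v (i + 1) ^^ X v (i + 2))) := by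
  unfold par
  fin_cases i
  · rfl
  · change _ = (X v 1 ^^ (X v 2 ^^ X v 0))
    cases X v 0 <;> cases X v 1 <;> cases X v 2 <;> rfl
  · change _ = (X v 2 ^^ (X v 0 ^^ X v 1))
    cases X v 0 <;> cases X v 1 <;> cases X v 2 <;> rfl

lemma isSym_bd (σ : Face → Bool) : IsSym (bd σ) := by
  intro v i
  unfold bd
  rw [fc_nbr_add_one, fc_nbr_add_two, Bool.xor_comm]

lemma par_bd (σ : Face → Bool) (v : Vertex) : par (bd σ) v = false := by
  unfold par bd
  change ((σ (fc v 1) ^^ σ (fc v 2)) ^^ ((σ (fc v 2) ^^ σ (fc v 0)) ^^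
    (σ (fc v 0) ^^ σ (fc v 1)))) = false
  cases σ (fc v 0) <;> cases σ (fc v 1) <;> cases σ (fc v 2) <;> rfl

lemma par_xor (X Y : EdgeSet) (v : Vertex) :
    par (fun v i => X v i ^^ Y v i) v = (par X v ^^ par Y v) := by
  unfold par
  dsimp only
  cases X v 0 <;> cases X v 1 <;> cases X v 2 <;> cases Y v 0 <;> cases Y v 1 <;>
    cases Y v 2 <;> rfl

lemma IsSym.xor {X Y : EdgeSet} (hX : IsSym X) (hY : IsSym Y) :
    IsSym fun v i => X v i ^^ Y v i := by
  intro v i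
  change (X _ _ ^^ Y _ _) = _
  rw [hX, hY]

/-- An edge set which is even at every vertex and bounded to the right is the boundary of a set of
faces. -/
lemma exists_bd_eq {X : EdgeSet} (hs : IsSym X) (hp : ∀ v, par X v = false) (M : ℤ)
    (hM : ∀ v i, M ≤ v.1 → X v i = false) :
    ∃ S : Face → Bool, bd S = X ∧ ∀ f : Face, M ≤ f.1 → S f = false := by
  -- Integrate `X` along each row of faces, leftwards from the column `M`: `T b n` is the colour of
  -- the face `n` columns to the left of `M` in the row `b`.
  let T : ℤ → ℕ → Bool := fun b n =>
    Nat.rec false (fun k s => s ^^ X (M - (k + 1), b, true) 2) n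
  have T0 : ∀ b, T b 0 = false := fun b => rfl
  have T1 : ∀ b k, T b (k + 1) = (T b k ^^ X (M - (k + 1), b, true) 2) := fun b k => rfl
  let S : Face → Bool := fun f => T f.2 (M - f.1).toNat
  have S0 : ∀ f : Face, M ≤ f.1 → S f = false := by
    intro f hf
    change T f.2 (M - f.1).toNat = false
    rw [Int.toNat_of_nonpos (by omega), T0]
  have S1 : ∀ a b, S (a, b) = (S (a + 1, b) ^^ X (a, b, true) 2) := by
    intro a b
    by_cases h : M ≤ a
    · rw [S0 (a, b) h, S0 (a + 1, b) (by simp; omega), hM _ _ h]; rfl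
    · obtain ⟨k, hk⟩ : ∃ k : ℕ, M = a + (k + 1) := ⟨(M - a - 1).toNat, by omega⟩
      change T b (M - a).toNat = (T b (M - (a + 1)).toNat ^^ _)
      rw [show (M - a).toNat = k + 1 by omega, show (M - (a + 1)).toNat = k by omega, T1,
        show M - (k + 1) = a by omega]
  have e1 : ∀ a b, (X (a, b, true) 0 ^^ (X (a, b, true) 1 ^^ X (a, b, true) 2)) = false :=
    fun a b => hp (a, b, true)
  have e2 : ∀ a b, (X (a, b, true) 0 ^^ (X (a + 1, b, true) 1 ^^ X (a, b + 1, true) 2)) =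
      false := by
    intro a b
    have h := hp (a + 1, b + 1, false)
    unfold par at h
    rw [← hs _ 0, ← hs _ 1, ← hs _ 2] at h
    simpa [nbr] using h
  -- Each row was integrated separately. That they fit together is proved by induction on the
  -- distance to `M`: the parities `e1` and `e2` at the two ends of one edge carry the claim one
  -- column to the left.
  have S2 : ∀ (n : ℕ) a b, (M - a).toNat = n →
      (S (a, b) ^^ S (a, b + 1)) = X (a, b, true) 1 := by
    intro n
    induction n with
    | zero =>
      intro a b h
      have h : M ≤ a := by omega
      rw [S0 (a, b) h, S0 (a, b + 1) h, hM _ _ h]; rfl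
    | succ n ih =>
      intro a b h
      have h1 := ih (a + 1) b (by omega)
      rw [S1 a b, S1 a (b + 1)]
      have h2 := e1 a b
      have h3 := e2 a b
      revert h1 h2 h3
      generalize S (a + 1, b) = p1, S (a + 1, b + 1) = p2, X (a, b, true) 0 = p3,
        X (a, b, true) 1 = p4, X (a, b, true) 2 = p5, X (a + 1, b, true) 1 = p6,
        X (a, b + 1, true) 2 = p7
      revert p1 p2 p3 p4 p5 p6 p7
      decide
  have key : ∀ a b i, bd S (a, b, true) i = X (a, b, true) i := by
    intro a b i
    have h1 := S1 a b
    have h2 := S2 _ a b rfl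
    have h3 := e1 a b
    fin_cases i
    · change (S (a + 1, b) ^^ S (a, b + 1)) = X (a, b, true) 0
      revert h1 h2 h3
      generalize S (a + 1, b) = p1, S (a, b) = p2, X (a, b, true) 0 = p3,
        X (a, b, true) 1 = p4, X (a, b, true) 2 = p5, S (a, b + 1) = p6
      revert p1 p2 p3 p4 p5 p6
      decide
    · change (S (a, b + 1) ^^ S (a, b)) = X (a, b, true) 1
      rw [Bool.xor_comm, h2]
    · change (S (a, b) ^^ S (a + 1, b)) = X (a, b, true) 2
      rw [h1]
      cases S (a + 1, b) <;> simp
  refine ⟨S, ?_, S0⟩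
  funext v i
  rcases v with ⟨a, b, _ | _⟩
  · rw [← isSym_bd S, ← hs]
    fin_cases i <;> exact key _ _ _
  · exact key a b i

lemma bool_of_bd_false {σ : Face → Bool} {v : Vertex} {i : Fin 3} (h : bd σ v i = false) :
    σ (fc v (i + 1)) = σ (fc v (i + 2)) := by
  unfold bd at h
  simpa using h

lemma chain_const {α β : Type*} {R : α → α → Prop} (τ : α → β) {γ : List α}
    (hγ : γ.IsChain R) (h : ∀ f ∈ γ, ∀ g ∈ γ, R f g → τ f = τ g) {f g : α} (hf : f ∈ γ)
    (hg : g ∈ γ) : τ f = τ g := by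
  induction γ generalizing f g with
  | nil => simp at hf
  | cons a γ ih =>
    have key : ∀ f ∈ a :: γ, τ f = τ a := by
      intro f hf
      rcases List.mem_cons.1 hf with rfl | hf
      · rfl
      · cases γ with
        | nil => simp at hf
        | cons b γ =>
          rw [List.isChain_cons_cons] at hγ
          rw [h a (by simp) b (by simp) hγ.1]
          exact ih hγ.2 (fun f hf g hg => h f (List.mem_cons_of_mem _ hf) g
            (List.mem_cons_of_mem _ hg)) hf (by simp)
    rw [key f hf, key g hg]

namespace Domain

variable (D : Domain)

lemma finite_vertices : {v : Vertex | ∃ i, fc v i ∈ D.faces}.Finite := by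
  refine (Set.Finite.image2 (fun f k => corner f k) D.faces.finite_toSet
    (Set.finite_univ (α := Fin 6))).subset ?_
  rintro v ⟨i, hi⟩
  obtain ⟨k, hk⟩ := (corner_iff (fc v i) v).2 ⟨i, rfl⟩
  exact ⟨fc v i, hi, k, trivial, hk.symm⟩

/-- If the length were 0, the boundary would be indexed by `ℤ`, and infinitely many vertices would
touch a finite set of faces. -/
instance len_neZero : NeZero D.len := by
  refine ⟨fun h => ?_⟩
  have h1 : (Set.range D.bdry).Finite := D.finite_vertices.subset
    fun v hv => (D.mem_range_bdry.1 hv).1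
  have h2 : Finite (ZMod D.len) := Set.finite_univ_iff.1
    (Set.Finite.of_finite_image (by rwa [Set.image_univ]) D.bdry_injective.injOn)
  have h3 : Infinite (ZMod D.len) := by rw [h]; exact inferInstanceAs (Infinite ℤ)
  exact not_finite (ZMod D.len)

lemma zmod_induction {n : ℕ} [NeZero n] {P : ZMod n → Prop} (h0 : P 0)
    (h1 : ∀ t, P t → P (t + 1)) (t : ZMod n) : P t := by
  have : ∀ k : ℕ, P (k : ZMod n) := by
    intro k
    induction k with
    | zero => simpa using h0
    | succ k ih => simpa using h1 _ ih
  simpa using this t.val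

/-- The two boundary edges at a boundary vertex. -/
lemma bdry_vertex (t : ZMod D.len) : ∃ i j, nbr (D.bdry t) i = D.bdry (t + 1) ∧
    nbr (D.bdry t) j = D.bdry (t - 1) ∧ fc (D.bdry t) (i + 2) ∈ D.faces ∧
    fc (D.bdry t) (i + 1) ∉ D.faces ∧ fc (D.bdry t) (j + 1) ∈ D.faces ∧
    fc (D.bdry t) (j + 2) ∉ D.faces ∧
    (j = i + 1 ∧ fc (D.bdry t) i ∉ D.faces ∨ j = i + 2 ∧ fc (D.bdry t) i ∈ D.faces) := by
  obtain ⟨i, h1, h2, h3⟩ := D.bdry_step t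
  obtain ⟨j, g1, g2, g3⟩ := D.bdry_step (t - 1)
  rw [sub_add_cancel] at g1
  rw [← fc_nbr_add_one, ← g1] at g2
  rw [← fc_nbr_add_two, ← g1] at g3
  refine ⟨i, j, h1.symm, by rw [g1, nbr_nbr], h2, h3, g2, g3, ?_⟩
  rcases fin3_cases i j with rfl | rfl | rfl
  · exact absurd g2 h3
  · left; rw [add_one_two] at g3; exact ⟨rfl, g3⟩
  · right; rw [add_two_one] at g2; exact ⟨rfl, g2⟩

/-- An edge set of the domain which is even at every vertex bounds a set of faces of the
domain. -/
lemma exists_bd_eq {X : EdgeSet} (hs : IsSym X) (hp : ∀ v, par X v = false)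
    (hD : ∀ v i, X v i = true → fc v (i + 1) ∈ D.faces ∨ fc v (i + 2) ∈ D.faces) :
    ∃ S : Face → Bool, (∀ f, S f = true → f ∈ D.faces) ∧ bd S = X := by
  classical
  obtain ⟨f₀, hf₀, hmax⟩ : ∃ f ∈ D.faces, ∀ g ∈ D.faces, g.1 ≤ f.1 := by
    obtain ⟨i, -, h, -⟩ := D.bdry_step 0
    exact D.faces.exists_max_image _ ⟨_, h⟩
  have hfc : ∀ v i, v.1 ≤ (fc v i).1 + 1 := by
    intro v i
    rcases v with ⟨a, b, _ | _⟩ <;> fin_cases i <;> simp [fc] <;> omega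
  have hbig : ∀ v i, f₀.1 + 2 ≤ v.1 → fc v i ∉ D.faces := by
    intro v i hv h
    have h1 := hmax _ h
    have h2 := hfc v i
    omega
  obtain ⟨S, hS, hS0⟩ := HexPerc.exists_bd_eq hs hp (f₀.1 + 2) (by
    intro v i hv
    by_contra h
    rw [Bool.not_eq_false] at h
    rcases hD v i h with h | h <;> exact hbig _ _ hv h)
  have hX : ∀ v i, fc v (i + 1) ∉ D.faces → fc v (i + 2) ∉ D.faces →
      S (fc v (i + 1)) = S (fc v (i + 2)) := by
    intro v i h1 h2
    refine bool_of_bd_false ?_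
    rw [hS]
    by_contra h
    rw [Bool.not_eq_false] at h
    exact (hD v i h).elim h1 h2
  -- All outer faces along the boundary have one colour: at a boundary vertex the outer faces of the
  -- two boundary edges coincide or are adjacent, and `hX` applies.
  have hout : ∀ c : Bool, (∀ t i, nbr (D.bdry t) i = D.bdry (t + 1) →
      S (fc (D.bdry t) (i + 1)) = c) ∨ ¬ (∃ t i, nbr (D.bdry t) i = D.bdry (t + 1) ∧
      S (fc (D.bdry t) (i + 1)) = c) := by
    intro c
    by_cases h : ∃ t i, nbr (D.bdry t) i = D.bdry (t + 1) ∧ S (fc (D.bdry t) (i + 1)) = c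
    · left
      obtain ⟨t₀, i₀, h1, h2⟩ := h
      intro t
      have := zmod_induction (P := fun t => ∀ i, nbr (D.bdry (t₀ + t)) i = D.bdry (t₀ + t + 1) →
        S (fc (D.bdry (t₀ + t)) (i + 1)) = c) ?_ ?_ (t - t₀)
      · simpa using this
      · intro i hi
        rw [add_zero] at hi ⊢
        rw [← h2, nbr_inj (hi.trans h1.symm)]
      · intro t ht i hi
        rw [← add_assoc] at hi ⊢
        obtain ⟨i', j, e1, e2, e3, e4, e5, e6, e7⟩ := D.bdry_vertex (t₀ + t + 1)
        have := nbr_inj (hi.trans e1.symm)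
        subst this
        rw [add_sub_cancel_right] at e2
        have h3 := ht j (by rw [← e2, nbr_nbr])
        rw [← e2, fc_nbr_add_one] at h3
        rw [← h3]
        rcases e7 with ⟨rfl, e7⟩ | ⟨rfl, e7⟩
        · have := hX (D.bdry (t₀ + t + 1)) (i + 2) (by rwa [add_two_one])
            (by rwa [add_two_two])
          rw [add_two_one, add_two_two] at this
          rw [← this, add_one_two]
        · rw [add_two_two]
    · right; exact h
  have hout0 : ∀ t i, nbr (D.bdry t) i = D.bdry (t + 1) →
      S (fc (D.bdry t) (i + 1)) = false := by
    rcases hout false with h | h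
    · exact h
    · exfalso
      -- To the right of a face in the extreme column there is an outer face, and the next one in
      -- the row is already in the range where `S` vanishes.
      obtain ⟨a, b⟩ := f₀
      obtain ⟨t, ht, ht'⟩ := D.exists_bdry (v := (a + 1, b, false)) (i := 2)
        (by simpa [fc] using hf₀)
        (by
          intro hh
          have := hmax _ hh
          simp [fc] at this)
      refine h ⟨t, 2, by rw [← ht, ht'], ?_⟩
      rw [← ht]
      change S (a + 1, b) = false
      have := hX (a + 1, b, true) 2
        (by intro hh; have := hmax _ hh; simp [fc] at this)
        (by intro hh; have := hmax _ hh; simp [fc] at this)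
      change S (a + 1, b) = S (a + 1 + 1, b) at this
      rw [this, hS0]
      change a + 2 ≤ a + 1 + 1
      omega
  -- Blackening all outer faces changes no interface: there is none between two outer faces, and
  -- those along the boundary are black already.
  refine ⟨fun f => S f && decide (f ∈ D.faces), fun f hf => by simp at hf; exact hf.2, ?_⟩
  funext v i
  rw [← hS]
  unfold bd
  by_cases h1 : fc v (i + 1) ∈ D.faces <;> by_cases h2 : fc v (i + 2) ∈ D.faces
  · simp [h1, h2]
  · obtain ⟨t, ht, ht'⟩ := D.exists_bdry_rev h1 h2
    have := hout0 t i (by rw [← ht, nbr_nbr, ← ht'])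
    rw [← ht, fc_nbr_add_one] at this
    simp [h1, h2, this]
  · obtain ⟨t, ht, ht'⟩ := D.exists_bdry h2 h1
    have := hout0 t i (by rw [← ht, ht'])
    rw [← ht] at this
    simp [h1, h2, this]
  · simp [h1, h2, hX v i h1 h2]

/-- The difference of the two colourings does not change between adjacent faces, and the domain is
connected. -/
lemma eq_of_bd_eq {σ τ : Face → Bool} {f : Face} (hf : f ∈ D.faces) (h0 : σ f = τ f)
    (h : ∀ v i, fc v (i + 1) ∈ D.faces → fc v (i + 2) ∈ D.faces → bd σ v i = bd τ v i)
    {g : Face} (hg : g ∈ D.faces) : σ g = τ g := by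
  obtain ⟨γ, ⟨-, h1⟩, h2, h3, h4⟩ := D.connected f hf g hg
  have := chain_const (fun f => σ f ^^ τ f) h1 (by
    intro p hp q hq hpq
    obtain ⟨v, i, rfl, rfl⟩ := faceAdj_iff.1 hpq
    have := h v i (h2 _ hp) (h2 _ hq)
    unfold bd at this
    revert this
    change _ → (σ _ ^^ τ _) = (σ _ ^^ τ _)
    cases σ (fc v (i + 1)) <;> cases σ (fc v (i + 2)) <;> cases τ (fc v (i + 1)) <;>
      cases τ (fc v (i + 2)) <;> simp) h3 h4
  change (σ _ ^^ τ _) = (σ _ ^^ τ _) at this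
  rw [h0] at this
  revert this
  cases σ g <;> cases τ g <;> simp

end Domain
end HexPerc

/-! ### Colourings with prescribed inner interfaces. -/

namespace HexPerc

/-- The indicator of a Boolean, modulo two. -/
def bz (b : Bool) : ZMod 2 := if b then 1 else 0

lemma bz_xor (a b : Bool) : bz (a ^^ b) = bz a + bz b := by revert a b; decide

lemma bz_inj {a b : Bool} (h : bz a = bz b) : a = b := by revert a b; decide

lemma bz_decide (a : ZMod 2) : bz (decide (a = 1)) = a := by revert a; decide

namespace Domain

variable (D : Domain)

/-- The handshake lemma. -/
lemma sum_par_bdry {ζ : EdgeSet} (hs : IsSym ζ)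
    (hsupp : ∀ v i, ζ v i = true → fc v (i + 1) ∈ D.faces ∧ fc v (i + 2) ∈ D.faces)
    (hp : ∀ v ∉ Set.range D.bdry, par ζ v = false) :
    ∑ t : ZMod D.len, bz (par ζ (D.bdry t)) = 0 := by
  classical
  set VS := D.finite_vertices.toFinset with hVS
  have h1 : ∑ t : ZMod D.len, bz (par ζ (D.bdry t)) = ∑ v ∈ VS, bz (par ζ v) := by
    rw [← Finset.sum_image (s := Finset.univ) (g := D.bdry) (f := fun v => bz (par ζ v))
      D.bdry_injective.injOn]
    apply Finset.sum_subset
    · intro v hv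
      simp only [Finset.mem_image, Finset.mem_univ, true_and] at hv
      have := (D.mem_range_bdry (v := v)).1 hv
      simpa [VS] using this.1
    · intro v _ hv
      rw [hp v (by simpa using hv)]
      rfl
  have h2 : ∀ v, bz (par ζ v) = ∑ i : Fin 3, bz (ζ v i) := by
    intro v
    rw [Fin.sum_univ_three, par, bz_xor, bz_xor, add_assoc]
  rw [h1, Finset.sum_congr rfl fun v _ => h2 v, ← Finset.sum_product',
    ← Finset.sum_filter_add_sum_filter_not (VS ×ˢ Finset.univ) (fun d => ζ d.1 d.2 = true)]
  have h3 : ∑ d ∈ (VS ×ˢ Finset.univ).filter (fun d => ¬ ζ d.1 d.2 = true), bz (ζ d.1 d.2) =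
      0 := by
    refine Finset.sum_eq_zero fun d hd => ?_
    rw [Finset.mem_filter] at hd
    simp [hd.2, bz]
  rw [h3, add_zero]
  -- Reversing a dart pairs equal contributions, which cancel modulo two.
  refine Finset.sum_involution (fun d _ => (nbr d.1 d.2, d.2)) ?_ ?_ ?_ ?_
  · intro d _
    dsimp only
    rw [hs]
    exact CharTwo.add_self_eq_zero _
  · intro d _ _ h
    exact nbr_ne d.1 d.2 (congrArg Prod.fst h)
  · intro d hd
    simp only [Finset.mem_filter, Finset.mem_product, Finset.mem_univ, and_true] at hd ⊢
    refine ⟨?_, by rw [hs]; exact hd.2⟩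
    have := (hsupp _ _ hd.2).2
    rw [← fc_nbr_add_one] at this
    simpa [VS] using ⟨_, this⟩
  · intro d _
    simp [nbr_nbr]

/-- Take partial sums of `p` around the boundary; the vanishing total makes them consistent where
the cycle closes. The boundary edges selected by `o` repair the parities `p`. -/
lemma exists_alternating {p : ZMod D.len → Bool} (hp : ∑ t, bz (p t) = 0) :
    ∃ o : ZMod D.len → Bool, ∀ t, (o t ^^ o (t - 1)) = p t := by
  let s : ℕ → ZMod 2 := fun k => ∑ j ∈ Finset.range (k + 1), bz (p (j : ZMod D.len))
  have hs : s (D.len - 1) = 0 := by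
    change ∑ j ∈ Finset.range (D.len - 1 + 1), bz (p (j : ZMod D.len)) = 0
    rw [Nat.sub_add_cancel (Nat.one_le_iff_ne_zero.2 (NeZero.ne _)), ← hp]
    refine Finset.sum_nbij' (fun j => (j : ZMod D.len)) ZMod.val ?_ ?_ ?_ ?_ ?_
    · simp
    · intro t _; simpa using ZMod.val_lt t
    · intro j hj; exact ZMod.val_cast_of_lt (by simpa using hj)
    · simp
    · simp
  have hrec : ∀ t : ZMod D.len, s t.val = s (t - 1).val + bz (p t) := by
    intro t
    -- The predecessor of 0 has the largest representative, whose partial sum is the total.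
    by_cases h0 : t = 0
    · subst h0
      have : ((0 : ZMod D.len) - 1).val = D.len - 1 := by
        rw [zero_sub, ← Nat.pred_eq_sub_one]
        obtain ⟨m, hm⟩ := Nat.exists_eq_succ_of_ne_zero (NeZero.ne D.len)
        have : ∀ n, n = D.len → (-1 : ZMod n).val = n.pred := by
          rintro n rfl
          revert hm
          generalize D.len = n
          rintro rfl
          exact ZMod.val_neg_one m
        exact this _ rfl
      rw [this, hs, ZMod.val_zero]
      simp [s]
    · have hv : 1 ≤ t.val := Nat.one_le_iff_ne_zero.2 (by simpa [ZMod.val_eq_zero] using h0)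
      have : (t - 1).val = t.val - 1 := by
        have h1 : ((t.val - 1 : ℕ) : ZMod D.len) = t - 1 := by
          rw [Nat.cast_sub hv]; simp
        rw [← h1, ZMod.val_cast_of_lt]
        have := ZMod.val_lt t
        omega
      rw [this]
      change ∑ j ∈ Finset.range (t.val + 1), _ = ∑ j ∈ Finset.range (t.val - 1 + 1), _ + _
      rw [Nat.sub_add_cancel hv, Finset.sum_range_succ]
      simp
  refine ⟨fun t => decide (s t.val = 1), fun t => bz_inj ?_⟩
  rw [bz_xor, bz_decide, bz_decide, hrec t, add_right_comm, CharTwo.add_self_eq_zero, zero_add]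

/-- The boundary edges with a given property. -/
def bdrySet (o : ZMod D.len → Bool) : EdgeSet := open Classical in fun v i =>
  decide (∃ t, o t = true ∧ (v = D.bdry t ∧ nbr v i = D.bdry (t + 1) ∨
    v = D.bdry (t + 1) ∧ nbr v i = D.bdry t))

lemma isSym_bdrySet (o : ZMod D.len → Bool) : IsSym (D.bdrySet o) := by
  intro v i
  unfold bdrySet
  rw [nbr_nbr]
  congr 1
  simp only [eq_iff_iff]
  refine exists_congr fun t => and_congr_right fun _ => ?_
  tauto

lemma bdrySet_out (o : ZMod D.len → Bool) {t : ZMod D.len} {i : Fin 3}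
    (h : nbr (D.bdry t) i = D.bdry (t + 1)) : D.bdrySet o (D.bdry t) i = o t := by
  unfold bdrySet
  rw [Bool.eq_iff_iff, decide_eq_true_iff]
  constructor
  · rintro ⟨s, hs, ⟨h1, -⟩ | ⟨h1, h2⟩⟩
    · rwa [D.bdry_injective h1]
    -- A boundary edge run in both directions would have faces of the domain on both sides.
    · exfalso
      obtain ⟨i', e1, e2, e3⟩ := D.bdry_step s
      obtain ⟨j, g1, g2, g3⟩ := D.bdry_step t
      have hj : i = j := nbr_inj (h.trans g1)
      subst hj
      have hi : nbr (nbr (D.bdry s) i') i' = D.bdry s := nbr_nbr _ _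
      rw [← e1, ← h1, ← h2] at hi
      have := nbr_inj hi
      subst this
      rw [← fc_nbr_add_one, ← e1, ← h1] at e2
      exact g3 e2
  · intro hs
    exact ⟨t, hs, Or.inl ⟨rfl, h⟩⟩

lemma bdrySet_in (o : ZMod D.len → Bool) {t : ZMod D.len} {j : Fin 3}
    (h : nbr (D.bdry t) j = D.bdry (t - 1)) : D.bdrySet o (D.bdry t) j = o (t - 1) := by
  rw [← D.isSym_bdrySet, h]
  apply D.bdrySet_out
  rw [← h, nbr_nbr, sub_add_cancel]

lemma bdrySet_faces {o : ZMod D.len → Bool} {v : Vertex} {i : Fin 3}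
    (h : D.bdrySet o v i = true) :
    fc v (i + 2) ∈ D.faces ∧ fc v (i + 1) ∉ D.faces ∨
      fc v (i + 1) ∈ D.faces ∧ fc v (i + 2) ∉ D.faces := by
  unfold bdrySet at h
  rw [decide_eq_true_iff] at h
  obtain ⟨t, -, ⟨rfl, h⟩ | ⟨h1, h⟩⟩ := h
  · obtain ⟨j, e1, e2, e3⟩ := D.bdry_step t
    have := nbr_inj (h.trans e1)
    subst this
    exact Or.inl ⟨e2, e3⟩
  · obtain ⟨j, e1, e2, e3⟩ := D.bdry_step t
    have := nbr_inj (v := v) (i := i) (j := j) (by rw [h, h1, e1, nbr_nbr])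
    subst this
    rw [← h, fc_nbr_add_two] at e2
    rw [← h, fc_nbr_add_one] at e3
    exact Or.inr ⟨e2, e3⟩

lemma par_bdrySet (o : ZMod D.len → Bool) (t : ZMod D.len) :
    par (D.bdrySet o) (D.bdry t) = (o t ^^ o (t - 1)) := by
  obtain ⟨i, j, h1, h2, h3, h4, h5, h6, h7⟩ := D.bdry_vertex t
  have e1 := D.bdrySet_out o h1
  have e2 := D.bdrySet_in o h2
  rcases h7 with ⟨rfl, h7⟩ | ⟨rfl, h7⟩
  · have e3 : D.bdrySet o (D.bdry t) (i + 2) = false := by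
      by_contra h
      rw [Bool.not_eq_false] at h
      rcases D.bdrySet_faces h with h | h
      · rw [add_two_two] at h; exact h4 h.1
      · rw [add_two_one] at h; exact h7 h.1
    rw [par_eq _ _ i, e1, e2, e3, Bool.xor_false]
  · have e3 : D.bdrySet o (D.bdry t) (i + 1) = false := by
      by_contra h
      rw [Bool.not_eq_false] at h
      rcases D.bdrySet_faces h with h | h
      · rw [add_one_one] at h
        exact h.2 h3
      · rw [add_one_two] at h
        exact h.2 h7
    rw [par_eq _ _ i, e1, e2, e3, Bool.false_xor]

/-- An edge set of the interior which is even at every interior vertex separates the two colours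
of a colouring of the faces. -/
lemma exists_coloring {ζ : EdgeSet} (hs : IsSym ζ)
    (hsupp : ∀ v i, ζ v i = true → fc v (i + 1) ∈ D.faces ∧ fc v (i + 2) ∈ D.faces)
    (hp : ∀ v ∉ Set.range D.bdry, par ζ v = false) :
    ∃ σ : Face → Bool, (∀ f, σ f = true → f ∈ D.faces) ∧
      ∀ v i, fc v (i + 1) ∈ D.faces → fc v (i + 2) ∈ D.faces → bd σ v i = ζ v i := by
  -- The odd vertices of `ζ` are on the boundary and even in number, so adding boundary edges makes
  -- it even everywhere without touching the inner edges.
  obtain ⟨o, ho⟩ := D.exists_alternating (D.sum_par_bdry hs hsupp hp)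
  obtain ⟨S, hS, hS'⟩ := D.exists_bd_eq (X := fun v i => ζ v i ^^ D.bdrySet o v i)
    (hs.xor (D.isSym_bdrySet o)) (by
      intro v
      rw [par_xor]
      by_cases hv : v ∈ Set.range D.bdry
      · obtain ⟨t, rfl⟩ := hv
        rw [par_bdrySet, ho, Bool.xor_self]
      · rw [hp v hv, Bool.false_xor]
        have : ∀ i, D.bdrySet o v i = false := by
          intro i
          by_contra h
          rw [Bool.not_eq_false] at h
          refine hv (D.mem_range_bdry.2 ?_)
          rcases D.bdrySet_faces h with h | h
          · exact ⟨⟨_, h.1⟩, ⟨_, h.2⟩⟩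
          · exact ⟨⟨_, h.1⟩, ⟨_, h.2⟩⟩
        simp [par, this]) (by
      intro v i h
      by_cases hz : ζ v i = true
      · exact Or.inl (hsupp v i hz).1
      · rw [Bool.not_eq_true] at hz
        rw [hz, Bool.false_xor] at h
        rcases D.bdrySet_faces h with h | h
        · exact Or.inr h.1
        · exact Or.inl h.1)
  refine ⟨S, hS, fun v i h1 h2 => ?_⟩
  rw [hS']
  have : D.bdrySet o v i = false := by
    by_contra h
    rw [Bool.not_eq_false] at h
    rcases D.bdrySet_faces h with h | h
    · exact h.2 h1
    · exact h.2 h2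
  simp [this]

end Domain
end HexPerc

namespace HexPerc

/-! ### Legs of edge sets -/

/-- Oriented edges. -/
abbrev Dart := Vertex × Fin 3

/-- The end of a dart. -/
def hd (d : Dart) : Vertex := nbr d.1 d.2

/-- The face on the left. -/
def lf (d : Dart) : Face := fc d.1 (d.2 + 2)

/-- The face on the right. -/
def rf (d : Dart) : Face := fc d.1 (d.2 + 1)

/-- The opposite dart. -/
def rv (d : Dart) : Dart := (hd d, d.2)

lemma rv_rv (d : Dart) : rv (rv d) = d := by simp [rv, hd, nbr_nbr]

lemma hd_rv (d : Dart) : hd (rv d) = d.1 := by simp [rv, hd, nbr_nbr]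

lemma lf_rv (d : Dart) : lf (rv d) = rf d := by simp [rv, hd, lf, rf, fc_nbr_add_two]

lemma rf_rv (d : Dart) : rf (rv d) = lf d := by simp [rv, hd, lf, rf, fc_nbr_add_one]

/-- `e` continues `d` in the edge set `X`, at a vertex outside the set `Q` of stops. -/
def Step (X : EdgeSet) (Q : Set Vertex) (d e : Dart) : Prop :=
  e.1 = hd d ∧ e.2 ≠ d.2 ∧ X e.1 e.2 = true ∧ hd d ∉ Q

/-- The darts reached from `(x, k)` by following `X` up to the first stop. -/
def Leg (X : EdgeSet) (Q : Set Vertex) (x : Vertex) (k : Fin 3) : Set Dart :=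
  {d | Relation.ReflTransGen (Step X Q) (x, k) d}

/-- The alternatives are a right turn, which keeps the face on the right and meets a new one on the
left, and a left turn, which does the opposite. -/
lemma step_cases {X : EdgeSet} {Q : Set Vertex} {d e : Dart} (h : Step X Q d e) :
    (e.2 = d.2 + 1 ∧ rf e = rf d ∧ rf d = fc (hd d) (d.2 + 2) ∧ lf d = fc (hd d) (d.2 + 1) ∧
      lf e = fc (hd d) d.2) ∨
    (e.2 = d.2 + 2 ∧ lf e = lf d ∧ lf d = fc (hd d) (d.2 + 1) ∧ rf d = fc (hd d) (d.2 + 2) ∧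
      rf e = fc (hd d) d.2) := by
  obtain ⟨v, i⟩ := d
  obtain ⟨w, j⟩ := e
  obtain ⟨h1, h2, -, -⟩ := h
  dsimp only [hd] at h1 h2 ⊢
  subst h1
  simp only [lf, rf]
  rcases fin3_cases i j with rfl | rfl | rfl
  · exact absurd rfl h2
  · left
    simp only [add_one_one, add_one_two, fc_nbr_add_two, fc_nbr_add_one, and_self]
  · right
    simp only [add_two_one, add_two_two, fc_nbr_add_two, fc_nbr_add_one, and_self]

/-- The edge set is even outside the stops, of which `x` is one, and it is finite. -/
structure Good (X : EdgeSet) (Q : Set Vertex) (x : Vertex) : Prop where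
  sym : IsSym X
  even : ∀ v ∉ Q, par X v = false
  fin : {d : Dart | X d.1 d.2 = true}.Finite
  mem : x ∈ Q

section Legs

variable {X Y : EdgeSet} {Q : Set Vertex} {x : Vertex} {j k : Fin 3} {d e : Dart}

/-- At a trivalent vertex, even degree means 0 or 2. -/
lemma even_third {v : Vertex} {a b : Fin 3} (h : par X v = false) (hab : a ≠ b)
    (ha : X v a = true) (hb : X v b = true) {c : Fin 3} (hc : X v c = true) : c = a ∨ c = b := by
  rw [par_eq X v a] at h
  rcases fin3_cases a b with rfl | rfl | rfl
  · exact absurd rfl hab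
  · rcases fin3_cases a c with rfl | rfl | rfl
    · exact Or.inl rfl
    · exact Or.inr rfl
    · rw [ha, hb, hc] at h; simp at h
  · rcases fin3_cases a c with rfl | rfl | rfl
    · exact Or.inl rfl
    · rw [ha, hb, hc] at h; simp at h
    · exact Or.inr rfl

lemma even_exists {v : Vertex} {a : Fin 3} (h : par X v = false) (ha : X v a = true) :
    ∃ b, b ≠ a ∧ X v b = true := by
  rw [par_eq X v a, ha] at h
  by_cases h1 : X v (a + 1) = true
  · exact ⟨_, add_one_ne a, h1⟩
  · refine ⟨_, add_two_ne a, ?_⟩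
    rw [Bool.not_eq_true] at h1
    rw [h1] at h
    simpa using h

lemma IsSym.rv (hX : IsSym X) (d : Dart) : X (rv d).1 (rv d).2 = X d.1 d.2 := hX _ _

lemma Step.mem_right (h : Step X Q d e) : X e.1 e.2 = true := h.2.2.1

namespace Good

variable (hG : Good X Q x)

include hG

lemma step_unique (hd' : X d.1 d.2 = true) {e e' : Dart} (h : Step X Q d e)
    (h' : Step X Q d e') : e = e' := by
  have h1 : X (hd d) d.2 = true := by rw [← hd']; exact hG.sym _ _
  have h2 := h.mem_right
  have h3 := h'.mem_right
  rw [h.1] at h2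
  rw [h'.1] at h3
  rcases even_third (hG.even _ h.2.2.2) h.2.1.symm h1 h2 h3 with h4 | h4
  · exact absurd h4 h'.2.1
  · exact Prod.ext (h.1.trans h'.1.symm) h4.symm

/-- Degree two away from the stops makes the motion reversible. -/
lemma step_inj {d d' : Dart} (hd1 : X d.1 d.2 = true) (hd2 : X d'.1 d'.2 = true)
    (h : Step X Q d e) (h' : Step X Q d' e) : d = d' := by
  have hw : hd d = hd d' := h.1.symm.trans h'.1
  have h1 : X (hd d) d.2 = true := by rw [← hd1]; exact hG.sym _ _
  have h2 : X (hd d) d'.2 = true := by rw [hw, ← hd2]; exact hG.sym _ _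
  have h3 := h.mem_right
  rw [h.1] at h3
  rcases even_third (hG.even _ h.2.2.2) h.2.1.symm h1 h3 h2 with h4 | h4
  · rw [← rv_rv d, ← rv_rv d']
    congr 1
    exact Prod.ext hw h4.symm
  · exact absurd h4.symm h'.2.1

lemma exists_step (hd' : X d.1 d.2 = true) (hQ : hd d ∉ Q) : ∃ e, Step X Q d e := by
  have h1 : X (hd d) d.2 = true := by rw [← hd']; exact hG.sym _ _
  obtain ⟨b, hb, hb'⟩ := even_exists (hG.even _ hQ) h1
  exact ⟨(hd d, b), rfl, hb, hb', hQ⟩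

omit hG in
lemma _root_.HexPerc.mem_leg_start : (x, k) ∈ Leg X Q x k := Relation.ReflTransGen.refl

omit hG in
lemma _root_.HexPerc.mem_leg_step (h : d ∈ Leg X Q x k) (h' : Step X Q d e) : e ∈ Leg X Q x k :=
  Relation.ReflTransGen.tail h h'

omit hG in
lemma _root_.HexPerc.mem_of_mem_leg (hk : X x k = true) (h : d ∈ Leg X Q x k) :
    X d.1 d.2 = true := by
  induction h with
  | refl => exact hk
  | tail _ h _ => exact h.mem_right

omit hG in
lemma _root_.HexPerc.leg_cases (h : d ∈ Leg X Q x k) :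
    d = (x, k) ∨ ∃ e ∈ Leg X Q x k, Step X Q e d := by
  rcases Relation.ReflTransGen.cases_tail h with h | ⟨e, h1, h2⟩
  · exact Or.inl h
  · exact Or.inr ⟨e, h1, h2⟩

lemma not_step_start : ¬ Step X Q d (x, k) := fun h => h.2.2.2 (h.1 ▸ hG.mem)

/-- Without an end, following `X` would be an injective self-map of the finite leg, hence
surjective; but no step leads to the starting dart, since `x` is a stop. -/
lemma exists_leg_end (hk : X x k = true) : ∃ d ∈ Leg X Q x k, hd d ∈ Q := by
  by_contra hcon
  push Not at hcon
  have hs : ∀ d : {d // d ∈ Leg X Q x k}, ∃ e : {d // d ∈ Leg X Q x k}, Step X Q d.1 e.1 := by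
    intro d
    obtain ⟨e, he⟩ := hG.exists_step (mem_of_mem_leg hk d.2) (hcon _ d.2)
    exact ⟨⟨e, mem_leg_step d.2 he⟩, he⟩
  choose f hf using hs
  have hfin : Finite {d // d ∈ Leg X Q x k} :=
    (hG.fin.subset fun d hd => mem_of_mem_leg hk hd).to_subtype
  have hinj : Function.Injective f := by
    intro a b hab
    have h1 := hf a
    have h2 := hf b
    rw [← hab] at h2
    exact Subtype.ext (hG.step_inj (mem_of_mem_leg hk a.2) (mem_of_mem_leg hk b.2) h1 h2)
  obtain ⟨d, hd'⟩ := (Finite.injective_iff_surjective.1 hinj) ⟨(x, k), mem_leg_start⟩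
  have := hf d
  rw [hd'] at this
  exact hG.not_step_start this

/-- Along a leg, either of two darts is reached from the other one. -/
lemma leg_total (hk : X x k = true) (h : d ∈ Leg X Q x k) (h' : e ∈ Leg X Q x k) :
    Relation.ReflTransGen (Step X Q) d e ∨ Relation.ReflTransGen (Step X Q) e d := by
  induction h with
  | refl => exact Or.inl h'
  | @tail b c hb hbc ih =>
    rcases ih with ih | ih
    · rcases Relation.ReflTransGen.cases_head ih with rfl | ⟨c', h1, h2⟩
      · exact Or.inr (Relation.ReflTransGen.single hbc)
      · rw [hG.step_unique (mem_of_mem_leg hk hb) hbc h1]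
        exact Or.inl h2
    · exact Or.inr (ih.tail hbc)

lemma end_unique (hk : X x k = true) (h : d ∈ Leg X Q x k) (h' : e ∈ Leg X Q x k)
    (hd1 : hd d ∈ Q) (he1 : hd e ∈ Q) : d = e := by
  have aux : ∀ {d e : Dart}, Relation.ReflTransGen (Step X Q) d e → hd d ∈ Q → d = e := by
    intro d e h hQ
    rcases Relation.ReflTransGen.cases_head h with rfl | ⟨c', h1, -⟩
    · rfl
    · exact absurd hQ h1.2.2.2
  rcases hG.leg_total hk h h' with h | h
  · exact aux h hd1
  · exact (aux h he1).symm

/-- Tracing a common dart backwards by `step_inj`, both legs arrive at their starting darts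
simultaneously. -/
lemma leg_disjoint (hj : X x j = true) (hk : X x k = true) (h : d ∈ Leg X Q x j)
    (h' : d ∈ Leg X Q x k) : j = k := by
  induction h with
  | refl =>
    rcases leg_cases h' with h | ⟨e, -, h⟩
    · exact congrArg Prod.snd h
    · exact absurd h hG.not_step_start
  | @tail b c hb hbc ih =>
    rcases leg_cases h' with rfl | ⟨e, he, h⟩
    · exact absurd hbc hG.not_step_start
    · rw [← hG.step_inj (mem_of_mem_leg hj hb) (mem_of_mem_leg hk he) hbc h] at he
      exact ih he

/-- Reversal turns the steps of one leg into steps of the other, so a common edge can be followed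
back to `x`. -/
lemma rv_mem (hj : X x j = true) (h : d ∈ Leg X Q x j) (h' : rv d ∈ Leg X Q x k) :
    rv (x, j) ∈ Leg X Q x k := by
  induction h with
  | refl => exact h'
  | @tail b c hb hbc ih =>
    refine ih (mem_leg_step h' ⟨?_, ?_, ?_, ?_⟩)
    · rw [hd_rv, hbc.1]; rfl
    · exact hbc.2.1.symm
    · rw [hG.sym.rv]; exact mem_of_mem_leg hj hb
    · rw [hd_rv, hbc.1]; exact hbc.2.2.2

lemma rv_not_mem (hj : X x j = true) (hk : X x k = true)
    (hh : ∃ e ∈ Leg X Q x k, hd e ∈ Q ∧ hd e ≠ x) (h : d ∈ Leg X Q x j) :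
    rv d ∉ Leg X Q x k := by
  intro h'
  obtain ⟨e, he, he1, he2⟩ := hh
  have h1 := hG.rv_mem hj h h'
  have h2 : hd (rv (x, j)) = x := hd_rv _
  have := hG.end_unique hk h1 he (by rw [h2]; exact hG.mem) he1
  rw [← this] at he2
  exact he2 h2

end Good

/-- The edges of a leg. -/
noncomputable def legE (X : EdgeSet) (Q : Set Vertex) (x : Vertex) (k : Fin 3) : EdgeSet :=
  open Classical in
  fun v i => decide ((v, i) ∈ Leg X Q x k ∨ rv (v, i) ∈ Leg X Q x k)

lemma legE_iff {v : Vertex} {i : Fin 3} :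
    legE X Q x k v i = true ↔ (v, i) ∈ Leg X Q x k ∨ rv (v, i) ∈ Leg X Q x k := by
  simp [legE]

lemma isSym_legE : IsSym (legE X Q x k) := by
  intro v i
  rw [Bool.eq_iff_iff, legE_iff, legE_iff]
  change rv (v, i) ∈ _ ∨ rv (rv (v, i)) ∈ _ ↔ _
  rw [rv_rv, or_comm]

/-- A vertex is visited by a leg. -/
def Visits (X : EdgeSet) (Q : Set Vertex) (x : Vertex) (k : Fin 3) (w : Vertex) : Prop :=
  w ∉ Q ∧ ∃ d ∈ Leg X Q x k, hd d = w

namespace Good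

variable (hG : Good X Q x)

include hG

lemma legE_le (hk : X x k = true) {v : Vertex} {i : Fin 3} (h : legE X Q x k v i = true) :
    X v i = true := by
  rcases legE_iff.1 h with h | h
  · exact mem_of_mem_leg hk h
  · rw [← hG.sym]; exact mem_of_mem_leg hk h

lemma visits_of_legE (hk : X x k = true) {w : Vertex} (hw : w ∉ Q) {i : Fin 3}
    (h : legE X Q x k w i = true) : Visits X Q x k w := by
  refine ⟨hw, ?_⟩
  rcases legE_iff.1 h with h | h
  · rcases leg_cases h with h | ⟨e, he, h⟩
    · cases h; exact absurd hG.mem hw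
    · exact ⟨e, he, h.1.symm⟩
  · exact ⟨_, h, hd_rv _⟩

/-- A visited vertex is not a stop, so it has degree two in `X`, and the leg uses both edges. -/
lemma legE_eq_of_visits (hk : X x k = true) {w : Vertex} (h : Visits X Q x k w) (i : Fin 3) :
    legE X Q x k w i = X w i := by
  obtain ⟨hw, d, hd', rfl⟩ := h
  obtain ⟨e, he⟩ := hG.exists_step (mem_of_mem_leg hk hd') hw
  have h1 : legE X Q x k (hd d) d.2 = true := legE_iff.2 (Or.inr (by
    change rv (rv d) ∈ _; rwa [rv_rv]))
  have h2 : legE X Q x k (hd d) e.2 = true := legE_iff.2 (Or.inl (by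
    rw [← he.1]; exact mem_leg_step hd' he))
  rw [Bool.eq_iff_iff]
  refine ⟨hG.legE_le hk, fun h => ?_⟩
  rcases even_third (hG.even _ hw) he.2.1.symm (hG.legE_le hk h1) (hG.legE_le hk h2) h with
    rfl | rfl
  · exact h1
  · exact h2

lemma legE_eq_false (hk : X x k = true) {w : Vertex} (hw : w ∉ Q) (h : ¬ Visits X Q x k w)
    (i : Fin 3) : legE X Q x k w i = false := by
  by_contra hcon
  rw [Bool.not_eq_false] at hcon
  exact h (hG.visits_of_legE hk hw hcon)

lemma par_legE (hk : X x k = true) {w : Vertex} (hw : w ∉ Q) : par (legE X Q x k) w = false := by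
  by_cases h : Visits X Q x k w
  · rw [← hG.even w hw]
    unfold par
    simp only [hG.legE_eq_of_visits hk h]
  · unfold par
    simp only [hG.legE_eq_false hk hw h]
    rfl

lemma legE_start (hk : X x k = true) (hh : ∃ e ∈ Leg X Q x k, hd e ∈ Q ∧ hd e ≠ x) (i : Fin 3) :
    legE X Q x k x i = true ↔ i = k := by
  rw [legE_iff]
  constructor
  · rintro (h | h)
    · rcases leg_cases h with h | ⟨e, he, h⟩
      · exact congrArg Prod.snd h
      · exact absurd h hG.not_step_start
    · exfalso
      obtain ⟨e, he, he1, he2⟩ := hh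
      have h2 : hd (rv (x, i)) = x := hd_rv _
      have := hG.end_unique hk h he (by rw [h2]; exact hG.mem) he1
      rw [← this] at he2
      exact he2 h2
  · rintro rfl
    exact Or.inl mem_leg_start

/-- Two different legs which end at other stops than `x` visit different vertices. -/
lemma not_visits (hj : X x j = true) (hk : X x k = true) (hjk : j ≠ k)
    (hh : ∃ e ∈ Leg X Q x k, hd e ∈ Q ∧ hd e ≠ x) {w : Vertex} (h : Visits X Q x j w) :
    ¬ Visits X Q x k w := by
  intro h'
  obtain ⟨hw, d, hd', rfl⟩ := h
  have h1 : X (hd d) d.2 = true := by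
    rw [← mem_of_mem_leg hj hd']; exact hG.sym _ _
  rw [← hG.legE_eq_of_visits hk h'] at h1
  rcases legE_iff.1 h1 with h1 | h1
  · exact hG.rv_not_mem hj hk hh hd' h1
  · change rv (rv d) ∈ _ at h1
    rw [rv_rv] at h1
    exact hjk (hG.leg_disjoint hj hk hd' h1)

/-- A colouring which does not change across the third edge at the visited vertices is constant
on either side of a leg. -/
lemma side_const {σ : Face → Bool} (hk : X x k = true)
    (hσ : ∀ w, Visits X Q x k w → ∀ i, X w i = false → bd σ w i = false)
    (h : d ∈ Leg X Q x k) : σ (lf d) = σ (lf (x, k)) ∧ σ (rf d) = σ (rf (x, k)) := by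
  induction h with
  | refl => exact ⟨rfl, rfl⟩
  | @tail b c hb hbc ih =>
    rw [← ih.1, ← ih.2]
    have hv : Visits X Q x k (hd b) := ⟨hbc.2.2.2, b, hb, rfl⟩
    have hb1 : X (hd b) b.2 = true := by
      rw [← mem_of_mem_leg hk hb]; exact hG.sym _ _
    have hc1 := hbc.mem_right
    rw [hbc.1] at hc1
    have h3 : ∀ i, i ≠ b.2 → i ≠ c.2 → X (hd b) i = false := by
      intro i h1 h2
      by_contra h
      rw [Bool.not_eq_false] at h
      rcases even_third (hG.even _ hv.1) hbc.2.1.symm hb1 hc1 h with h | h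
      · exact h1 h
      · exact h2 h
    rcases step_cases hbc with ⟨e1, e2, e3, e4, e5⟩ | ⟨e1, e2, e3, e4, e5⟩
    · have := bool_of_bd_false (hσ _ hv _ (h3 (b.2 + 2) (add_two_ne _) (by
        rw [e1]; exact add_two_ne_add_one _)))
      rw [add_two_one, add_two_two] at this
      rw [e2, e4, e5, this]
      exact ⟨rfl, rfl⟩
    · have := bool_of_bd_false (hσ _ hv _ (h3 (b.2 + 1) (add_one_ne _) (by
        rw [e1]; exact (add_two_ne_add_one _).symm)))
      rw [add_one_one, add_one_two] at this
      rw [e2, e4, e5, this]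
      exact ⟨rfl, rfl⟩

/-- Every face at a visited vertex lies along the leg. -/
lemma face_of_visits (hk : X x k = true) {w : Vertex} (h : Visits X Q x k w) (i : Fin 3) :
    ∃ d ∈ Leg X Q x k, fc w i = lf d ∨ fc w i = rf d := by
  obtain ⟨hw, d, hd', rfl⟩ := h
  obtain ⟨e, he⟩ := hG.exists_step (mem_of_mem_leg hk hd') hw
  have he' := mem_leg_step hd' he
  rcases step_cases he with ⟨-, -, e3, e4, e5⟩ | ⟨-, -, e3, e4, e5⟩ <;>
    rcases fin3_cases d.2 i with rfl | rfl | rfl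
  · exact ⟨e, he', Or.inl e5.symm⟩
  · exact ⟨d, hd', Or.inl e4.symm⟩
  · exact ⟨d, hd', Or.inr e3.symm⟩
  · exact ⟨e, he', Or.inr e5.symm⟩
  · exact ⟨d, hd', Or.inl e3.symm⟩
  · exact ⟨d, hd', Or.inr e4.symm⟩

end Good

/-- A step consults the edge set only at the vertex where it turns. -/
lemma leg_congr (h : ∀ w, Visits X Q x k w → ∀ i, Y w i = X w i) :
    Leg Y Q x k = Leg X Q x k := by
  ext d
  constructor
  · intro h'
    induction h' with
    | refl => exact mem_leg_start
    | @tail b c _ hbc ih =>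
      refine mem_leg_step ih ⟨hbc.1, hbc.2.1, ?_, hbc.2.2.2⟩
      have h1 := hbc.mem_right
      rw [hbc.1] at h1 ⊢
      rwa [h _ ⟨hbc.2.2.2, b, ih, rfl⟩] at h1
  · intro h'
    induction h' with
    | refl => exact mem_leg_start
    | @tail b c hb hbc ih =>
      refine mem_leg_step ih ⟨hbc.1, hbc.2.1, ?_, hbc.2.2.2⟩
      have h1 := hbc.mem_right
      rw [hbc.1] at h1 ⊢
      rwa [h _ ⟨hbc.2.2.2, b, hb, rfl⟩]

end Legs
end HexPerc

/-! ### Tripods, triples of legs, and colour switching. -/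

namespace HexPerc

/-- The exclusive union of two edge sets. -/
def xorE (X Y : EdgeSet) : EdgeSet := fun v i => X v i ^^ Y v i

namespace Domain

variable (D : Domain) (A : Set (ZMod D.len))

/-- The boundary edges in `A`. -/
noncomputable def free : EdgeSet := open Classical in D.bdrySet fun t => decide (t ∈ A)

/-- The endpoints of the boundary edges in `A`. -/
def term : Set Vertex := {v | ∃ t, v = D.bdry t ∧ (t ∈ A ∨ t - 1 ∈ A)}

/-- The edges, except the boundary edges in `A`, which separate colours. -/
noncomputable def cut (σ : Face → Bool) : EdgeSet := fun v i => bd σ v i && !D.free A v i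

/-- The places where legs stop. -/
def stops (x : Vertex) : Set Vertex := insert x (D.term A)

/-- Three disjoint legs from `x` to the boundary, and loops. -/
structure Src (x : Vertex) (ξ : EdgeSet) : Prop where
  sym : IsSym ξ
  supp : ∀ v i, ξ v i = true → (fc v (i + 1) ∈ D.faces ∨ fc v (i + 2) ∈ D.faces) ∧
    D.free A v i = false
  even : ∀ v ∉ D.stops A x, par ξ v = false
  start : ∀ k, ξ x k = true
  hits : ∀ k, ∃ d ∈ Leg ξ (D.stops A x) x k, hd d ∈ D.term A

/-- The colouring `σ` is black at the `i`-th face at `x` and white at the other two, and the two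
interfaces starting at `x` end at the boundary and do not share white faces. -/
structure Tripod (x : Vertex) (i : Fin 3) (σ : Face → Bool) : Prop where
  black : σ (fc x i) = false
  white₁ : σ (fc x (i + 1)) = true
  white₂ : σ (fc x (i + 2)) = true
  hits₁ : ∃ d ∈ Leg (D.cut A σ) (D.stops A x) x (i + 1), hd d ∈ D.term A
  hits₂ : ∃ d ∈ Leg (D.cut A σ) (D.stops A x) x (i + 2), hd d ∈ D.term A
  disj : ∀ d ∈ Leg (D.cut A σ) (D.stops A x) x (i + 1),
    ∀ e ∈ Leg (D.cut A σ) (D.stops A x) x (i + 2), rf d ≠ lf e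

/-- The faces to the right of a leg. -/
noncomputable def rightFaces (X : EdgeSet) (x : Vertex) (k : Fin 3) : Face → Bool :=
  open Classical in fun f => decide (∃ d ∈ Leg X (D.stops A x) x k, rf d = f)

/-- `ω` is a colouring whose interfaces are the edges of `ξ` outside the `k`-th leg. -/
structure IsCol (x : Vertex) (ξ : EdgeSet) (k : Fin 3) (ω : Face → Bool) : Prop where
  supp : ∀ f, ω f = true → f ∈ D.faces
  eq : D.cut A ω = xorE ξ (legE ξ (D.stops A x) x k)

/-- The three legs obtained by turning the white faces to the right of an interface black. -/
noncomputable def toSrc (x : Vertex) (i : Fin 3) (σ : Face → Bool) : EdgeSet :=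
  xorE (D.cut A fun f => σ f ^^ D.rightFaces A (D.cut A σ) x (i + 1) f)
    (legE (D.cut A σ) (D.stops A x) x (i + 1))

variable {D A} {x : Vertex} {i : Fin 3} {σ : Face → Bool} {ξ : EdgeSet}

lemma rightFaces_iff {X : EdgeSet} {k : Fin 3} {f : Face} :
    D.rightFaces A X x k f = true ↔ ∃ d ∈ Leg X (D.stops A x) x k, rf d = f := by
  simp [rightFaces]

lemma rightFaces_congr {X Y : EdgeSet} {k : Fin 3}
    (h : Leg X (D.stops A x) x k = Leg Y (D.stops A x) x k) :
    D.rightFaces A X x k = D.rightFaces A Y x k := by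
  unfold rightFaces
  rw [h]

lemma _root_.HexPerc.legE_congr {X Y : EdgeSet} {Q Q' : Set Vertex} {k : Fin 3}
    (h : Leg X Q x k = Leg Y Q' x k) : legE X Q x k = legE Y Q' x k := by
  unfold legE
  rw [h]

lemma term_subset : D.term A ⊆ Set.range D.bdry := by
  rintro v ⟨t, rfl, -⟩
  exact ⟨t, rfl⟩

lemma free_eq_false {v : Vertex} (hv : v ∉ D.term A) (k : Fin 3) : D.free A v k = false := by
  by_contra h
  rw [Bool.not_eq_false] at h
  unfold free bdrySet at h
  rw [decide_eq_true_iff] at h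
  obtain ⟨t, ht, ⟨rfl, -⟩ | ⟨rfl, -⟩⟩ := h
  · exact hv ⟨t, rfl, Or.inl (by simpa using ht)⟩
  · exact hv ⟨t + 1, rfl, Or.inr (by simpa using ht)⟩

lemma free_interior {v : Vertex} {k : Fin 3} (h1 : fc v (k + 1) ∈ D.faces)
    (h2 : fc v (k + 2) ∈ D.faces) : D.free A v k = false := by
  by_contra h
  rw [Bool.not_eq_false] at h
  rcases D.bdrySet_faces h with h | h
  · exact h.2 h1
  · exact h.2 h2

lemma isSym_cut : IsSym (D.cut A σ) := by
  intro v k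
  unfold cut
  rw [isSym_bd σ v k]
  congr 2
  exact D.isSym_bdrySet _ v k

lemma cut_eq_bd {v : Vertex} (hv : v ∉ D.term A) (k : Fin 3) : D.cut A σ v k = bd σ v k := by
  unfold cut
  rw [free_eq_false hv]
  simp

lemma cut_interior {v : Vertex} {k : Fin 3} (h1 : fc v (k + 1) ∈ D.faces)
    (h2 : fc v (k + 2) ∈ D.faces) : D.cut A σ v k = bd σ v k := by
  unfold cut
  rw [free_interior h1 h2]
  simp

lemma par_cut {v : Vertex} (hv : v ∉ D.term A) : par (D.cut A σ) v = false := by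
  rw [← par_bd σ v]
  unfold par
  simp only [cut_eq_bd hv]

lemma bd_supp (hσ : ∀ f, σ f = true → f ∈ D.faces) {v : Vertex} {k : Fin 3}
    (h : bd σ v k = true) : fc v (k + 1) ∈ D.faces ∨ fc v (k + 2) ∈ D.faces := by
  unfold bd at h
  by_cases h1 : σ (fc v (k + 1)) = true
  · exact Or.inl (hσ _ h1)
  · rw [Bool.not_eq_true] at h1
    rw [h1, Bool.false_xor] at h
    exact Or.inr (hσ _ h)

lemma cut_supp (hσ : ∀ f, σ f = true → f ∈ D.faces) {v : Vertex} {k : Fin 3}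
    (h : D.cut A σ v k = true) : (fc v (k + 1) ∈ D.faces ∨ fc v (k + 2) ∈ D.faces) ∧
      D.free A v k = false := by
  unfold cut at h
  rw [Bool.and_eq_true, Bool.not_eq_true'] at h
  exact ⟨bd_supp hσ h.1, h.2⟩

lemma finite_darts {X : EdgeSet} (hX : ∀ v i, X v i = true → fc v (i + 1) ∈ D.faces ∨
    fc v (i + 2) ∈ D.faces) : {d : Dart | X d.1 d.2 = true}.Finite := by
  refine (D.finite_vertices.prod (Set.finite_univ (α := Fin 3))).subset ?_
  rintro ⟨v, i⟩ h
  refine ⟨?_, trivial⟩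
  rcases hX v i h with h | h
  · exact ⟨_, h⟩
  · exact ⟨_, h⟩

lemma not_mem_term (hx : x ∉ Set.range D.bdry) : x ∉ D.term A := fun h => hx (term_subset h)

lemma good_cut (hσ : ∀ f, σ f = true → f ∈ D.faces) :
    Good (D.cut A σ) (D.stops A x) x where
  sym := isSym_cut
  even v hv := par_cut fun h => hv (Or.inr h)
  fin := finite_darts fun _ _ h => (cut_supp hσ h).1
  mem := Or.inl rfl

lemma Src.good (h : D.Src A x ξ) : Good ξ (D.stops A x) x where
  sym := h.sym
  even := h.even
  fin := finite_darts fun v i hv => (h.supp v i hv).1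
  mem := Or.inl rfl

lemma hits_of_term (hx : x ∉ Set.range D.bdry) {X : EdgeSet} {k : Fin 3}
    (h : ∃ d ∈ Leg X (D.stops A x) x k, hd d ∈ D.term A) :
    ∃ d ∈ Leg X (D.stops A x) x k, hd d ∈ D.stops A x ∧ hd d ≠ x := by
  obtain ⟨d, hd1, h⟩ := h
  exact ⟨d, hd1, Or.inr h, fun h' => not_mem_term hx (h' ▸ h)⟩

lemma par_xorE {X Y : EdgeSet} {v : Vertex} (hX : par X v = false) (hY : par Y v = false) :
    par (xorE X Y) v = false := by
  unfold xorE
  rw [par_xor, hX, hY]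
  rfl

section Colours

variable (hσ : ∀ f, σ f = true → f ∈ D.faces) (hx : x ∉ Set.range D.bdry)
  (h0 : σ (fc x i) = false) (h1 : σ (fc x (i + 1)) = true) (h2 : σ (fc x (i + 2)) = true)

include hx h0 h1 h2

lemma cut_start (k : Fin 3) : D.cut A σ x k = true ↔ k ≠ i := by
  rw [cut_eq_bd (not_mem_term hx)]
  unfold bd
  rcases fin3_cases i k with rfl | rfl | rfl
  · simp [h1, h2]
  · simp [add_one_one, add_one_two, h0, h2]
  · simp [add_two_one, add_two_two, h0, h1]

include hσ

/-- Off the interface no colours are separated at the visited vertices, so `side_const` propagates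
the colours seen at `x`. -/
lemma cut_side₁ {d : Dart} (h : d ∈ Leg (D.cut A σ) (D.stops A x) x (i + 1)) :
    σ (lf d) = false ∧ σ (rf d) = true := by
  have h3 := (good_cut (A := A) (x := x) hσ).side_const
    ((cut_start hx h0 h1 h2 _).2 (add_one_ne i))
    (σ := σ) (fun w hw k hk => by rwa [← cut_eq_bd fun h => hw.1 (Or.inr h)]) h
  rw [h3.1, h3.2]
  simp [lf, rf, add_one_one, add_one_two, h0, h2]

lemma cut_side₂ {d : Dart} (h : d ∈ Leg (D.cut A σ) (D.stops A x) x (i + 2)) :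
    σ (lf d) = true ∧ σ (rf d) = false := by
  have h3 := (good_cut (A := A) (x := x) hσ).side_const
    ((cut_start hx h0 h1 h2 _).2 (add_two_ne i))
    (σ := σ) (fun w hw k hk => by rwa [← cut_eq_bd fun h => hw.1 (Or.inr h)]) h
  rw [h3.1, h3.2]
  simp [lf, rf, add_two_one, add_two_two, h0, h1]

end Colours

namespace Tripod

variable (hσ : ∀ f, σ f = true → f ∈ D.faces) (hT : D.Tripod A x i σ)
  (hx : x ∉ Set.range D.bdry)

include hσ hT hx

omit hσ in
lemma start : ∀ k, D.cut A σ x k = true ↔ k ≠ i :=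
  cut_start hx hT.black hT.white₁ hT.white₂

lemma side₁ {d : Dart} (h : d ∈ Leg (D.cut A σ) (D.stops A x) x (i + 1)) :
    σ (lf d) = false ∧ σ (rf d) = true :=
  cut_side₁ hσ hx hT.black hT.white₁ hT.white₂ h

lemma side₂ {d : Dart} (h : d ∈ Leg (D.cut A σ) (D.stops A x) x (i + 2)) :
    σ (lf d) = true ∧ σ (rf d) = false :=
  cut_side₂ hσ hx hT.black hT.white₁ hT.white₂ h

/-- The colouring in which the faces to the right of an interface have been turned black. -/
lemma flip_le {f : Face} (h : D.rightFaces A (D.cut A σ) x (i + 1) f = true) : σ f = true := by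
  obtain ⟨d, hd', rfl⟩ := rightFaces_iff.1 h
  exact (hT.side₁ hσ hx hd').2

lemma rightFaces_lf₁ {d : Dart} (h : d ∈ Leg (D.cut A σ) (D.stops A x) x (i + 1)) :
    D.rightFaces A (D.cut A σ) x (i + 1) (lf d) = false := by
  by_contra h'
  rw [Bool.not_eq_false] at h'
  have := hT.flip_le hσ hx h'
  rw [(hT.side₁ hσ hx h).1] at this
  simp at this

lemma rightFaces_rf₁ {d : Dart} (h : d ∈ Leg (D.cut A σ) (D.stops A x) x (i + 1)) :
    D.rightFaces A (D.cut A σ) x (i + 1) (rf d) = true := rightFaces_iff.2 ⟨d, h, rfl⟩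

/-- This is where `Tripod.disj` enters: the flip leaves the white side of the second interface
alone. -/
lemma rightFaces_lf₂ {d : Dart} (h : d ∈ Leg (D.cut A σ) (D.stops A x) x (i + 2)) :
    D.rightFaces A (D.cut A σ) x (i + 1) (lf d) = false := by
  by_contra h'
  rw [Bool.not_eq_false] at h'
  obtain ⟨e, he, he'⟩ := rightFaces_iff.1 h'
  exact hT.disj e he d h he'

lemma rightFaces_rf₂ {d : Dart} (h : d ∈ Leg (D.cut A σ) (D.stops A x) x (i + 2)) :
    D.rightFaces A (D.cut A σ) x (i + 1) (rf d) = false := by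
  by_contra h'
  rw [Bool.not_eq_false] at h'
  have := hT.flip_le hσ hx h'
  rw [(hT.side₂ hσ hx h).2] at this
  simp at this

/-- After the flip all faces at a vertex of this leg are black, so the flipped colouring contributes
no edge there and only the leg itself remains. -/
lemma toSrc_visits₁ {w : Vertex} (hw : Visits (D.cut A σ) (D.stops A x) x (i + 1) w) (k : Fin 3) :
    D.toSrc A x i σ w k = D.cut A σ w k := by
  have hG := good_cut (A := A) (x := x) hσ
  have hk := (hT.start hx _).2 (add_one_ne i)
  have hf : ∀ k, (σ (fc w k) ^^ D.rightFaces A (D.cut A σ) x (i + 1) (fc w k)) = false := by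
    intro k
    obtain ⟨d, hd', h | h⟩ := hG.face_of_visits hk hw k
    · rw [h, hT.rightFaces_lf₁ hσ hx hd', (hT.side₁ hσ hx hd').1]; rfl
    · rw [h, hT.rightFaces_rf₁ hσ hx hd', (hT.side₁ hσ hx hd').2]; rfl
  unfold toSrc xorE
  rw [cut_eq_bd (fun h => hw.1 (Or.inr h)), hG.legE_eq_of_visits hk hw]
  unfold bd
  beta_reduce
  rw [hf, hf]
  simp

/-- No face along this leg is flipped, and the leg `i + 1` visits none of its vertices. -/
lemma toSrc_visits₂ {w : Vertex} (hw : Visits (D.cut A σ) (D.stops A x) x (i + 2) w) (k : Fin 3) :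
    D.toSrc A x i σ w k = D.cut A σ w k := by
  have hG := good_cut (A := A) (x := x) hσ
  have hk := (hT.start hx _).2 (add_one_ne i)
  have hk2 := (hT.start hx _).2 (add_two_ne i)
  have hf : ∀ k, (σ (fc w k) ^^ D.rightFaces A (D.cut A σ) x (i + 1) (fc w k)) = σ (fc w k) := by
    intro k
    obtain ⟨d, hd', h | h⟩ := hG.face_of_visits hk2 hw k
    · rw [h, hT.rightFaces_lf₂ hσ hx hd', Bool.xor_false]
    · rw [h, hT.rightFaces_rf₂ hσ hx hd', Bool.xor_false]
  unfold toSrc xorE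
  rw [cut_eq_bd (fun h => hw.1 (Or.inr h)), cut_eq_bd (fun h => hw.1 (Or.inr h)),
    hG.legE_eq_false hk hw.1
      (hG.not_visits hk2 hk (add_two_ne_add_one i) (hits_of_term hx hT.hits₁) hw)]
  unfold bd
  beta_reduce
  rw [hf, hf]
  simp

lemma leg_toSrc₁ : Leg (D.toSrc A x i σ) (D.stops A x) x (i + 1) =
    Leg (D.cut A σ) (D.stops A x) x (i + 1) :=
  leg_congr fun _ hw k => hT.toSrc_visits₁ hσ hx hw k

lemma leg_toSrc₂ : Leg (D.toSrc A x i σ) (D.stops A x) x (i + 2) =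
    Leg (D.cut A σ) (D.stops A x) x (i + 2) :=
  leg_congr fun _ hw k => hT.toSrc_visits₂ hσ hx hw k

/-- These colours explain the three legs: the interfaces of the flipped colouring leave `x` in the
directions `i` and `i + 2`, and the old interface `i + 1` is added back. -/
lemma flip_values : (σ (fc x i) ^^ D.rightFaces A (D.cut A σ) x (i + 1) (fc x i)) = false ∧
    (σ (fc x (i + 1)) ^^ D.rightFaces A (D.cut A σ) x (i + 1) (fc x (i + 1))) = true ∧
    (σ (fc x (i + 2)) ^^ D.rightFaces A (D.cut A σ) x (i + 1) (fc x (i + 2))) = false := by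
  have h1 := hT.rightFaces_lf₁ hσ hx mem_leg_start
  have h2 := hT.rightFaces_rf₁ hσ hx mem_leg_start
  have h3 := hT.rightFaces_lf₂ hσ hx mem_leg_start
  simp only [lf, rf, add_one_one, add_one_two, add_two_two] at h1 h2 h3
  simp [h1, h2, h3, hT.black, hT.white₁, hT.white₂]

lemma toSrc_start (k : Fin 3) : D.toSrc A x i σ x k = true := by
  have hG := good_cut (A := A) (x := x) hσ
  have hk := (hT.start hx _).2 (add_one_ne i)
  have hl := hG.legE_start hk (hits_of_term hx hT.hits₁) k
  obtain ⟨f1, f2, f3⟩ := hT.flip_values hσ hx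
  unfold toSrc xorE
  rw [cut_eq_bd (not_mem_term hx)]
  unfold bd
  beta_reduce
  rcases fin3_cases i k with rfl | rfl | rfl
  · rw [f2, f3]
    have : ¬ k = k + 1 := (add_one_ne k).symm
    simpa [this] using hl
  · rw [add_one_one, add_one_two, f1, f3]
    simpa using hl
  · rw [add_two_one, add_two_two, f1, f2]
    simpa [add_two_ne_add_one] using hl

lemma flip_supp : ∀ f, (σ f ^^ D.rightFaces A (D.cut A σ) x (i + 1) f) = true → f ∈ D.faces := by
  intro f hf
  by_cases h : σ f = true
  · exact hσ f h
  · rw [Bool.not_eq_true] at h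
    rw [h, Bool.false_xor] at hf
    exact hσ f (hT.flip_le hσ hx hf)

/-- The legs `i + 1` and `i + 2` are the old interfaces. The leg `i` is new, and the only danger is
that it comes back to `x`. -/
lemma toSrc_src : D.Src A x (D.toSrc A x i σ) := by
  have hG := good_cut (A := A) (x := x) hσ
  have hk := (hT.start hx _).2 (add_one_ne i)
  have hs : IsSym (D.toSrc A x i σ) := isSym_cut.xor isSym_legE
  have hsupp : ∀ v k, D.toSrc A x i σ v k = true →
      (fc v (k + 1) ∈ D.faces ∨ fc v (k + 2) ∈ D.faces) ∧ D.free A v k = false := by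
    intro v k h
    by_cases h' : legE (D.cut A σ) (D.stops A x) x (i + 1) v k = true
    · exact cut_supp hσ (hG.legE_le hk h')
    · unfold toSrc xorE at h
      rw [Bool.not_eq_true] at h'
      rw [h', Bool.xor_false] at h
      exact cut_supp (hT.flip_supp hσ hx) h
  have heven : ∀ v ∉ D.stops A x, par (D.toSrc A x i σ) v = false := fun v hv =>
    par_xorE (par_cut fun h => hv (Or.inr h)) (hG.par_legE hk hv)
  have hG' : Good (D.toSrc A x i σ) (D.stops A x) x :=
    ⟨hs, heven, finite_darts fun v i hv => (hsupp v i hv).1, Or.inl rfl⟩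
  have h1 : ∃ d ∈ Leg (D.toSrc A x i σ) (D.stops A x) x (i + 1), hd d ∈ D.term A := by
    rw [hT.leg_toSrc₁ hσ hx]; exact hT.hits₁
  have h2 : ∃ d ∈ Leg (D.toSrc A x i σ) (D.stops A x) x (i + 2), hd d ∈ D.term A := by
    rw [hT.leg_toSrc₂ hσ hx]; exact hT.hits₂
  refine ⟨hs, hsupp, heven, hT.toSrc_start hσ hx, fun k => ?_⟩
  rcases fin3_cases i k with rfl | rfl | rfl
  · obtain ⟨d, hd', hq⟩ := hG'.exists_leg_end (hT.toSrc_start hσ hx k)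
    refine ⟨d, hd', ?_⟩
    rcases hq with hq | hq
    swap
    · exact hq
    exfalso
    -- A returning leg `i` has white on its right and black on its left all along, which at `x`
    -- forces arrival through the edge `i + 2`; but the leg `i + 2` ends at the boundary.
    have hside := hG'.side_const
      (σ := fun f => σ f ^^ D.rightFaces A (D.cut A σ) x (k + 1) f)
      (hT.toSrc_start hσ hx k) (fun w hw j hj => by
        rw [← cut_eq_bd (A := A) fun h => hw.1 (Or.inr h)]
        have h3 := hG'.not_visits (hT.toSrc_start hσ hx k) (hT.toSrc_start hσ hx (k + 1))
          (add_one_ne k).symm (hits_of_term hx h1) hw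
        have h4 := hG'.legE_eq_false (hT.toSrc_start hσ hx (k + 1)) hw.1 h3 j
        rw [legE_congr (hT.leg_toSrc₁ hσ hx)] at h4
        unfold toSrc xorE at hj
        rwa [h4, Bool.xor_false] at hj) hd'
    obtain ⟨f1, f2, f3⟩ := hT.flip_values hσ hx
    have e : d = rv (x, d.2) := by
      rw [← hq]
      exact (rv_rv d).symm
    rw [e, lf_rv, rf_rv] at hside
    simp only [lf, rf] at hside
    rw [f2, f3] at hside
    have e2 : d.2 = k + 2 := by
      rcases fin3_cases k d.2 with h | h | h
      · rw [h, f2] at hside; simp at hside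
      · rw [h, add_one_two, f1] at hside; simp at hside
      · exact h
    refine hG'.rv_not_mem (hT.toSrc_start hσ hx k) (hT.toSrc_start hσ hx (k + 2))
      (hits_of_term hx h2) hd' ?_
    rw [e, rv_rv, e2]
    exact mem_leg_start
  · exact h1
  · exact h2

end Tripod

section Col

variable {k : Fin 3} {ω : Face → Bool} (hx : x ∉ Set.range D.bdry) (hS : D.Src A x ξ)
  (hω : D.IsCol A x ξ k ω)

include hx hS hω

lemma IsCol.bd_start (j : Fin 3) : bd ω x j = decide (j ≠ k) := by
  rw [← cut_eq_bd (A := A) (not_mem_term hx), hω.eq]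
  unfold xorE
  rw [hS.start, Bool.true_xor]
  have := hS.good.legE_start (hS.start k) (hits_of_term hx (hS.hits k)) j
  by_cases h : j = k
  · rw [this.2 h]
    simp [h]
  · simp [h] at this
    simp [this, h]

/-- A leg other than `k` is an interface of `ω`, while around the vertices of the leg `k` there is
no interface at all; in both cases the colour on each side persists. -/
lemma IsCol.side {j : Fin 3} {d : Dart} (h : d ∈ Leg ξ (D.stops A x) x j) :
    ω (lf d) = ω (fc x (j + 2)) ∧ ω (rf d) = ω (fc x (j + 1)) := by
  refine hS.good.side_const (hS.start j) (fun w hw a ha => ?_) h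
  rw [← cut_eq_bd (A := A) fun h => hw.1 (Or.inr h), hω.eq]
  unfold xorE
  by_cases hjk : j = k
  · subst hjk
    rw [hS.good.legE_eq_of_visits (hS.start j) hw, Bool.xor_self]
  · rw [hS.good.legE_eq_false (hS.start k) hw.1 (hS.good.not_visits (hS.start j) (hS.start k) hjk
      (hits_of_term hx (hS.hits k)) hw), ha]
    rfl

lemma IsCol.bd_of_visits {j : Fin 3} (hjk : j ≠ k) {w : Vertex}
    (hw : Visits ξ (D.stops A x) x j w) (a : Fin 3) : bd ω w a = ξ w a := by
  rw [← cut_eq_bd (A := A) fun h => hw.1 (Or.inr h), hω.eq]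
  unfold xorE
  rw [hS.good.legE_eq_false (hS.start k) hw.1 (hS.good.not_visits (hS.start j) (hS.start k) hjk
      (hits_of_term hx (hS.hits k)) hw), Bool.xor_false]

end Col

/-- Without the removed leg two interfaces remain at `x`, so one colour there determines the others.
The next two lemmas are the same for the other legs. -/
lemma IsCol.values₀ {ω : Face → Bool} (hx : x ∉ Set.range D.bdry) (hS : D.Src A x ξ)
    (hω : D.IsCol A x ξ i ω)
    (hb : ω (fc x i) = false) : ω (fc x (i + 1)) = true ∧ ω (fc x (i + 2)) = true := by
  have h1 := hω.bd_start hx hS (i + 1)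
  have h2 := hω.bd_start hx hS (i + 2)
  unfold bd at h1 h2
  simp only [add_one_one, add_one_two, add_two_one, add_two_two] at h1 h2
  rw [hb] at h1 h2
  simp at h1 h2
  exact ⟨h2, h1⟩

lemma IsCol.values₁ {ω : Face → Bool} (hx : x ∉ Set.range D.bdry) (hS : D.Src A x ξ)
    (hω : D.IsCol A x ξ (i + 1) ω)
    (hb : ω (fc x i) = false) : ω (fc x (i + 1)) = true ∧ ω (fc x (i + 2)) = false := by
  have h1 := hω.bd_start hx hS (i + 1)
  have h2 := hω.bd_start hx hS (i + 2)
  unfold bd at h1 h2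
  simp only [add_one_one, add_one_two, add_two_one, add_two_two] at h1 h2
  rw [hb] at h1 h2
  simp at h1 h2
  exact ⟨h2, h1⟩

lemma IsCol.values₂ {ω : Face → Bool} (hx : x ∉ Set.range D.bdry) (hS : D.Src A x ξ)
    (hω : D.IsCol A x ξ (i + 2) ω)
    (hb : ω (fc x i) = false) : ω (fc x (i + 1)) = false ∧ ω (fc x (i + 2)) = true := by
  have h1 := hω.bd_start hx hS (i + 1)
  have h2 := hω.bd_start hx hS (i + 2)
  unfold bd at h1 h2
  simp only [add_one_one, add_one_two, add_two_one, add_two_two] at h1 h2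
  rw [hb] at h1 h2
  simp at h1 h2
  exact ⟨h2, h1⟩

/-- Three legs come from a tripod as soon as the colourings exist. -/
lemma exists_tripod (hx : x ∉ Set.range D.bdry) (hS : D.Src A x ξ) {ω₀ ω₁ : Face → Bool}
    (h₀ : D.IsCol A x ξ i ω₀) (h₁ : D.IsCol A x ξ (i + 1) ω₁)
    (hb₀ : ω₀ (fc x i) = false) (hb₁ : ω₁ (fc x i) = false) :
    ∃ σ : Face → Bool, (∀ f, σ f = true → f ∈ D.faces) ∧ D.Tripod A x i σ ∧
      D.toSrc A x i σ = ξ := by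
  have hG := hS.good
  obtain ⟨a1, a2⟩ := h₀.values₀ hx hS hb₀
  obtain ⟨b1, b2⟩ := h₁.values₁ hx hS hb₁
  have s0 : ∀ {d}, d ∈ Leg ξ (D.stops A x) x (i + 1) → ω₀ (lf d) = false ∧ ω₀ (rf d) = true := by
    intro d hd'
    have := h₀.side hx hS hd'
    rwa [add_one_one, add_one_two, hb₀, a2] at this
  have s0' : ∀ {d}, d ∈ Leg ξ (D.stops A x) x (i + 2) → ω₀ (lf d) = true ∧ ω₀ (rf d) = false := by
    intro d hd'
    have := h₀.side hx hS hd'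
    rwa [add_two_one, add_two_two, hb₀, a1] at this
  have s1 : ∀ {d}, d ∈ Leg ξ (D.stops A x) x (i + 1) → ω₁ (lf d) = false ∧ ω₁ (rf d) = false := by
    intro d hd'
    have := h₁.side hx hS hd'
    rwa [add_one_one, add_one_two, hb₁, b2] at this
  have s1' : ∀ {d}, d ∈ Leg ξ (D.stops A x) x (i + 2) → ω₁ (lf d) = true ∧ ω₁ (rf d) = false := by
    intro d hd'
    have := h₁.side hx hS hd'
    rwa [add_two_one, add_two_two, hb₁, b1] at this
  -- The faces to be turned back to white. They are white in `ω₀` and black in `ω₁`.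
  set R := D.rightFaces A ξ x (i + 1) with hR
  have r0 : ∀ {f}, R f = true → ω₀ f = true ∧ ω₁ f = false := by
    intro f hf
    obtain ⟨d, hd', rfl⟩ := rightFaces_iff.1 hf
    exact ⟨(s0 hd').2, (s1 hd').2⟩
  have r1 : ∀ {f}, ω₀ f = false → R f = false := by
    intro f hf
    by_contra h
    rw [Bool.not_eq_false] at h
    rw [(r0 h).1] at hf; simp at hf
  have r2 : ∀ {f}, ω₁ f = true → R f = false := by
    intro f hf
    by_contra h
    rw [Bool.not_eq_false] at h
    rw [(r0 h).2] at hf; simp at hf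
  have hσ : ∀ f, (ω₁ f ^^ R f) = true → f ∈ D.faces := by
    intro f hf
    by_cases h : ω₁ f = true
    · exact h₁.supp f h
    · rw [Bool.not_eq_true] at h
      rw [h, Bool.false_xor] at hf
      exact h₀.supp f (r0 hf).1
  have v1 : ∀ w, Visits ξ (D.stops A x) x (i + 1) w → ∀ j,
      D.cut A (fun f => ω₁ f ^^ R f) w j = ξ w j := by
    intro w hw j
    rw [cut_eq_bd fun h => hw.1 (Or.inr h), ← h₀.bd_of_visits hx hS (add_one_ne i) hw]
    -- Near the leg `i + 1` the new colouring looks like `ω₀`, which has this leg among its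
    -- interfaces.
    have : ∀ k, (ω₁ (fc w k) ^^ R (fc w k)) = ω₀ (fc w k) := by
      intro k
      obtain ⟨d, hd', h | h⟩ := hG.face_of_visits (hS.start _) hw k
      · rw [h, r1 (s0 hd').1, (s0 hd').1, (s1 hd').1]; rfl
      · rw [h, hR, rightFaces_iff.2 ⟨d, hd', rfl⟩, (s0 hd').2, (s1 hd').2]; rfl
    unfold bd
    beta_reduce
    rw [this, this]
  have v2 : ∀ w, Visits ξ (D.stops A x) x (i + 2) w → ∀ j,
      D.cut A (fun f => ω₁ f ^^ R f) w j = ξ w j := by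
    intro w hw j
    rw [cut_eq_bd fun h => hw.1 (Or.inr h), ← h₁.bd_of_visits hx hS (add_two_ne_add_one i) hw]
    -- Near the leg `i + 2` it looks like `ω₁`, because no face there lies in `R`.
    have : ∀ k, (ω₁ (fc w k) ^^ R (fc w k)) = ω₁ (fc w k) := by
      intro k
      obtain ⟨d, hd', h | h⟩ := hG.face_of_visits (hS.start _) hw k
      · rw [h, r2 (s1' hd').1, Bool.xor_false]
      · rw [h, r1 (s0' hd').2, Bool.xor_false]
    unfold bd
    beta_reduce
    rw [this, this]
  have l1 := leg_congr v1
  have l2 := leg_congr v2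
  refine ⟨fun f => ω₁ f ^^ R f, hσ, ?_, ?_⟩
  · constructor
    · simp only [hb₁, r1 hb₀, Bool.xor_false]
    · simp only [b1, r2 b1, Bool.xor_false]
    · simp only [b2, Bool.false_xor]
      refine rightFaces_iff.2 ⟨_, mem_leg_start, ?_⟩
      simp [rf, add_one_one]
    · rw [l1]; exact hS.hits _
    · rw [l2]; exact hS.hits _
    · rw [l1, l2]
      intro d hd' e he h
      -- In `ω₁` the right side of the leg `i + 1` is black and the left side of the leg `i + 2` is
      -- white, so they have no common face.
      have h1 := (s1 hd').2
      rw [h, (s1' he).1] at h1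
      simp at h1
  · have : (fun f => (ω₁ f ^^ R f) ^^ D.rightFaces A (D.cut A fun f => ω₁ f ^^ R f) x (i + 1) f) =
        ω₁ := by
      rw [rightFaces_congr l1]
      funext f
      rw [Bool.xor_assoc, ← hR, Bool.xor_self, Bool.xor_false]
    unfold toSrc
    rw [this, legE_congr l1, h₁.eq]
    funext v j
    unfold xorE
    rw [Bool.xor_assoc, Bool.xor_self, Bool.xor_false]

/-- A tripod is determined by its legs. -/
lemma tripod_injective (hx : x ∉ Set.range D.bdry) (hxf : fc x i ∈ D.faces) {σ τ : Face → Bool}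
    (hσ : ∀ f, σ f = true → f ∈ D.faces) (hτ : ∀ f, τ f = true → f ∈ D.faces)
    (h1 : D.Tripod A x i σ) (h2 : D.Tripod A x i τ) (h : D.toSrc A x i σ = D.toSrc A x i τ) :
    σ = τ := by
  -- The image retains the leg `i + 1`, from which the set of flipped faces can be read off.
  have hl : Leg (D.cut A σ) (D.stops A x) x (i + 1) = Leg (D.cut A τ) (D.stops A x) x (i + 1) := by
    rw [← h1.leg_toSrc₁ hσ hx, ← h2.leg_toSrc₁ hτ hx, h]
  have hR := rightFaces_congr hl
  have hc : ∀ v k, D.cut A (fun f => σ f ^^ D.rightFaces A (D.cut A σ) x (i + 1) f) v k =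
      D.cut A (fun f => τ f ^^ D.rightFaces A (D.cut A τ) x (i + 1) f) v k := by
    intro v k
    have := congrFun (congrFun h v) k
    unfold toSrc xorE at this
    rw [legE_congr hl] at this
    simpa using this
  funext g
  -- The flipped colouring is determined by its interfaces and by the black face `fc x i`.
  have key : (σ g ^^ D.rightFaces A (D.cut A σ) x (i + 1) g) =
      (τ g ^^ D.rightFaces A (D.cut A τ) x (i + 1) g) := by
    by_cases hg : g ∈ D.faces
    · refine D.eq_of_bd_eq (σ := fun f => σ f ^^ D.rightFaces A (D.cut A σ) x (i + 1) f)
        (τ := fun f => τ f ^^ D.rightFaces A (D.cut A τ) x (i + 1) f) hxf ?_ ?_ hg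
      · exact (h1.flip_values hσ hx).1.trans (h2.flip_values hτ hx).1.symm
      · intro v j e1 e2
        rw [← cut_interior (A := A) e1 e2, ← cut_interior (A := A) e1 e2]
        exact hc v j
    · have e1 : ¬ (σ g ^^ D.rightFaces A (D.cut A σ) x (i + 1) g) = true :=
        fun h => hg (h1.flip_supp hσ hx g h)
      have e2 : ¬ (τ g ^^ D.rightFaces A (D.cut A τ) x (i + 1) g) = true :=
        fun h => hg (h2.flip_supp hτ hx g h)
      rw [Bool.not_eq_true] at e1 e2
      rw [e1, e2]
  rw [hR] at key
  simpa using key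

end Domain
end HexPerc

/-! ### The two arcs, and colourings for the two boundary conditions. -/

namespace HexPerc

lemma bool_of_xor {a b : Bool} (h : (a ^^ b) = false) : a = b := by
  revert a b; decide

lemma zmod_val_sub {n : ℕ} [NeZero n] (a b : ZMod n) :
    (a - b).val = if b.val ≤ a.val then a.val - b.val else n + a.val - b.val := by
  split_ifs with h
  · exact ZMod.val_sub h
  · push Not at h
    have h1 := ZMod.val_sub h.le
    rw [← neg_sub, ZMod.neg_val, if_neg, h1]
    · have := b.val_lt; omega
    · intro h2
      rw [h2, ZMod.val_zero] at h1
      omega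

namespace Domain

variable {D : Domain}

lemma one_lt_len : 1 < D.len := by
  by_contra h
  have h1 : D.len = 1 := by have := NeZero.pos D.len; omega
  have : Subsingleton (ZMod D.len) := by rw [h1]; infer_instance
  exact D.l_ne_r (Subsingleton.elim _ _)

lemma val_l_sub_r_pos : 0 < (D.l - D.r).val := by
  rw [Nat.pos_iff_ne_zero, ne_eq, ZMod.val_eq_zero, sub_eq_zero]
  exact D.l_ne_r

lemma mem_d_iff {t : ZMod D.len} : t ∈ D.d ↔ t ∉ D.u := by
  change (t - D.l).val < (D.r - D.l).val ↔ ¬ (t - D.r).val < (D.l - D.r).val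
  have h1 : t - D.l = (t - D.r) - (D.l - D.r) := by ring
  have h2 : D.r - D.l = 0 - (D.l - D.r) := by ring
  have h3 := D.val_l_sub_r_pos
  have h4 := (D.l - D.r).val_lt
  have h5 := (t - D.r).val_lt
  rw [h1, h2, zmod_val_sub, zmod_val_sub 0, ZMod.val_zero]
  split_ifs <;> omega

lemma mem_u_sub_one {t : ZMod D.len} (hl : t ≠ D.l) (hr : t ≠ D.r) :
    t - 1 ∈ D.u ↔ t ∈ D.u := by
  change (t - 1 - D.r).val < (D.l - D.r).val ↔ (t - D.r).val < (D.l - D.r).val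
  have h1 : t - 1 - D.r = (t - D.r) - 1 := by ring
  have h2 : (1 : ZMod D.len).val = 1 := by
    rw [ZMod.val_one_eq_one_mod, Nat.mod_eq_of_lt one_lt_len]
  have h3 : (t - D.r).val ≠ 0 := by
    rw [ne_eq, ZMod.val_eq_zero, sub_eq_zero]; exact hr
  have h4 : (t - D.r).val ≠ (D.l - D.r).val := by
    intro h
    exact hl (sub_left_injective (ZMod.val_injective _ h))
  rw [h1, zmod_val_sub, h2]
  split_ifs <;> omega

lemma mem_d_sub_one {t : ZMod D.len} (hl : t ≠ D.l) (hr : t ≠ D.r) :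
    t - 1 ∈ D.d ↔ t ∈ D.d := by
  rw [mem_d_iff, mem_d_iff, mem_u_sub_one hl hr]

/-- A vertex on an edge between two faces of the domain is not a corner of the domain. -/
lemma not_isCorner {d : Dart} (h1 : lf d ∈ D.faces) (h2 : rf d ∈ D.faces) :
    ¬ D.IsCorner (hd d) := by
  rintro ⟨f, -, hf⟩
  have e1 := hf (lf d) ⟨h1, (corner_iff _ _).2 ⟨d.2 + 1, by simp [hd, lf, fc_nbr_add_one]⟩⟩
  have e2 := hf (rf d) ⟨h2, (corner_iff _ _).2 ⟨d.2 + 2, by simp [hd, rf, fc_nbr_add_two]⟩⟩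
  exact add_two_ne_add_one d.2 (fc_inj (e1.trans e2.symm))

section Corners

variable (hl : D.IsCorner D.ptL) (hr : D.IsCorner D.ptR)
include hl hr

/-- A marked vertex meets a single face of the domain, whereas an inner edge has two. -/
lemma ne_of_interior {d : Dart} (h1 : lf d ∈ D.faces) (h2 : rf d ∈ D.faces) {t : ZMod D.len}
    (ht : hd d = D.bdry t) : t ≠ D.l ∧ t ≠ D.r := by
  have := not_isCorner h1 h2
  rw [ht] at this
  exact ⟨fun h => this (h ▸ hl), fun h => this (h ▸ hr)⟩

/-- The set `D.term D.u` contains both ends of the arc, where the arcs meet; a leg arriving through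
an inner edge cannot end there, so no ambiguity arises. -/
lemma mem_term_u {d : Dart} (h1 : lf d ∈ D.faces) (h2 : rf d ∈ D.faces) {t : ZMod D.len}
    (ht : hd d = D.bdry t) : hd d ∈ D.term D.u ↔ t ∈ D.u := by
  obtain ⟨e1, e2⟩ := ne_of_interior hl hr h1 h2 ht
  constructor
  · rintro ⟨s, hs, hs'⟩
    rw [ht] at hs
    cases D.bdry_injective hs
    rwa [mem_u_sub_one e1 e2, or_self] at hs'
  · intro h
    exact ⟨t, ht, Or.inl h⟩

end Corners

lemma free_out {A : Set (ZMod D.len)} {t : ZMod D.len} {i : Fin 3}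
    (h : nbr (D.bdry t) i = D.bdry (t + 1)) : D.free A (D.bdry t) i = true ↔ t ∈ A := by
  unfold free
  rw [D.bdrySet_out _ h]
  simp

lemma isSym_free {A : Set (ZMod D.len)} : IsSym (D.free A) := D.isSym_bdrySet _

/-- To compare two edge sets of the domain, look at its interior and boundary edges. -/
lemma edgeSet_ext {X Y : EdgeSet} (hX : IsSym X) (hY : IsSym Y)
    (hX' : ∀ v i, X v i = true → fc v (i + 1) ∈ D.faces ∨ fc v (i + 2) ∈ D.faces)
    (hY' : ∀ v i, Y v i = true → fc v (i + 1) ∈ D.faces ∨ fc v (i + 2) ∈ D.faces)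
    (h1 : ∀ v i, fc v (i + 1) ∈ D.faces → fc v (i + 2) ∈ D.faces → X v i = Y v i)
    (h2 : ∀ t i, nbr (D.bdry t) i = D.bdry (t + 1) → X (D.bdry t) i = Y (D.bdry t) i) : X = Y := by
  funext v i
  by_cases a1 : fc v (i + 1) ∈ D.faces <;> by_cases a2 : fc v (i + 2) ∈ D.faces
  · exact h1 v i a1 a2
  · obtain ⟨t, ht, ht'⟩ := D.exists_bdry_rev a1 a2
    rw [← hX, ← hY, ht]
    exact h2 t i (by rw [← ht, nbr_nbr, ht'])
  · obtain ⟨t, rfl, ht'⟩ := D.exists_bdry a2 a1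
    exact h2 t i ht'
  · have e1 := fun h => (hX' v i h).elim a1 a2
    have e2 := fun h => (hY' v i h).elim a1 a2
    rw [Bool.eq_iff_iff]
    exact ⟨fun h => (e1 h).elim, fun h => (e2 h).elim⟩

/-- The colouring with the colours in the domain exchanged. -/
def opp (D : Domain) (σ : Face → Bool) : Face → Bool := fun f => !σ f && decide (f ∈ D.faces)

lemma opp_supp {σ : Face → Bool} : ∀ f, D.opp σ f = true → f ∈ D.faces := by
  intro f hf
  unfold opp at hf
  rw [Bool.and_eq_true, decide_eq_true_iff] at hf
  exact hf.2

lemma opp_mem {σ : Face → Bool} {f : Face} (hf : f ∈ D.faces) : D.opp σ f = !σ f := by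
  simp [opp, hf]

lemma bd_opp {σ : Face → Bool} {v : Vertex} {i : Fin 3} (h1 : fc v (i + 1) ∈ D.faces)
    (h2 : fc v (i + 2) ∈ D.faces) : bd (D.opp σ) v i = bd σ v i := by
  unfold bd
  rw [opp_mem h1, opp_mem h2]
  simp

/-- The edges between two faces of the domain. -/
def inner (D : Domain) (X : EdgeSet) : EdgeSet := fun v i =>
  X v i && (decide (fc v (i + 1) ∈ D.faces) && decide (fc v (i + 2) ∈ D.faces))

lemma inner_iff {X : EdgeSet} {v : Vertex} {i : Fin 3} : D.inner X v i = true ↔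
    X v i = true ∧ fc v (i + 1) ∈ D.faces ∧ fc v (i + 2) ∈ D.faces := by
  simp [inner]

lemma inner_eq {X : EdgeSet} {v : Vertex} {i : Fin 3} (h1 : fc v (i + 1) ∈ D.faces)
    (h2 : fc v (i + 2) ∈ D.faces) : D.inner X v i = X v i := by
  simp [inner, h1, h2]

lemma isSym_inner {X : EdgeSet} (h : IsSym X) : IsSym (D.inner X) := by
  intro v i
  unfold inner
  rw [h, fc_nbr_add_one, fc_nbr_add_two, Bool.and_comm (decide _)]

lemma par_inner {X : EdgeSet} (hX : ∀ v i, X v i = true → fc v (i + 1) ∈ D.faces ∨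
    fc v (i + 2) ∈ D.faces) {v : Vertex} (hv : v ∉ Set.range D.bdry) :
    D.inner X v = X v := by
  funext i
  rw [Bool.eq_iff_iff, inner_iff]
  refine ⟨fun h => h.1, fun h => ⟨h, ?_⟩⟩
  rw [mem_range_bdry] at hv
  push Not at hv
  rcases hX v i h with h' | h'
  · exact ⟨h', hv ⟨_, h'⟩ _⟩
  · exact ⟨hv ⟨_, h'⟩ _, h'⟩

/-- With the whole boundary free only inner edges matter, and these survive an exchange of the
colours, so the colour of one face can be chosen. -/
lemma exists_cut_univ {ζ : EdgeSet} (hs : IsSym ζ)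
    (hsupp : ∀ v i, ζ v i = true → (fc v (i + 1) ∈ D.faces ∨ fc v (i + 2) ∈ D.faces) ∧
      D.free Set.univ v i = false)
    (hp : ∀ v ∉ Set.range D.bdry, par ζ v = false) {f : Face} (hf : f ∈ D.faces) :
    ∃ σ : Face → Bool, (∀ f, σ f = true → f ∈ D.faces) ∧ D.cut Set.univ σ = ζ ∧ σ f = false := by
  have hin : ∀ v i, ζ v i = true → fc v (i + 1) ∈ D.faces ∧ fc v (i + 2) ∈ D.faces := by
    intro v i h
    by_contra h'
    have : D.inner ζ = ζ := by
      refine edgeSet_ext (D := D) (isSym_inner hs) hs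
        (fun v i h => Or.inl (inner_iff.1 h).2.1) (fun v i h => (hsupp v i h).1)
        (fun v i h1 h2 => inner_eq h1 h2) (fun t j hj => ?_)
      have h1 := (free_out (A := Set.univ) hj).2 trivial
      rw [Bool.eq_iff_iff]
      refine ⟨fun h => (inner_iff.1 h).1, fun h => ?_⟩
      rw [(hsupp _ _ h).2] at h1
      simp at h1
    rw [← this] at h
    exact h' (inner_iff.1 h).2
  obtain ⟨σ, h1, h2⟩ := D.exists_coloring hs hin hp
  have key : ∀ τ : Face → Bool, (∀ f, τ f = true → f ∈ D.faces) →
      (∀ v i, fc v (i + 1) ∈ D.faces → fc v (i + 2) ∈ D.faces → bd τ v i = ζ v i) →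
      D.cut Set.univ τ = ζ := by
    intro τ h3 h4
    refine edgeSet_ext (D := D) isSym_cut hs (fun v i h => (cut_supp h3 h).1)
      (fun v i h => (hsupp v i h).1) (fun v i e1 e2 => ?_) (fun t j hj => ?_)
    · rw [cut_interior e1 e2, h4 v i e1 e2]
    · have h5 := (free_out (A := Set.univ) hj).2 trivial
      rw [Bool.eq_iff_iff]
      constructor
      · intro h; rw [(cut_supp h3 h).2] at h5; simp at h5
      · intro h; rw [(hsupp _ _ h).2] at h5; simp at h5
  by_cases hc : σ f = false
  · exact ⟨σ, h1, key σ h1 h2, hc⟩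
  · refine ⟨D.opp σ, opp_supp, key _ opp_supp fun v i e1 e2 => ?_, ?_⟩
    · rw [bd_opp e1 e2, h2 v i e1 e2]
    · rw [opp_mem hf]; simpa using hc

/-- The inner edges come from `exists_coloring`. On `d` the outside counts as black, so boundary
edges must match too: by parity the discrepancy is the same on all edges of `d`, and exchanging the
colours removes it if present. No freedom is left to prescribe a colour. -/
lemma exists_cut_u {ζ : EdgeSet} (hs : IsSym ζ)
    (hsupp : ∀ v i, ζ v i = true → (fc v (i + 1) ∈ D.faces ∨ fc v (i + 2) ∈ D.faces) ∧
      D.free D.u v i = false)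
    (hp : ∀ v ∉ D.term D.u, par ζ v = false) :
    ∃ σ : Face → Bool, (∀ f, σ f = true → f ∈ D.faces) ∧ D.cut D.u σ = ζ := by
  have hs' := fun v i h => (hsupp v i h).1
  obtain ⟨σ, h1, h2⟩ := D.exists_coloring (isSym_inner hs) (fun v i h => (inner_iff.1 h).2)
    (fun v hv => by
      unfold par
      rw [par_inner hs' hv]
      exact hp v fun h => hv (term_subset h))
  have h2' : ∀ v i, fc v (i + 1) ∈ D.faces → fc v (i + 2) ∈ D.faces → bd σ v i = ζ v i :=
    fun v i e1 e2 => by rw [h2 v i e1 e2, inner_eq e1 e2]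
  have hE : IsSym (fun v i => bd σ v i ^^ ζ v i) := (isSym_bd σ).xor hs
  -- the discrepancy on the boundary edges
  have hstep : ∀ t, t - 1 ∉ D.u → t ∉ D.u → ∀ i j, nbr (D.bdry t) i = D.bdry (t + 1) →
      nbr (D.bdry (t - 1)) j = D.bdry t →
      (bd σ (D.bdry t) i ^^ ζ (D.bdry t) i) =
        (bd σ (D.bdry (t - 1)) j ^^ ζ (D.bdry (t - 1)) j) := by
    intro t ht1 ht i j hi hj
    obtain ⟨i', j', e1, e2, e3, e4, e5, e6, e7⟩ := D.bdry_vertex t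
    cases nbr_inj (hi.trans e1.symm)
    have hjj : j = j' := by
      have := nbr_nbr (D.bdry (t - 1)) j
      rw [hj, ← e2] at this
      exact nbr_inj this
    subst hjj
    have h3 : par (fun v i => bd σ v i ^^ ζ v i) (D.bdry t) = false := by
      rw [par_xor, par_bd, hp, Bool.xor_false]
      rintro ⟨s, hs, hs'⟩
      cases D.bdry_injective hs
      exact hs'.elim ht ht1
    have h4 := hE (D.bdry t) j
    rw [e2] at h4
    refine Eq.trans ?_ h4.symm
    -- The third edge lies either between two outer faces or between two faces of the domain, and
    -- shows no discrepancy in either case.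
    have h5 : ∀ k, k ≠ i → k ≠ j → (bd σ (D.bdry t) k ^^ ζ (D.bdry t) k) = false := by
      intro k hk1 hk2
      rcases e7 with ⟨rfl, e7⟩ | ⟨rfl, e7⟩
      · have : k = i + 2 := by
          rcases fin3_cases i k with h | h | h
          exacts [absurd h hk1, absurd h hk2, h]
        subst this
        have b1 : ∀ b : Bool, ¬ b = true → b = false := by decide
        have z1 := b1 _ fun h => (hs' (D.bdry t) (i + 2) h).elim
          (by rw [add_two_one]; exact e7) (by rw [add_two_two]; exact e4)
        have z2 := b1 _ fun h => (bd_supp h1 (v := D.bdry t) (k := i + 2) h).elim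
          (by rw [add_two_one]; exact e7) (by rw [add_two_two]; exact e4)
        rw [z1, z2]; rfl
      · have : k = i + 1 := by
          rcases fin3_cases i k with h | h | h
          exacts [absurd h hk1, h, absurd h hk2]
        subst this
        rw [h2' _ _ (by rwa [add_one_one]) (by rwa [add_one_two]), Bool.xor_self]
    rw [par_eq _ _ i] at h3
    have hij : j ≠ i := by
      rcases e7 with ⟨rfl, -⟩ | ⟨rfl, -⟩
      · exact add_one_ne i
      · exact add_two_ne i
    rcases fin3_cases i j with rfl | rfl | rfl
    · exact absurd rfl hij
    · rw [h5 (i + 2) (add_two_ne i) (add_two_ne_add_one i), Bool.xor_false] at h3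
      exact bool_of_xor h3
    · rw [h5 (i + 1) (add_one_ne i) (add_two_ne_add_one i).symm, Bool.false_xor] at h3
      exact bool_of_xor h3
  obtain ⟨i₀, hi₀, -⟩ := D.bdry_step D.l
  have hall : ∀ n : ℕ, n < (D.r - D.l).val → ∀ j,
      nbr (D.bdry (D.l + n)) j = D.bdry (D.l + n + 1) →
      (bd σ (D.bdry (D.l + n)) j ^^ ζ (D.bdry (D.l + n)) j) =
        (bd σ (D.bdry D.l) i₀ ^^ ζ (D.bdry D.l) i₀) := by
    have hmem : ∀ n : ℕ, n < (D.r - D.l).val → D.l + n ∉ D.u := by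
      intro n hn
      rw [← mem_d_iff]
      change (D.l + n - D.l).val < _
      rwa [add_sub_cancel_left, ZMod.val_natCast_of_lt (hn.trans (ZMod.val_lt _))]
    intro n
    induction n with
    | zero =>
      intro _ j hj
      have e : D.l + ((0 : ℕ) : ZMod D.len) = D.l := by simp
      rw [e] at hj ⊢
      rw [nbr_inj (hj.trans hi₀)]
    | succ n ih =>
      intro hn j hj
      obtain ⟨j', hj', -⟩ := D.bdry_step (D.l + n)
      rw [← ih (by omega) j' hj'.symm]
      have e : D.l + ((n + 1 : ℕ) : ZMod D.len) - 1 = D.l + n := by push_cast; ring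
      have e' : D.l + ((n + 1 : ℕ) : ZMod D.len) = D.l + n + 1 := by push_cast; ring
      have := hstep (D.l + ((n + 1 : ℕ) : ZMod D.len)) (by rw [e]; exact hmem n (by omega))
        (hmem _ hn) j j' hj (by rw [e, e']; exact hj'.symm)
      rw [this, e]
  have hd : ∀ t ∉ D.u, ∀ j, nbr (D.bdry t) j = D.bdry (t + 1) →
      (bd σ (D.bdry t) j ^^ ζ (D.bdry t) j) = (bd σ (D.bdry D.l) i₀ ^^ ζ (D.bdry D.l) i₀) := by
    intro t ht j hj
    rw [← mem_d_iff] at ht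
    have e : D.l + ((t - D.l).val : ZMod D.len) = t := by simp
    have := hall (t - D.l).val ht j
    rw [e] at this
    exact this hj
  have key : ∀ τ : Face → Bool, (∀ f, τ f = true → f ∈ D.faces) →
      (∀ v i, fc v (i + 1) ∈ D.faces → fc v (i + 2) ∈ D.faces → bd τ v i = ζ v i) →
      (∀ t ∉ D.u, ∀ j, nbr (D.bdry t) j = D.bdry (t + 1) → bd τ (D.bdry t) j = ζ (D.bdry t) j) →
      D.cut D.u τ = ζ := by
    intro τ h3 h4 h5
    refine edgeSet_ext (D := D) isSym_cut hs (fun v i h => (cut_supp h3 h).1)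
      (fun v i h => (hsupp v i h).1) (fun v i e1 e2 => ?_) (fun t j hj => ?_)
    · rw [cut_interior e1 e2, h4 v i e1 e2]
    · by_cases ht : t ∈ D.u
      · have h5 := (free_out hj).2 ht
        rw [Bool.eq_iff_iff]
        constructor
        · intro h; rw [(cut_supp h3 h).2] at h5; simp at h5
        · intro h; rw [(hsupp _ _ h).2] at h5; simp at h5
      · have h6 : D.free D.u (D.bdry t) j = false := by
          have := mt (free_out hj).1 ht
          simpa using this
        unfold cut
        rw [h6, h5 t ht j hj]
        simp
  by_cases hc : (bd σ (D.bdry D.l) i₀ ^^ ζ (D.bdry D.l) i₀) = false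
  · refine ⟨σ, h1, key σ h1 h2' fun t ht j hj => ?_⟩
    have := hd t ht j hj
    rw [hc] at this
    simpa using this
  · refine ⟨D.opp σ, opp_supp, key _ opp_supp (fun v i e1 e2 => ?_) fun t ht j hj => ?_⟩
    · rw [bd_opp e1 e2, h2' v i e1 e2]
    · have h3 := hd t ht j hj
      rw [Bool.not_eq_false] at hc
      rw [hc] at h3
      obtain ⟨j', g1, g2, g3⟩ := D.bdry_step t
      cases nbr_inj (hj.trans g1)
      have e1 : ∀ τ : Face → Bool, (∀ f, τ f = true → f ∈ D.faces) →
          τ (fc (D.bdry t) (j + 1)) = false := by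
        intro τ hτ
        by_contra h
        rw [Bool.not_eq_false] at h
        exact g3 (hτ _ h)
      unfold bd at h3 ⊢
      rw [e1 _ h1] at h3
      rw [e1 _ opp_supp, opp_mem g2]
      revert h3
      cases σ (fc (D.bdry t) (j + 2)) <;> cases ζ (D.bdry t) j <;> simp

end Domain
end HexPerc

/-! ### The colour-switching bijection for both boundary conditions. -/

namespace HexPerc

section Legs

variable {X Y : EdgeSet} {Q Q' : Set Vertex} {x : Vertex} {j k : Fin 3} {d : Dart}

lemma leg_mono (hXY : ∀ v i, X v i = true → Y v i = true) (hQ : Q' ⊆ Q) :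
    Leg X Q x k ⊆ Leg Y Q' x k := by
  intro d h
  induction h with
  | refl => exact mem_leg_start
  | @tail a b _ hab ih =>
    exact mem_leg_step ih ⟨hab.1, hab.2.1, hXY _ _ hab.2.2.1, fun h => hab.2.2.2 (hQ h)⟩

/-- Fewer edges and more stops give an initial piece of the leg. If that piece ends at a stop in
`Q'`, the longer leg has to end there as well. -/
lemma Good.leg_eq_of_end (hG : Good Y Q' x) (hk : Y x k = true)
    (hXY : ∀ v i, X v i = true → Y v i = true) (hQ : Q' ⊆ Q) (h : d ∈ Leg X Q x k)
    (hd' : hd d ∈ Q') : Leg X Q x k = Leg Y Q' x k := by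
  refine (leg_mono hXY hQ).antisymm fun e he => ?_
  have back : ∀ b c, b ∈ Leg Y Q' x k → Step Y Q' b c → c ∈ Leg X Q x k → b ∈ Leg X Q x k := by
    intro b c hb hbc hc
    rcases leg_cases hc with rfl | ⟨b', hb', hbc'⟩
    · exact absurd hbc hG.not_step_start
    · have h1 : Step Y Q' b' c :=
        ⟨hbc'.1, hbc'.2.1, hXY _ _ hbc'.2.2.1, fun h => hbc'.2.2.2 (hQ h)⟩
      rwa [hG.step_inj (mem_of_mem_leg hk hb)
        (mem_of_mem_leg hk (leg_mono hXY hQ hb')) hbc h1]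
  have hd2 := leg_mono hXY hQ h
  rcases hG.leg_total hk he hd2 with h1 | h1
  · clear hd'
    have : ∀ b, Relation.ReflTransGen (Step Y Q') e b → b ∈ Leg X Q x k → e ∈ Leg X Q x k := by
      intro b hb
      induction hb with
      | refl => exact id
      | @tail b c hb hbc ih => exact fun hc => ih (back b c (he.trans hb) hbc hc)
    exact this d h1 h
  · rcases Relation.ReflTransGen.cases_head h1 with rfl | ⟨c, h2, -⟩
    · exact h
    · exact absurd hd' h2.2.2.2

/-- A leg that comes back to `x` through the edge `j` runs along the leg `j` backwards. With
`return_symm` this makes a returning pair interchangeable. -/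
lemma Good.rv_mem_of_return (hG : Good X Q x) (hj : X x j = true) (hk : X x k = true)
    (h : rv (x, j) ∈ Leg X Q x k) (hd' : d ∈ Leg X Q x j) : rv d ∈ Leg X Q x k := by
  induction hd' with
  | refl => exact h
  | @tail b c hb hbc ih =>
    have hs : Step X Q (rv c) (rv b) := by
      refine ⟨?_, hbc.2.1.symm, ?_, ?_⟩
      · rw [hd_rv, hbc.1]; rfl
      · rw [hG.sym.rv]; exact mem_of_mem_leg hj hb
      · rw [hd_rv, hbc.1]; exact hbc.2.2.2
    rcases leg_cases ih with h' | ⟨e, he, h'⟩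
    · exfalso
      apply hbc.2.2.2
      have := congrArg Prod.fst h'
      change hd b = x at this
      rw [this]
      exact hG.mem
    · rwa [hG.step_inj (by rw [hG.sym.rv]; exact hbc.mem_right) (mem_of_mem_leg hk he) hs h']

lemma Good.return_symm (hG : Good X Q x) (hj : X x j = true) (hk : X x k = true)
    (h : rv (x, j) ∈ Leg X Q x k) : rv (x, k) ∈ Leg X Q x j := by
  obtain ⟨d, hd', hq⟩ := hG.exists_leg_end hj
  rcases leg_cases (hG.rv_mem_of_return hj hk h hd') with h' | ⟨e, -, h'⟩
  · rw [← h', rv_rv]; exact hd'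
  · refine absurd hq ?_
    have := h'.1
    change hd d = hd e at this
    rw [this]
    exact h'.2.2.2

end Legs

namespace Domain

variable {D : Domain} {A : Set (ZMod D.len)} {x : Vertex} {i : Fin 3} {ξ : EdgeSet}

/-- The colouring of all faces given by a configuration, black outside of the domain. -/
noncomputable def ext (ω : D.Config) : Face → Bool := open Classical in
  fun f => if h : f ∈ D.faces then ω ⟨f, h⟩ else false

lemma ext_iff {ω : D.Config} {f : Face} : ext ω f = true ↔ White ω f := by
  unfold ext White
  split_ifs with h <;> simp [h]

lemma ext_supp (ω : D.Config) : ∀ f, ext ω f = true → f ∈ D.faces := by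
  intro f hf
  exact (ext_iff.1 hf).1

lemma ext_injective : Function.Injective (ext (D := D)) := by
  intro ω ω' h
  funext ⟨f, hf⟩
  have := congrFun h f
  simpa [ext, hf] using this

lemma exists_ext {σ : Face → Bool} (hσ : ∀ f, σ f = true → f ∈ D.faces) :
    ∃ ω : D.Config, ext ω = σ := by
  refine ⟨fun f => σ f, funext fun f => ?_⟩
  unfold ext
  split_ifs with h
  · rfl
  · by_contra h'
    exact h (hσ f (by simpa using Ne.symm h'))

/-- The leg ends at a vertex of `B`. -/
def HitsArc (X : EdgeSet) (x : Vertex) (k : Fin 3) (B : Set (ZMod D.len)) : Prop :=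
  ∃ d ∈ Leg X (D.stops Set.univ x) x k, ∃ t ∈ B, hd d = D.bdry t

/-- One of the two legs goes along the boundary, and has the domain on the correct side. -/
def Norm (D : Domain) (X : EdgeSet) (x : Vertex) (i : Fin 3) : Prop :=
  (∃ d ∈ Leg X (D.stops D.u x) x (i + 1), lf d ∉ D.faces) ∨
    ∃ d ∈ Leg X (D.stops D.u x) x (i + 2), rf d ∉ D.faces

/-- Since `toSrc` preserves the legs `i + 1` and `i + 2`, any condition `P` on them is carried
along. The boundary condition matters only for the existence of the colourings used by the inverse,
which is isolated in `hP`. -/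
lemma bijOn_toSrc (hx : x ∉ Set.range D.bdry) (hxf : ∀ k, fc x k ∈ D.faces)
    {P : Set Dart → Set Dart → Prop}
    (hP : ∀ ξ, D.Src A x ξ →
      P (Leg ξ (D.stops A x) x (i + 1)) (Leg ξ (D.stops A x) x (i + 2)) →
      ∀ k, ∃ ω, D.IsCol A x ξ k ω ∧ ω (fc x i) = false) :
    Set.BijOn (fun ω : D.Config => D.toSrc A x i (ext ω))
      {ω | D.Tripod A x i (ext ω) ∧ P (Leg (D.cut A (ext ω)) (D.stops A x) x (i + 1))
        (Leg (D.cut A (ext ω)) (D.stops A x) x (i + 2))}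
      {ξ | D.Src A x ξ ∧ P (Leg ξ (D.stops A x) x (i + 1)) (Leg ξ (D.stops A x) x (i + 2))} := by
  refine ⟨?_, ?_, ?_⟩
  · rintro ω ⟨h1, h2⟩
    refine ⟨h1.toSrc_src (ext_supp ω) hx, ?_⟩
    rwa [h1.leg_toSrc₁ (ext_supp ω) hx, h1.leg_toSrc₂ (ext_supp ω) hx]
  · rintro ω ⟨h1, -⟩ ω' ⟨h2, -⟩ h
    exact ext_injective (tripod_injective hx (hxf i) (ext_supp ω) (ext_supp ω') h1 h2 h)
  · rintro ξ ⟨h1, h2⟩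
    obtain ⟨ω₀, h3, h4⟩ := hP ξ h1 h2 i
    obtain ⟨ω₁, h5, h6⟩ := hP ξ h1 h2 (i + 1)
    obtain ⟨σ, e1, e2, e3⟩ := exists_tripod hx h1 h3 h5 h4 h6
    obtain ⟨ω, rfl⟩ := exists_ext e1
    refine ⟨ω, ⟨e2, ?_⟩, e3⟩
    rwa [← e2.leg_toSrc₁ e1 hx, ← e2.leg_toSrc₂ e1 hx, e3]

section Col

variable (hx : x ∉ Set.range D.bdry) (hS : D.Src A x ξ)

lemma sym_sub (hS : D.Src A x ξ) (k : Fin 3) : IsSym (xorE ξ (legE ξ (D.stops A x) x k)) :=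
  hS.sym.xor isSym_legE

lemma supp_sub (hS : D.Src A x ξ) (k : Fin 3) {v : Vertex} {j : Fin 3}
    (h : xorE ξ (legE ξ (D.stops A x) x k) v j = true) :
    (fc v (j + 1) ∈ D.faces ∨ fc v (j + 2) ∈ D.faces) ∧ D.free A v j = false := by
  by_cases h' : legE ξ (D.stops A x) x k v j = true
  · exact hS.supp v j (hS.good.legE_le (hS.start k) h')
  · rw [Bool.not_eq_true] at h'
    unfold xorE at h
    rw [h', Bool.xor_false] at h
    exact hS.supp v j h

include hx hS

/-- Removing one of three legs leaves degree two at `x`, and a leg is even at every other vertex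
that is not a stop. -/
lemma par_sub (k : Fin 3) {v : Vertex} (hv : v ∉ D.term A) :
    par (xorE ξ (legE ξ (D.stops A x) x k)) v = false := by
  by_cases hvx : v = x
  · subst hvx
    have h1 := hS.good.legE_start (hS.start k) (hits_of_term hx (hS.hits k))
    have b1 : ∀ b : Bool, ¬ b = true → b = false := by decide
    have h2 := (h1 k).2 rfl
    have h3 := b1 _ (mt (h1 (k + 1)).1 (add_one_ne k))
    have h4 := b1 _ (mt (h1 (k + 2)).1 (add_two_ne k))
    rw [par_eq _ _ k]
    unfold xorE
    rw [h2, h3, h4, hS.start, hS.start, hS.start]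
    rfl
  · have hv' : v ∉ D.stops A x := fun h => h.elim hvx hv
    exact par_xorE (hS.even v hv') (hS.good.par_legE (hS.start k) hv')

end Col

lemma term_univ : D.term Set.univ = Set.range D.bdry := by
  refine term_subset.antisymm ?_
  rintro v ⟨t, rfl⟩
  exact ⟨t, rfl, Or.inl trivial⟩

lemma exists_isCol_univ (hx : x ∉ Set.range D.bdry) (hxf : ∀ k, fc x k ∈ D.faces)
    (hS : D.Src Set.univ x ξ) (k : Fin 3) :
    ∃ ω, D.IsCol Set.univ x ξ k ω ∧ ω (fc x i) = false := by
  obtain ⟨σ, h1, h2, h3⟩ := exists_cut_univ (sym_sub hS k) (fun v j h => supp_sub hS k h)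
    (fun v hv => par_sub hx hS k (by rwa [term_univ])) (hxf i)
  exact ⟨σ, ⟨h1, h2⟩, h3⟩

/-- The colour at `fc x i` cannot be chosen here. It is forced by `Norm`: a leg having this face on
one side runs along the outside on that same side, and colours are constant along the sides. -/
lemma exists_isCol_u (hx : x ∉ Set.range D.bdry) (hS : D.Src D.u x ξ) (hN : D.Norm ξ x i)
    (k : Fin 3) : ∃ ω, D.IsCol D.u x ξ k ω ∧ ω (fc x i) = false := by
  obtain ⟨σ, h1, h2⟩ := exists_cut_u (sym_sub hS k) (fun v j h => supp_sub hS k h)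
    (fun v hv => par_sub hx hS k hv)
  have hω : D.IsCol D.u x ξ k σ := ⟨h1, h2⟩
  refine ⟨σ, hω, ?_⟩
  by_contra h
  rw [Bool.not_eq_false] at h
  rcases hN with ⟨d, hd', h'⟩ | ⟨d, hd', h'⟩
  · have := (hω.side hx hS hd').1
    rw [add_one_two, h] at this
    exact h' (h1 _ this)
  · have := (hω.side hx hS hd').2
    rw [add_two_one, h] at this
    exact h' (h1 _ this)

lemma interior_of_not_free {v : Vertex} {j : Fin 3}
    (h : fc v (j + 1) ∈ D.faces ∨ fc v (j + 2) ∈ D.faces) (hf : D.free Set.univ v j = false) :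
    fc v (j + 1) ∈ D.faces ∧ fc v (j + 2) ∈ D.faces := by
  by_cases a1 : fc v (j + 1) ∈ D.faces <;> by_cases a2 : fc v (j + 2) ∈ D.faces
  · exact ⟨a1, a2⟩
  · obtain ⟨t, ht, ht'⟩ := D.exists_bdry_rev a1 a2
    have := (free_out (A := Set.univ) (t := t) (i := j) (by rw [← ht, nbr_nbr, ht'])).2 trivial
    rw [← ht, isSym_free, hf] at this
    simp at this
  · obtain ⟨t, rfl, ht'⟩ := D.exists_bdry a2 a1
    rw [(free_out (A := Set.univ) ht').2 trivial] at hf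
    simp at hf
  · exact (h.elim a1 a2).elim

lemma Src.interior (hS : D.Src Set.univ x ξ) {v : Vertex} {j : Fin 3} (h : ξ v j = true) :
    fc v (j + 1) ∈ D.faces ∧ fc v (j + 2) ∈ D.faces :=
  interior_of_not_free (hS.supp v j h).1 (hS.supp v j h).2

/-- Two inner edges at a vertex account for all three of its faces. -/
lemma not_mem_range {v : Vertex} {a b : Fin 3} (hab : a ≠ b)
    (h1 : fc v (a + 1) ∈ D.faces ∧ fc v (a + 2) ∈ D.faces)
    (h2 : fc v (b + 1) ∈ D.faces ∧ fc v (b + 2) ∈ D.faces) : v ∉ Set.range D.bdry := by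
  rw [mem_range_bdry]
  rintro ⟨-, k, hk⟩
  rcases fin3_cases a k with rfl | rfl | rfl
  · rcases fin3_cases k b with rfl | rfl | rfl
    · exact hab rfl
    · rw [add_one_two] at h2; exact hk h2.2
    · rw [add_two_one] at h2; exact hk h2.1
  · exact hk h1.1
  · exact hk h1.2

lemma interior_rv {d : Dart} (h : fc d.1 (d.2 + 1) ∈ D.faces ∧ fc d.1 (d.2 + 2) ∈ D.faces) :
    fc (hd d) (d.2 + 1) ∈ D.faces ∧ fc (hd d) (d.2 + 2) ∈ D.faces := by
  unfold hd
  rw [fc_nbr_add_one, fc_nbr_add_two]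
  exact h.symm

lemma stops_subset : D.stops A x ⊆ D.stops Set.univ x := by
  refine Set.insert_subset_insert ?_
  rw [term_univ]
  exact term_subset

lemma inner_le {X : EdgeSet} : ∀ v j, D.inner X v j = true → X v j = true :=
  fun _ _ h => (inner_iff.1 h).1

/-- A leg of the restricted set is an initial piece of the original leg. The latter ends elsewhere
than at `x`, so the former cannot return to `x`. -/
lemma inner_src (hx : x ∉ Set.range D.bdry) (hxf : ∀ k, fc x k ∈ D.faces) (hS : D.Src A x ξ) :
    D.Src Set.univ x (D.inner ξ) := by
  have hsym := isSym_inner (D := D) hS.sym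
  have hsupp : ∀ v j, D.inner ξ v j = true → (fc v (j + 1) ∈ D.faces ∨ fc v (j + 2) ∈ D.faces) ∧
      D.free Set.univ v j = false := fun v j h =>
    ⟨Or.inl (inner_iff.1 h).2.1, free_interior (inner_iff.1 h).2.1 (inner_iff.1 h).2.2⟩
  have heven : ∀ v ∉ D.stops Set.univ x, par (D.inner ξ) v = false := by
    intro v hv
    unfold par
    rw [par_inner (fun v j h => (hS.supp v j h).1) (fun h => hv (Or.inr (by rwa [term_univ])))]
    exact hS.even v fun h => hv (stops_subset h)
  have hstart : ∀ k, D.inner ξ x k = true := fun k => by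
    rw [inner_eq (hxf _) (hxf _)]; exact hS.start k
  have hG : Good (D.inner ξ) (D.stops Set.univ x) x :=
    ⟨hsym, heven, finite_darts fun v i hv => (hsupp v i hv).1, Or.inl rfl⟩
  refine ⟨hsym, hsupp, heven, hstart, fun k => ?_⟩
  obtain ⟨d, hd', hq⟩ := hG.exists_leg_end (hstart k)
  refine ⟨d, hd', ?_⟩
  rcases hq with hq | hq
  · exfalso
    have h1 : d ∈ Leg ξ (D.stops A x) x k := leg_mono inner_le stops_subset hd'
    obtain ⟨e, he, he1, he2⟩ := hits_of_term hx (hS.hits k)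
    rw [← hS.good.end_unique (hS.start k) h1 he (by rw [hq]; exact Or.inl rfl) he1] at he2
    exact he2 hq
  · exact hq

/-! ### Restricting triples of legs to the inner edges. -/

section Restrict

variable (hl : D.IsCorner D.ptL) (hr : D.IsCorner D.ptR) (hx : x ∉ Set.range D.bdry)
  (hxf : ∀ k, fc x k ∈ D.faces)

include hl hr hx hxf

/-- Otherwise the leg `i` would continue along `d`. But its right face is white in the colouring
without the leg `i + 1`, and its left face is white in the one without the leg `i + 2`, so both
faces are in the domain, which fails for an edge of `d`. -/
lemma inner_hits (hS : D.Src D.u x ξ) (hN : D.Norm ξ x i) : HitsArc (D.inner ξ) x i D.u := by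
  have hS' := inner_src hx hxf hS
  obtain ⟨d, hd', hd2⟩ := hS'.hits i
  rw [term_univ] at hd2
  obtain ⟨t, ht⟩ := hd2
  refine ⟨d, hd', t, ?_, ht.symm⟩
  by_contra htu
  have hd3 := leg_mono inner_le (stops_subset (A := D.u)) hd'
  have hint := hS'.interior (mem_of_mem_leg (hS'.start i) hd')
  have hq : hd d ∉ D.stops D.u x := by
    rintro (h | h)
    · exact hx ⟨t, ht.trans h⟩
    · exact htu ((mem_term_u hl hr hint.2 hint.1 ht.symm).1 h)
  obtain ⟨e, he⟩ := hS.good.exists_step (mem_of_mem_leg (hS.start i) hd3) hq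
  have he' := mem_leg_step hd3 he
  obtain ⟨ω₁, h1, b1⟩ := exists_isCol_u hx hS hN (i + 1)
  obtain ⟨ω₂, h2, b2⟩ := exists_isCol_u hx hS hN (i + 2)
  have e1 := (h1.side hx hS he').2
  have e2 := (h2.side hx hS he').1
  rw [(h1.values₁ hx hS b1).1] at e1
  rw [(h2.values₂ hx hS b2).2] at e2
  have e3 : fc e.1 (e.2 + 1) ∈ D.faces ∧ fc e.1 (e.2 + 2) ∈ D.faces :=
    ⟨h1.supp _ e1, h2.supp _ e2⟩
  rw [he.1] at e3
  exact not_mem_range he.2.1.symm (interior_rv hint) e3 ⟨t, ht⟩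

omit hl hr hx hxf in
lemma leg_inner (hS : D.Src D.u x ξ) {k : Fin 3} (h : HitsArc (D.inner ξ) x k D.u) :
    Leg (D.inner ξ) (D.stops Set.univ x) x k = Leg ξ (D.stops D.u x) x k := by
  obtain ⟨d, hd', t, ht, ht'⟩ := h
  exact hS.good.leg_eq_of_end (hS.start k) inner_le stops_subset hd'
    (Or.inr ⟨t, ht', Or.inl ht⟩)

omit hl hr in
-- A leg that ends on `u` after restriction has not been shortened, so it consists of inner edges;
-- the leg in `Norm` does not.
lemma inner_not_hits (hS : D.Src D.u x ξ) (hN : D.Norm ξ x i) :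
    ¬ (HitsArc (D.inner ξ) x (i + 1) D.u ∧ HitsArc (D.inner ξ) x (i + 2) D.u) := by
  rintro ⟨h1, h2⟩
  have hS' := inner_src hx hxf hS
  rcases hN with ⟨d, hd', h⟩ | ⟨d, hd', h⟩
  · rw [← leg_inner hS h1] at hd'
    exact h (hS'.interior (mem_of_mem_leg (hS'.start _) hd')).2
  · rw [← leg_inner hS h2] at hd'
    exact h (hS'.interior (mem_of_mem_leg (hS'.start _) hd')).1

/-- The inner edges contain the leg `i`. They determine the colouring without it, black at `fc x i`,
and this colouring determines the edges along `d`. -/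
lemma inner_injOn : Set.InjOn D.inner {ξ | D.Src D.u x ξ ∧ D.Norm ξ x i} := by
  rintro ξ ⟨h1, n1⟩ ξ' ⟨h2, n2⟩ h
  obtain ⟨ω, c1, b1⟩ := exists_isCol_u hx h1 n1 i
  obtain ⟨ω', c2, b2⟩ := exists_isCol_u hx h2 n2 i
  have hleg : legE ξ (D.stops D.u x) x i = legE ξ' (D.stops D.u x) x i := by
    refine legE_congr ?_
    rw [← leg_inner h1 (inner_hits hl hr hx hxf h1 n1),
      ← leg_inner h2 (inner_hits hl hr hx hxf h2 n2), h]
  have hω : ω = ω' := by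
    funext f
    by_cases hf : f ∈ D.faces
    · refine D.eq_of_bd_eq (hxf i) (b1.trans b2.symm) (fun v j e1 e2 => ?_) hf
      rw [← cut_interior (A := D.u) e1 e2, ← cut_interior (A := D.u) e1 e2, c1.eq, c2.eq]
      unfold xorE
      rw [hleg, ← inner_eq (D := D) (X := ξ) e1 e2, ← inner_eq (D := D) (X := ξ') e1 e2, h]
    · have e1 := mt (c1.supp f) hf
      have e2 := mt (c2.supp f) hf
      rw [Bool.not_eq_true] at e1 e2
      rw [e1, e2]
  have key := c1.eq.symm.trans ((congrArg _ hω).trans c2.eq)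
  funext v j
  have := congrFun (congrFun key v) j
  unfold xorE at this
  rw [hleg] at this
  simpa using this

end Restrict

end Domain
end HexPerc

/-! ### Extending triples of legs along `d`. -/

namespace HexPerc

lemma bool_of_not {b : Bool} (h : ¬ b = true) : b = false := by simpa using h

lemma Good.legE_eq_false_of_mem {X : EdgeSet} {Q : Set Vertex} {x v : Vertex} {k : Fin 3} {d : Dart}
    (hG : Good X Q x) (hk : X x k = true) (hd' : d ∈ Leg X Q x k) (hq : hd d ∈ Q) (hv : v ∈ Q)
    (hvx : v ≠ x) (hvd : v ≠ hd d) (j : Fin 3) : legE X Q x k v j = false := by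
  refine bool_of_not fun h => ?_
  rcases legE_iff.1 h with h | h
  · rcases leg_cases h with h' | ⟨e, -, h'⟩
    · exact hvx (congrArg Prod.fst h')
    · refine h'.2.2.2 ?_
      rw [← h'.1]; exact hv
  · have h1 : hd (rv (v, j)) = v := hd_rv _
    have := hG.end_unique hk h hd' (by rwa [h1]) hq
    rw [← this, h1] at hvd
    exact hvd rfl

namespace Domain

variable {D : Domain} {x : Vertex} {i : Fin 3} {ξ : EdgeSet}

/-- Three legs, the `i`-th of which ends at `u`, continued along the other boundary arc. -/
structure Extends (D : Domain) (x : Vertex) (i : Fin 3) (ξ' : EdgeSet) (ω : Face → Bool) :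
    Prop where
  good : Good ξ' (D.stops D.u x) x
  start : ∀ k, ξ' x k = true
  supp : ∀ f, ω f = true → f ∈ D.faces
  black : ω (fc x i) = false
  white₁ : ω (fc x (i + 1)) = true
  white₂ : ω (fc x (i + 2)) = true
  eq : D.cut D.u ω = xorE ξ' (legE ξ' (D.stops D.u x) x i)
  edges : ∀ v j, ξ' v j = true → fc v (j + 1) ∈ D.faces ∨ fc v (j + 2) ∈ D.faces
  hits : ∃ d ∈ Leg ξ' (D.stops D.u x) x i, hd d ∈ D.term D.u

namespace Extends

variable {ω : Face → Bool} (h : D.Extends x i ξ ω) (hx : x ∉ Set.range D.bdry)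
include h hx

lemma side {j : Fin 3} (hj : j ≠ i) {d : Dart} (hd' : d ∈ Leg ξ (D.stops D.u x) x j) :
    ω (lf d) = ω (fc x (j + 2)) ∧ ω (rf d) = ω (fc x (j + 1)) := by
  refine h.good.side_const (h.start j) (fun w hw a ha => ?_) hd'
  rw [← cut_eq_bd (A := D.u) fun h => hw.1 (Or.inr h), h.eq]
  unfold xorE
  rw [h.good.legE_eq_false (h.start i) hw.1 (h.good.not_visits (h.start j) (h.start i) hj
      (hits_of_term hx h.hits) hw), ha]
  rfl

lemma side₁ {d : Dart} (hd' : d ∈ Leg ξ (D.stops D.u x) x (i + 1)) :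
    ω (lf d) = false ∧ ω (rf d) = true := by
  have := h.side hx (add_one_ne i) hd'
  rwa [add_one_one, add_one_two, h.black, h.white₂] at this

lemma side₂ {d : Dart} (hd' : d ∈ Leg ξ (D.stops D.u x) x (i + 2)) :
    ω (lf d) = true ∧ ω (rf d) = false := by
  have := h.side hx (add_two_ne i) hd'
  rwa [add_two_one, add_two_two, h.black, h.white₁] at this

omit hx in
/-- A leg which meets the other arc goes along it. -/
lemma boundary_step {k : Fin 3} {d : Dart} (hd' : d ∈ Leg ξ (D.stops D.u x) x k)
    (hint : fc d.1 (d.2 + 1) ∈ D.faces ∧ fc d.1 (d.2 + 2) ∈ D.faces)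
    (hq : hd d ∉ D.stops D.u x) (hr : hd d ∈ Set.range D.bdry) :
    ∃ e ∈ Leg ξ (D.stops D.u x) x k, ¬ (rf e ∈ D.faces ∧ lf e ∈ D.faces) := by
  obtain ⟨e, he⟩ := h.good.exists_step (mem_of_mem_leg (h.start k) hd') hq
  refine ⟨e, mem_leg_step hd' he, fun e3 => ?_⟩
  change fc e.1 (e.2 + 1) ∈ D.faces ∧ fc e.1 (e.2 + 2) ∈ D.faces at e3
  rw [he.1] at e3
  exact not_mem_range he.2.1.symm (interior_rv hint) e3 hr

/-- A Jordan curve argument. The returning leg is a closed curve bounding a set `S` of faces. At `e`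
its left is outside the domain, so `S` lies on its right, where the leg `i` starts. That leg cannot
cross the curve, yet it ends at a boundary vertex, which touches a face outside the domain and hence
outside `S`. -/
lemma not_return_aux (hret : rv (x, i + 2) ∈ Leg ξ (D.stops D.u x) x (i + 1))
    {e : Dart} (he : e ∈ Leg ξ (D.stops D.u x) x (i + 1)) (h1 : lf e ∉ D.faces) : False := by
  have hx1 : hd (rv (x, i + 2)) = x := hd_rv _
  have hxQ : x ∈ D.stops D.u x := Or.inl rfl
  have hk := h.start (i + 1)
  have hx2 : ∀ j, legE ξ (D.stops D.u x) x (i + 1) x j = true ↔ j = i + 1 ∨ j = i + 2 := by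
    intro j
    rw [legE_iff]
    constructor
    · rintro (h' | h')
      · rcases leg_cases h' with h' | ⟨e, -, h'⟩
        · exact Or.inl (congrArg Prod.snd h')
        · exact absurd h' h.good.not_step_start
      · have hx3 : hd (rv (x, j)) = x := hd_rv _
        have := h.good.end_unique hk h' hret (by rw [hx3]; exact hxQ) (by rw [hx1]; exact hxQ)
        exact Or.inr (congrArg Prod.snd this)
    · rintro (rfl | rfl)
      · exact Or.inl mem_leg_start
      · exact Or.inr hret
  have hE : ∀ v ∈ D.stops D.u x, v ≠ x → ∀ j, legE ξ (D.stops D.u x) x (i + 1) v j = false :=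
    fun v hv hvx j => h.good.legE_eq_false_of_mem hk hret (by rw [hx1]; exact hxQ) hv hvx
      (by rw [hx1]; exact hvx) j
  have hxi : legE ξ (D.stops D.u x) x (i + 1) x i = false := bool_of_not fun h' => by
    rcases (hx2 i).1 h' with h' | h'
    · exact add_one_ne i h'.symm
    · exact add_two_ne i h'.symm
  obtain ⟨S, hS, hS'⟩ := D.exists_bd_eq (X := legE ξ (D.stops D.u x) x (i + 1)) isSym_legE (by
    intro v
    by_cases hv : v ∈ D.stops D.u x
    · by_cases hvx : v = x
      · rw [hvx, par_eq _ _ i, hxi, (hx2 _).2 (Or.inl rfl), (hx2 _).2 (Or.inr rfl)]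
        rfl
      · unfold par
        simp only [hE v hv hvx]
        rfl
    · exact h.good.par_legE hk hv) (fun v j h' => h.edges v j (h.good.legE_le hk h'))
  have hside := fun d (hd' : d ∈ Leg ξ (D.stops D.u x) x (i + 1)) =>
    h.good.side_const (σ := S) hk (fun w hw j hj => by
      rw [hS', h.good.legE_eq_of_visits hk hw, hj]) hd'
  have s1 : S (lf e) = false := bool_of_not fun h' => h1 (hS _ h')
  have s2 : S (rf e) = true := by
    have : bd S e.1 e.2 = true := by rw [hS']; exact legE_iff.2 (Or.inl he)
    unfold bd at this
    change (S (rf e) ^^ S (lf e)) = true at this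
    rw [s1] at this
    simpa using this
  have s3 := (hside e he).2
  rw [s2] at s3
  change true = S (fc x (i + 1 + 1)) at s3
  rw [add_one_one] at s3
  obtain ⟨d, hd', hd2⟩ := h.hits
  have hside' := h.good.side_const (σ := S) (h.start i) (fun w hw j hj => by
      rw [hS', h.good.legE_eq_false hk hw.1 fun h' => h.good.not_visits hk (h.start i)
        (add_one_ne i) (hits_of_term hx h.hits) h' hw]) hd'
  have s4 : S (lf d) = true := by rw [hside'.1, s3]; rfl
  obtain ⟨t, ht, -⟩ := id hd2
  have hdx : hd d ≠ x := fun h' => hx ⟨t, ht.symm.trans h'⟩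
  have s5 : ∀ j, S (fc (hd d) (j + 1)) = S (fc (hd d) (j + 2)) := fun j => by
    refine bool_of_bd_false ?_
    rw [hS']
    exact hE _ (Or.inr hd2) hdx j
  have s6 : ∀ j, S (fc (hd d) j) = true := by
    have h0 : S (fc (hd d) (d.2 + 1)) = true := by
      rw [← s4]; unfold hd lf; rw [fc_nbr_add_one]
    intro j
    rcases fin3_cases d.2 j with h' | h' | h'
    · have := s5 (d.2 + 2)
      rw [add_two_one, add_two_two, h0] at this
      rw [h']; exact this
    · rw [h']; exact h0
    · rw [h', ← s5]; exact h0
  obtain ⟨-, j, hj⟩ := D.mem_range_bdry.1 ⟨t, ht.symm⟩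
  exact hj (hS _ (s6 j))

/-- If one of the legs goes along the boundary then all end at `u`. -/
lemma src (he : (∃ e ∈ Leg ξ (D.stops D.u x) x (i + 1), ¬ (rf e ∈ D.faces ∧ lf e ∈ D.faces)) ∨
      ∃ e ∈ Leg ξ (D.stops D.u x) x (i + 2), ¬ (rf e ∈ D.faces ∧ lf e ∈ D.faces))
    (hfree : ∀ v j, ξ v j = true → D.free D.u v j = false) :
    D.Src D.u x ξ ∧ D.Norm ξ x i := by
  have hN : D.Norm ξ x i := by
    rcases he with ⟨e, he, h'⟩ | ⟨e, he, h'⟩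
    · exact Or.inl ⟨e, he, fun h2 => h' ⟨h.supp _ (h.side₁ hx he).2, h2⟩⟩
    · exact Or.inr ⟨e, he, fun h2 => h' ⟨h2, h.supp _ (h.side₂ hx he).1⟩⟩
  -- If the boundary dart is on the leg `i + 2`, its reverse is on the returning leg `i + 1`, with
  -- left and right exchanged.
  have hret : rv (x, i + 2) ∉ Leg ξ (D.stops D.u x) x (i + 1) := by
    intro h1
    rcases hN with ⟨e, he, h'⟩ | ⟨e, he, h'⟩
    · exact h.not_return_aux hx h1 he h'
    · refine h.not_return_aux hx h1 (h.good.rv_mem_of_return (h.start _) (h.start _) h1 he) ?_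
      rwa [lf_rv]
  refine ⟨⟨h.good.sym, fun v j hv => ⟨h.edges v j hv, hfree v j hv⟩, h.good.even, h.start,
    fun k => ?_⟩, hN⟩
  obtain ⟨d, hd', hq⟩ := h.good.exists_leg_end (h.start k)
  rcases hq with hq | hq
  swap
  · exact ⟨d, hd', hq⟩
  have e : d = rv (x, d.2) := by rw [← hq]; exact (rv_rv d).symm
  -- The colours on both sides of a leg returning to `x` leave only one possible edge of arrival.
  rcases fin3_cases i k with rfl | rfl | rfl
  · exact h.hits
  · exfalso
    have hs := h.side₁ hx hd'
    rw [e, lf_rv, rf_rv] at hs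
    simp only [lf, rf] at hs
    rcases fin3_cases i d.2 with h' | h' | h'
    · rw [h', h.white₁] at hs; simp at hs
    · rw [h', add_one_two, h.black] at hs; simp at hs
    · rw [h'] at e
      rw [e] at hd'
      exact hret hd'
  · exfalso
    have hs := h.side₂ hx hd'
    rw [e, lf_rv, rf_rv] at hs
    simp only [lf, rf] at hs
    rcases fin3_cases i d.2 with h' | h' | h'
    · rw [h', h.white₂] at hs; simp at hs
    · rw [h'] at e
      rw [e] at hd'
      exact hret (h.good.return_symm (h.start _) (h.start _) hd')
    · rw [h', add_two_one, h.black] at hs; simp at hs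

end Extends

/-- Take the colouring, black at `fc x i`, whose interfaces are `ξ` without the leg `i`. Counting
the outside of `d` as black adds boundary edges along `d`; then put the leg `i` back. As the other
two legs do not both end on `u`, one of them now runs along `d`, and `Extends.src` applies. -/
lemma inner_surj (hl : D.IsCorner D.ptL) (hr : D.IsCorner D.ptR) (hx : x ∉ Set.range D.bdry)
    (hxf : ∀ k, fc x k ∈ D.faces) (hS : D.Src Set.univ x ξ) (hi : HitsArc ξ x i D.u)
    (hn : ¬ (HitsArc ξ x (i + 1) D.u ∧ HitsArc ξ x (i + 2) D.u)) :
    ∃ ξ', (D.Src D.u x ξ' ∧ D.Norm ξ' x i) ∧ D.inner ξ' = ξ := by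
  obtain ⟨ω, c, b⟩ := exists_isCol_univ (i := i) hx hxf hS i
  obtain ⟨w1, w2⟩ := c.values₀ hx hS b
  obtain ⟨d₀, hd₀, t₀, ht₀, hdt₀⟩ := hi
  set L := legE ξ (D.stops Set.univ x) x i with hL
  have hLint : ∀ v j, L v j = true → fc v (j + 1) ∈ D.faces ∧ fc v (j + 2) ∈ D.faces :=
    fun v j h => hS.interior (hS.good.legE_le (hS.start i) h)
  have hLstop : ∀ v ∈ Set.range D.bdry, v ∉ D.term D.u → ∀ j, L v j = false := by
    intro v hv hvu j
    refine hS.good.legE_eq_false_of_mem (hS.start i) hd₀ (Or.inr ?_) (Or.inr ?_) ?_ ?_ j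
    · rw [term_univ]; exact ⟨t₀, hdt₀.symm⟩
    · rwa [term_univ]
    · rintro rfl; exact hx hv
    · rintro rfl; exact hvu ⟨t₀, hdt₀, Or.inl ht₀⟩
  set ξ' := xorE (D.cut D.u ω) L with hξ'
  have hin : D.inner ξ' = ξ := by
    funext v j
    by_cases h : fc v (j + 1) ∈ D.faces ∧ fc v (j + 2) ∈ D.faces
    · rw [inner_eq h.1 h.2]
      have h1 := congrFun (congrFun c.eq v) j
      rw [cut_interior h.1 h.2] at h1
      rw [hξ']
      unfold xorE at h1 ⊢
      rw [cut_interior h.1 h.2, h1, ← hL, Bool.xor_assoc, Bool.xor_self, Bool.xor_false]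
    · have h1 := bool_of_not (fun h' => h (inner_iff (D := D) (X := ξ') (v := v) (i := j).1 h').2)
      have h2 := bool_of_not (fun h' => h (hS.interior (v := v) (j := j) h'))
      rw [h1, h2]
  have hsupp : ∀ v j, ξ' v j = true → (fc v (j + 1) ∈ D.faces ∨ fc v (j + 2) ∈ D.faces) ∧
      D.free D.u v j = false := by
    intro v j h
    by_cases h' : L v j = true
    · exact ⟨Or.inl (hLint v j h').1, free_interior (hLint v j h').1 (hLint v j h').2⟩
    · rw [hξ'] at h
      unfold xorE at h
      rw [bool_of_not h', Bool.xor_false] at h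
      exact cut_supp c.supp h
  have hG : Good ξ' (D.stops D.u x) x := by
    refine ⟨isSym_cut.xor isSym_legE, fun v hv => ?_, finite_darts fun v j h => (hsupp v j h).1,
      Or.inl rfl⟩
    refine par_xorE (par_cut fun h => hv (Or.inr h)) ?_
    by_cases hv' : v ∈ Set.range D.bdry
    · unfold par
      simp only [hLstop v hv' fun h => hv (Or.inr h)]
      rfl
    · refine hS.good.par_legE (hS.start i) ?_
      rintro (h | h)
      · exact hv (Or.inl h)
      · rw [term_univ] at h; exact hv' h
  have hle : ∀ v j, ξ v j = true → ξ' v j = true := by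
    rw [← hin]; exact inner_le
  have hstart : ∀ k, ξ' x k = true := fun k => hle _ _ (hS.start k)
  have hleg : Leg ξ (D.stops Set.univ x) x i = Leg ξ' (D.stops D.u x) x i :=
    hG.leg_eq_of_end (hstart i) hle stops_subset hd₀ (Or.inr ⟨t₀, hdt₀, Or.inl ht₀⟩)
  have hX : D.Extends x i ξ' ω := by
    refine ⟨hG, hstart, c.supp, b, w1, w2, ?_, fun v j h => (hsupp v j h).1, ?_⟩
    · rw [← legE_congr hleg, ← hL, hξ']
      funext v j
      unfold xorE
      rw [Bool.xor_assoc, Bool.xor_self, Bool.xor_false]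
    · rw [← hleg]
      exact ⟨d₀, hd₀, t₀, hdt₀, Or.inl ht₀⟩
  have key : ∀ k, ¬ HitsArc ξ x k D.u →
      ∃ e ∈ Leg ξ' (D.stops D.u x) x k, ¬ (rf e ∈ D.faces ∧ lf e ∈ D.faces) := by
    intro k hk
    obtain ⟨d, hd', hd2⟩ := hS.hits k
    rw [term_univ] at hd2
    obtain ⟨t, ht⟩ := id hd2
    have hint := hS.interior (mem_of_mem_leg (hS.start k) hd')
    refine hX.boundary_step (leg_mono hle stops_subset hd') hint ?_ hd2
    rintro (h | h)
    · exact hx (h ▸ hd2)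
    · exact hk ⟨d, hd', t, (mem_term_u hl hr hint.2 hint.1 ht.symm).1 h, ht.symm⟩
  refine ⟨ξ', hX.src hx ?_ fun v j h => (hsupp v j h).2, hin⟩
  by_cases h1 : HitsArc ξ x (i + 1) D.u
  · exact Or.inr (key _ fun h2 => hn ⟨h1, h2⟩)
  · exact Or.inl (key _ h1)

/-- Brings the boundary condition on `u` back to the free one, in which all four derivatives are
compared. -/
lemma bijOn_inner (hl : D.IsCorner D.ptL) (hr : D.IsCorner D.ptR) (hx : x ∉ Set.range D.bdry)
    (hxf : ∀ k, fc x k ∈ D.faces) : Set.BijOn D.inner {ξ | D.Src D.u x ξ ∧ D.Norm ξ x i}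
      {ξ | D.Src Set.univ x ξ ∧ HitsArc ξ x i D.u ∧
        ¬ (HitsArc ξ x (i + 1) D.u ∧ HitsArc ξ x (i + 2) D.u)} := by
  refine ⟨?_, inner_injOn hl hr hx hxf, ?_⟩
  · rintro ξ ⟨h1, h2⟩
    exact ⟨inner_src hx hxf h1, inner_hits hl hr hx hxf h1 h2, inner_not_hits hx hxf h1 h2⟩
  · rintro ξ ⟨h1, h2, h3⟩
    obtain ⟨ξ', h4, h5⟩ := inner_surj hl hr hx hxf h1 h2 h3
    exact ⟨ξ', h4, h5⟩

end Domain
end HexPerc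

/-! ### Paths of hexagons and their two sides. -/

namespace HexPerc

/-- Deleting two edges of a six-cycle leaves two arcs. In the application `P` is the component of a
corner. -/
lemma hexagon_arcs {α : Type*} (P : Fin 6 → α) (k₁ k₂ : Fin 6)
    (h : ∀ k, k ≠ k₁ → k ≠ k₂ → P k = P (k + 1)) : P (k₁ + 1) = P k₂ ∧ P (k₂ + 1) = P k₁ := by
  have h0 := h 0
  have h1 := h 1
  have h2 := h 2
  have h3 := h 3
  have h4 := h 4
  have h5 := h 5
  clear h
  fin_cases k₁ <;> fin_cases k₂ <;> simp at h0 h1 h2 h3 h4 h5 ⊢ <;> simp_all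

lemma hexagon_all (P : Fin 6 → Prop) (k₁ k₂ : Fin 6) (h1 : P k₁) (h1' : P (k₁ + 1)) (h2 : P k₂)
    (h2' : P (k₂ + 1)) (h : ∀ k, k ≠ k₁ → k ≠ k₂ → P k = P (k + 1)) (k : Fin 6) : P k := by
  have g0 := h 0
  have g1 := h 1
  have g2 := h 2
  have g3 := h 3
  have g4 := h 4
  have g5 := h 5
  clear h
  have key : P 0 ∧ P 1 ∧ P 2 ∧ P 3 ∧ P 4 ∧ P 5 := by
    fin_cases k₁ <;> fin_cases k₂ <;> simp at g0 g1 g2 g3 g4 g5 h1 h1' h2 h2' <;> simp_all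
  obtain ⟨p0, p1, p2, p3, p4, p5⟩ := key
  fin_cases k <;> assumption

lemma corner_injective (f : Face) : Function.Injective (corner f) := by
  obtain ⟨a, b⟩ := f
  intro k k' h
  fin_cases k <;> fin_cases k' <;> simp [corner] at h ⊢ <;> omega

lemma LeftOf.next_unique {f : Face} {a b b' : Vertex} (h : LeftOf f a b) (h' : LeftOf f a b') :
    b = b' := by
  obtain ⟨k, rfl, rfl⟩ := h
  obtain ⟨k', e, rfl⟩ := h'
  rw [corner_injective f e]

section Hexagon

variable {r : Vertex → Vertex → Prop} (hr : Equivalence r) {f : Face} {a b a' b' : Vertex}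
  (h1 : LeftOf f a b) (h2 : LeftOf f a' b')
  (h : ∀ c c', LeftOf f c c' → c ≠ a → c ≠ a' → r c c')
include hr h1 h2 h

lemma hexagon_sides : r b a' ∧ r a b' := by
  obtain ⟨k₁, rfl, rfl⟩ := h1
  obtain ⟨k₂, rfl, rfl⟩ := h2
  let s : Setoid Vertex := ⟨r, hr⟩
  have := hexagon_arcs (fun k => (Quotient.mk s (corner f k))) k₁ k₂ fun k e1 e2 =>
    Quotient.sound (h _ _ ⟨k, rfl, rfl⟩ (fun e => e1 (corner_injective f e))
      (fun e => e2 (corner_injective f e)))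
  exact ⟨Quotient.exact this.1, hr.symm (Quotient.exact this.2)⟩

lemma hexagon_cover {v : Vertex} {k : Fin 6} (hv : v = corner f k) : r v a ∨ r v b := by
  have hs := hexagon_sides hr h1 h2 h
  obtain ⟨k₁, rfl, rfl⟩ := h1
  obtain ⟨k₂, rfl, rfl⟩ := h2
  subst hv
  refine hexagon_all (fun k => r (corner f k) (corner f k₁) ∨ r (corner f k) (corner f (k₁ + 1)))
    k₁ k₂ (Or.inl (hr.refl _)) (Or.inr (hr.refl _)) (Or.inr (hr.symm hs.1))
    (Or.inl (hr.symm hs.2)) (fun k e1 e2 => ?_) k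
  have := h _ _ ⟨k, rfl, rfl⟩ (fun e => e1 (corner_injective f e))
      (fun e => e2 (corner_injective f e))
  have e : ∀ z, r (corner f k) z ↔ r (corner f (k + 1)) z :=
    fun z => ⟨fun hz => hr.trans (hr.symm this) hz, fun hz => hr.trans this hz⟩
  simp only [e]

end Hexagon

lemma infix_pair_iff {α : Type*} {l : List α} {a b : α} :
    [a, b] <:+: l ↔ ∃ n, l[n]? = some a ∧ l[n + 1]? = some b := by
  constructor
  · rintro ⟨s, t, rfl⟩
    refine ⟨s.length, ?_, ?_⟩ <;> simp
  · rintro ⟨n, h1, h2⟩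
    refine ⟨l.take n, l.drop (n + 2), ?_⟩
    obtain ⟨h1', rfl⟩ := List.getElem?_eq_some_iff.1 h1
    obtain ⟨h2', rfl⟩ := List.getElem?_eq_some_iff.1 h2
    rw [List.append_assoc]
    conv_rhs => rw [← List.take_append_drop n l, List.drop_eq_getElem_cons h1',
      List.drop_eq_getElem_cons h2']
    rfl

lemma index_unique {α : Type*} {l : List α} (hl : l.Nodup) {m n : ℕ} {a : α}
    (h1 : l[m]? = some a) (h2 : l[n]? = some a) : m = n := by
  obtain ⟨h1', rfl⟩ := List.getElem?_eq_some_iff.1 h1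
  obtain ⟨h2', h⟩ := List.getElem?_eq_some_iff.1 h2
  exact (hl.getElem_inj_iff.1 h).symm

namespace Domain

variable {D : Domain}

lemma not_leftOf_bdry {f : Face} {t : ZMod D.len} (h : LeftOf f (D.bdry (t + 1)) (D.bdry t)) :
    f ∉ D.faces := fun hf => ((D.bdry_edges _ _).1 ⟨t, rfl, rfl⟩).2 ⟨f, hf, h⟩

lemma exists_hasBdryEdge (t : ZMod D.len) : ∃ f ∈ D.faces, D.HasBdryEdge f t :=
  ((D.bdry_edges _ _).1 ⟨t, rfl, rfl⟩).1

lemma adj_of_leftOf {f : Face} (hf : f ∈ D.faces) {a b : Vertex} (h : LeftOf f a b) :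
    D.graph.Adj a b := by
  obtain ⟨i, rfl, rfl⟩ := leftOf_iff.1 h
  exact D.graph_adj.2 ⟨i, rfl, Or.inr hf⟩

namespace Crosscut

variable (c : D.Crosscut)

/-- The edges of the domain which are not crossed. -/
def av : SimpleGraph Vertex := D.graph.deleteEdges c.crossed

variable {c}

lemma av_adj {a b : Vertex} : c.av.Adj a b ↔ D.graph.Adj a b ∧ s(a, b) ∉ c.crossed :=
  SimpleGraph.deleteEdges_adj

lemma reach_equiv : Equivalence c.av.Reachable := c.av.reachable_is_equivalence

/-- From here on separation is treated through the components of `av`. -/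
lemma separates_iff {A B : Set Vertex} :
    c.Separates A B ↔ ∀ a ∈ A, ∀ b ∈ B, ¬ c.av.Reachable a b := by
  refine forall₄_congr fun a _ b _ => ?_
  constructor
  · rintro h ⟨p⟩
    have hle : c.av ≤ D.graph := SimpleGraph.deleteEdges_le _
    obtain ⟨e, he, he'⟩ := h (p.mapLe hle)
    rw [SimpleGraph.Walk.edges_mapLe_eq_edges] at he
    have := p.edges_subset_edgeSet he
    unfold av at this
    rw [SimpleGraph.edgeSet_deleteEdges] at this
    exact this.2 he'
  · intro h p
    by_contra hcon
    push Not at hcon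
    exact h ⟨p.toDeleteEdges _ hcon⟩

section Joins

variable {A B : Set (ZMod D.len)} (hc : c.Joins A B)

include hc

lemma Joins.mem_faces {n : ℕ} {f : Face} (h : c.path[n]? = some f) : f ∈ D.faces :=
  hc.2.2.1 f (List.mem_of_getElem? h)

lemma Joins.first_edge : ∃ f, c.path[0]? = some f ∧ D.HasBdryEdge f c.first := by
  obtain ⟨f, h1, h2⟩ := hc.2.2.2.2.2.1
  refine ⟨f, ?_, h2⟩
  rwa [← List.head?_eq_getElem?]

lemma Joins.last_edge : ∃ f, c.path[c.path.length - 1]? = some f ∧ D.HasBdryEdge f c.last := by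
  obtain ⟨f, h1, h2⟩ := hc.2.2.2.2.2.2
  refine ⟨f, ?_, h2⟩
  rwa [← List.getLast?_eq_getElem?]

/-- The edges of a face which are crossed are the entrance and the exit. -/
lemma Joins.crossed_cases {n : ℕ} {f : Face} (h : c.path[n]? = some f) {a b : Vertex}
    (hab : LeftOf f a b) (hcr : s(a, b) ∈ c.crossed) :
    (n = 0 ∧ a = D.bdry c.first) ∨ (n = c.path.length - 1 ∧ a = D.bdry c.last) ∨
      (∃ m g, n = m + 1 ∧ c.path[m]? = some g ∧ LeftOf g b a) ∨
      ∃ g, c.path[n + 1]? = some g ∧ LeftOf g b a := by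
  have hf := hc.mem_faces h
  have key : ∀ t, s(a, b) = s(D.bdry t, D.bdry (t + 1)) → a = D.bdry t ∧ D.HasBdryEdge f t := by
    intro t ht
    rcases Sym2.eq_iff.1 ht with ⟨rfl, rfl⟩ | ⟨rfl, rfl⟩
    · exact ⟨rfl, hab⟩
    · exact absurd hf (not_leftOf_bdry hab)
  rcases hcr with hcr | hcr | ⟨g, g', z, z', hg, hz, hz', he⟩
  · obtain ⟨h1, h2⟩ := key _ hcr
    obtain ⟨f', h3, h4⟩ := hc.first_edge
    rw [LeftOf.unique h4 h2] at h3
    exact Or.inl ⟨index_unique hc.2.1 h h3, h1⟩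
  · obtain ⟨h1, h2⟩ := key _ hcr
    obtain ⟨f', h3, h4⟩ := hc.last_edge
    rw [LeftOf.unique h4 h2] at h3
    exact Or.inr (Or.inl ⟨index_unique hc.2.1 h h3, h1⟩)
  · obtain ⟨m, hm, hm'⟩ := infix_pair_iff.1 hg
    rcases Sym2.eq_iff.1 he with ⟨rfl, rfl⟩ | ⟨rfl, rfl⟩
    · cases LeftOf.unique hab hz
      rw [index_unique hc.2.1 h hm]
      exact Or.inr (Or.inr (Or.inr ⟨g', hm', hz'⟩))
    · cases LeftOf.unique hab hz'
      exact Or.inr (Or.inr (Or.inl ⟨m, g, index_unique hc.2.1 h hm', hm, hz⟩))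

/-- The entrance of a face of the path, with its sides. -/
lemma Joins.entrance (n : ℕ) {f : Face} (h : c.path[n]? = some f) :
    ∃ a b, LeftOf f a b ∧ c.av.Reachable a (D.bdry c.first) ∧
      c.av.Reachable b (D.bdry (c.first + 1)) ∧
      (n = 0 ∧ a = D.bdry c.first ∨ ∃ m g, n = m + 1 ∧ c.path[m]? = some g ∧ LeftOf g b a) := by
  induction n generalizing f with
  | zero =>
    obtain ⟨f', h1, h2⟩ := hc.first_edge
    cases h1.symm.trans h
    exact ⟨_, _, h2, .rfl, .rfl, Or.inl ⟨rfl, rfl⟩⟩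
  | succ n ih =>
    have hn : n < c.path.length := by
      have := (List.getElem?_eq_some_iff.1 h).1
      omega
    have hg : c.path[n]? = some c.path[n] := List.getElem?_eq_getElem hn
    obtain ⟨a, b, h1, h2, h3, h4⟩ := ih hg
    have hadj : FaceAdj c.path[n] f := by
      obtain ⟨h5, rfl⟩ := List.getElem?_eq_some_iff.1 h
      exact List.isChain_iff_getElem.1 hc.1.2 n h5
    obtain ⟨a', b', h5, h6⟩ := hadj
    refine ⟨b', a', h6, ?_, ?_, Or.inr ⟨n, _, rfl, hg, h5⟩⟩
    all_goals
      -- Only the entrance and the exit of a hexagon are crossed, so its two remaining arcs carry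
      -- both sides from one to the other.
      have hs := hexagon_sides (reach_equiv (c := c)) h1 h5 (fun z z' hz e1 e2 => by
        refine SimpleGraph.Adj.reachable (av_adj.2
          ⟨adj_of_leftOf (hc.mem_faces hg) hz, fun hcr => ?_⟩)
        rcases hc.crossed_cases hg hz hcr with ⟨e3, e4⟩ | ⟨e3, e4⟩ | ⟨m, g, e3, e4, e5⟩ |
          ⟨g, e3, e4⟩
        · rcases h4 with ⟨-, h4⟩ | ⟨m, g, h7, -⟩
          · exact e1 (e4.trans h4.symm)
          · omega
        · have := (List.getElem?_eq_some_iff.1 h).1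
          omega
        · rcases h4 with ⟨h7, -⟩ | ⟨m', g', h7, h8, h9⟩
          · omega
          · have : m = m' := by omega
            subst this
            cases e4.symm.trans h8
            exact e1 (leftOf_unique_edge hz e5 h1 h9).1
        · cases e3.symm.trans h
          exact e2 (leftOf_unique_edge hz e4 h5 h6).1)
    · exact hs.2.symm.trans h2
    · exact hs.1.symm.trans h3

/-- The entrance and the exit of a face of the path. -/
lemma Joins.face_sides {n : ℕ} {f : Face} (h : c.path[n]? = some f) :
    ∃ a b a' b', LeftOf f a b ∧ LeftOf f a' b' ∧ c.av.Reachable a (D.bdry c.first) ∧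
      c.av.Reachable b (D.bdry (c.first + 1)) ∧
      (n = c.path.length - 1 → a' = D.bdry c.last) ∧
      ∀ z z', LeftOf f z z' → z ≠ a → z ≠ a' → c.av.Reachable z z' := by
  obtain ⟨a, b, h1, h2, h3, h4⟩ := hc.entrance n h
  have hn := (List.getElem?_eq_some_iff.1 h).1
  have aux : ∀ z z', LeftOf f z z' → z ≠ a → s(z, z') ∈ c.crossed →
      (n = c.path.length - 1 ∧ z = D.bdry c.last) ∨
      ∃ g, c.path[n + 1]? = some g ∧ LeftOf g z' z := by
    intro z z' hz e1 hcr
    rcases hc.crossed_cases h hz hcr with ⟨e3, e4⟩ | e3 | ⟨m, g, e3, e4, e5⟩ | e3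
    · rcases h4 with ⟨-, h4⟩ | ⟨m, g, h7, -⟩
      · exact absurd (e4.trans h4.symm) e1
      · omega
    · exact Or.inl e3
    · rcases h4 with ⟨h7, -⟩ | ⟨m', g', h7, h8, h9⟩
      · omega
      · have : m = m' := by omega
        subst this
        cases e4.symm.trans h8
        exact absurd (leftOf_unique_edge hz e5 h1 h9).1 e1
    · exact Or.inr e3
  by_cases hlast : n = c.path.length - 1
  · obtain ⟨f', h5, h6⟩ := hc.last_edge
    rw [← hlast] at h5
    cases h5.symm.trans h
    refine ⟨a, b, _, _, h1, h6, h2, h3, fun _ => rfl, fun z z' hz e1 e2 => ?_⟩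
    refine SimpleGraph.Adj.reachable (av_adj.2
      ⟨adj_of_leftOf (hc.mem_faces h) hz, fun hcr => ?_⟩)
    rcases aux z z' hz e1 hcr with ⟨-, e3⟩ | ⟨g, e3, -⟩
    · exact e2 e3
    · have := (List.getElem?_eq_some_iff.1 e3).1
      omega
  · have hn' : n + 1 < c.path.length := by omega
    have hg : c.path[n + 1]? = some c.path[n + 1] := List.getElem?_eq_getElem hn'
    obtain ⟨a', b', h5, h6⟩ : FaceAdj f c.path[n + 1] := by
      obtain ⟨h5, rfl⟩ := List.getElem?_eq_some_iff.1 h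
      exact List.isChain_iff_getElem.1 hc.1.2 n hn'
    refine ⟨a, b, a', b', h1, h5, h2, h3, fun h => absurd h hlast, fun z z' hz e1 e2 => ?_⟩
    refine SimpleGraph.Adj.reachable (av_adj.2
      ⟨adj_of_leftOf (hc.mem_faces h) hz, fun hcr => ?_⟩)
    rcases aux z z' hz e1 hcr with ⟨e3, -⟩ | ⟨g, e3, e4⟩
    · exact hlast e3
    · cases e3.symm.trans hg
      exact e2 (leftOf_unique_edge hz e4 h5 h6).1

/-- The ends of the last edge. -/
lemma Joins.last_sides : c.av.Reachable (D.bdry (c.last + 1)) (D.bdry c.first) ∧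
    c.av.Reachable (D.bdry c.last) (D.bdry (c.first + 1)) := by
  obtain ⟨f, h, h6⟩ := hc.last_edge
  obtain ⟨a, b, a', b', h1, h2, h3, h4, h5, h7⟩ := hc.face_sides h
  cases h5 rfl
  cases LeftOf.next_unique h6 h2
  have hs := hexagon_sides (reach_equiv (c := c)) h1 h2 h7
  exact ⟨hs.2.symm.trans h3, hs.1.symm.trans h4⟩

/-- The ends of the edge between two consecutive hexagons. -/
lemma Joins.step_sides {v : Vertex} {j : Fin 3} (h : [fc v (j + 1), fc v (j + 2)] <:+: c.path) :
    c.av.Reachable v (D.bdry c.first) ∧ c.av.Reachable (nbr v j) (D.bdry (c.first + 1)) := by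
  obtain ⟨n, h1, h2⟩ := infix_pair_iff.1 h
  obtain ⟨a, b, h3, h4, h5, h6⟩ := hc.entrance (n + 1) h2
  rcases h6 with ⟨h6, -⟩ | ⟨m, g, h6, h7, h8⟩
  · omega
  · have : m = n := by omega
    subst this
    cases h7.symm.trans h1
    obtain ⟨rfl, rfl⟩ := leftOf_unique_edge h3 h8 (leftOf_nbr v j) (leftOf_nbr_rev v j)
    exact ⟨h4, h5⟩

/-- Every vertex is on one of the two sides. -/
lemma Joins.cover {f : Face} (hf : f ∈ D.faces) {k : Fin 6} :
    c.av.Reachable (corner f k) (D.bdry c.first) ∨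
      c.av.Reachable (corner f k) (D.bdry (c.first + 1)) := by
  let G : Face → Prop := fun g => ∀ k, c.av.Reachable (corner g k) (D.bdry c.first) ∨
    c.av.Reachable (corner g k) (D.bdry (c.first + 1))
  have hpath : ∀ (n : ℕ) (g : Face), c.path[n]? = some g → G g := by
    intro n g h k
    obtain ⟨a, b, a', b', h1, h2, h3, h4, h5, h7⟩ := hc.face_sides h
    rcases hexagon_cover (reach_equiv (c := c)) h1 h2 h7 (v := corner g k) rfl with h8 | h8
    · exact Or.inl (h8.trans h3)
    · exact Or.inr (h8.trans h4)
  -- A hexagon off the path has no crossed edge, so all its corners are joined to those shared with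
  -- a neighbour; the property spreads through the connected domain.
  have hstep : ∀ g g', g ∈ D.faces → FaceAdj g g' → G g' → G g := by
    intro g g' hg hadj hG
    by_cases hgp : g ∈ c.path
    · obtain ⟨n, hn⟩ := List.mem_iff_getElem?.1 hgp
      exact hpath n g hn
    · obtain ⟨a, b, ⟨k₀, rfl, rfl⟩, ⟨k₁, e1, e2⟩⟩ := hadj
      have hall : ∀ z z', LeftOf g z z' → c.av.Reachable z z' := by
        intro z z' hz
        refine SimpleGraph.Adj.reachable (av_adj.2 ⟨adj_of_leftOf hg hz, fun hcr => ?_⟩)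
        rcases hcr with hcr | hcr | ⟨p, q, y, y', hpq, hy, hy', he⟩
        · rcases Sym2.eq_iff.1 hcr with ⟨rfl, rfl⟩ | ⟨rfl, rfl⟩
          · obtain ⟨f', h3, h4⟩ := hc.first_edge
            rw [LeftOf.unique h4 hz] at h3
            exact hgp (List.mem_of_getElem? h3)
          · exact not_leftOf_bdry hz hg
        · rcases Sym2.eq_iff.1 hcr with ⟨rfl, rfl⟩ | ⟨rfl, rfl⟩
          · obtain ⟨f', h3, h4⟩ := hc.last_edge
            rw [LeftOf.unique h4 hz] at h3
            exact hgp (List.mem_of_getElem? h3)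
          · exact not_leftOf_bdry hz hg
        · rcases Sym2.eq_iff.1 he with ⟨rfl, rfl⟩ | ⟨rfl, rfl⟩
          · rw [← LeftOf.unique hz hy] at hpq
            exact hgp (hpq.subset (by simp))
          · rw [← LeftOf.unique hz hy'] at hpq
            exact hgp (hpq.subset (by simp))
      intro k
      have h0 := hG k₁
      rw [← e1] at h0
      rcases hexagon_cover (reach_equiv (c := c)) (f := g) ⟨k₀, rfl, rfl⟩ ⟨k₀, rfl, rfl⟩
        (fun z z' hz _ _ => hall z z' hz) (v := corner g k) rfl with h8 | h8
      · have h9 := hall _ _ (⟨k₀, rfl, rfl⟩ : LeftOf g _ _)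
        exact h0.imp (fun h => (h8.trans h9).trans h) (fun h => (h8.trans h9).trans h)
      · exact h0.imp (fun h => h8.trans h) (fun h => h8.trans h)
  obtain ⟨f₀, h0, -⟩ := hc.first_edge
  obtain ⟨γ, ⟨-, hγ⟩, h1, h2, h3⟩ := D.connected f hf f₀ (hc.mem_faces h0)
  have hG0 : G f₀ := hpath 0 f₀ h0
  have : ∀ g ∈ γ, G g ↔ G f₀ := by
    intro g hg
    have := chain_const (R := fun p q => FaceAdj p q) (fun g => G g) hγ (fun p hp q hq hpq =>
      propext ⟨hstep q p (h1 q hq) hpq.symm, hstep p q (h1 p hp) hpq⟩) hg h3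
    exact iff_of_eq this
  exact (this f h2).2 hG0 k

end Joins

end Crosscut

end Domain
end HexPerc

/-! ### Separation by a path of hexagons, and the order of boundary vertices. -/

namespace HexPerc

/-- A single edge. -/
def oneEdge (x : Vertex) (i : Fin 3) : EdgeSet := fun v j =>
  decide ((v, j) = (x, i)) || decide (rv (v, j) = (x, i))

lemma oneEdge_iff {x v : Vertex} {i j : Fin 3} : oneEdge x i v j = true ↔
    v = x ∧ j = i ∨ v = nbr x i ∧ j = i := by
  unfold oneEdge rv hd
  simp only [Bool.or_eq_true, decide_eq_true_iff, Prod.mk.injEq]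
  refine or_congr Iff.rfl (and_congr_left fun h => ?_)
  subst h
  constructor
  · intro h; rw [← h, nbr_nbr]
  · intro h; rw [h, nbr_nbr]

lemma isSym_oneEdge {x : Vertex} {i : Fin 3} : IsSym (oneEdge x i) := by
  intro v j
  rw [Bool.eq_iff_iff, oneEdge_iff, oneEdge_iff]
  by_cases h : j = i
  · subst h
    have e1 : nbr v j = x ↔ v = nbr x j :=
      ⟨fun h => by rw [← h, nbr_nbr], fun h => by rw [h, nbr_nbr]⟩
    have e2 : nbr v j = nbr x j ↔ v = x :=
      ⟨fun h => by rw [← nbr_nbr v j, h, nbr_nbr], fun h => by rw [h]⟩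
    rw [e1, e2]
    tauto
  · simp [h]

lemma par_oneEdge {x : Vertex} {i : Fin 3} (v : Vertex) :
    par (oneEdge x i) v = (decide (v = x) ^^ decide (v = nbr x i)) := by
  have h1 : oneEdge x i v (i + 1) = false := bool_of_not fun h => by
    rcases oneEdge_iff.1 h with ⟨-, h⟩ | ⟨-, h⟩ <;> exact add_one_ne i h
  have h2 : oneEdge x i v (i + 2) = false := bool_of_not fun h => by
    rcases oneEdge_iff.1 h with ⟨-, h⟩ | ⟨-, h⟩ <;> exact add_two_ne i h
  rw [par_eq _ _ i, h1, h2, Bool.xor_false, Bool.xor_false, Bool.eq_iff_iff, oneEdge_iff]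
  by_cases h3 : v = x
  · subst h3
    simp [(nbr_ne v i).symm]
  · simp [h3]

/-- Loop erasure: when the new head already occurs, everything before its occurrence is dropped. -/
lemma exists_simple_chain {α : Type*} {T : α → α → Prop} {a b : α}
    (h : Relation.ReflTransGen T a b) :
    ∃ l : List α, l.IsChain T ∧ l.head? = some a ∧ l.getLast? = some b ∧ l.Nodup := by
  induction h using Relation.ReflTransGen.head_induction_on with
  | refl => exact ⟨[b], by simp⟩
  | @head a a' h _ ih =>
    obtain ⟨l, h1, h2, h3, h4⟩ := ih
    by_cases ha : a ∈ l
    · obtain ⟨s, t, rfl⟩ := List.append_of_mem ha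
      refine ⟨a :: t, h1.right_of_append, rfl, ?_, (List.nodup_append.1 h4).2.1⟩
      rw [← h3, List.getLast?_append_of_ne_nil]
      simp
    · refine ⟨a :: l, ?_, rfl, ?_, List.nodup_cons.2 ⟨ha, h4⟩⟩
      · cases l with
        | nil => simp
        | cons c l =>
          simp only [List.head?_cons, Option.some.injEq] at h2
          subst h2
          exact List.isChain_cons_cons.2 ⟨h, h1⟩
      · cases l with
        | nil => simp at h2
        | cons c l => simpa using h3

lemma exists_exit {α : Type*} {T : α → α → Prop} {P : α → Prop} {l : List α} (h : l.IsChain T)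
    {a b : α} (h1 : l.head? = some a) (h2 : l.getLast? = some b) (ha : P a) (hb : ¬ P b) :
    ∃ p q, [p, q] <:+: l ∧ T p q ∧ P p ∧ ¬ P q := by
  induction l generalizing a with
  | nil => simp at h1
  | cons c l ih =>
    simp only [List.head?_cons, Option.some.injEq] at h1
    subst h1
    cases l with
    | nil =>
      simp only [List.getLast?_singleton, Option.some.injEq] at h2
      subst h2
      exact absurd ha hb
    | cons d l =>
      rw [List.isChain_cons_cons] at h
      by_cases hd : P d
      · obtain ⟨p, q, h3, h4⟩ := ih h.2 rfl (by simpa using h2) hd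
        exact ⟨p, q, h3.trans (List.suffix_cons _ _).isInfix, h4⟩
      · exact ⟨c, d, (List.prefix_append [c, d] l).isInfix, h.1, ha, hd⟩

lemma isChain_infix {α : Type*} {l : List α} : l.IsChain fun p q => [p, q] <:+: l := by
  rw [List.isChain_iff_getElem]
  intro n hn
  exact infix_pair_iff.2 ⟨n, by simp, by simp⟩

lemma reflTransGen_of_chain {α : Type*} {T : α → α → Prop} {l : List α} (h : l.IsChain T) {a b : α}
    (h1 : l.head? = some a) (h2 : l.getLast? = some b) : Relation.ReflTransGen T a b := by
  induction l generalizing a with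
  | nil => simp at h1
  | cons c l ih =>
    simp only [List.head?_cons, Option.some.injEq] at h1
    subst h1
    cases l with
    | nil =>
      simp only [List.getLast?_singleton, Option.some.injEq] at h2
      subst h2
      exact .refl
    | cons d l =>
      rw [List.isChain_cons_cons] at h
      exact .head h.1 (ih h.2 rfl (by simpa using h2))

namespace Domain

variable {D : Domain}

/-- The position of a boundary edge after `r`. -/
def pos (t : ZMod D.len) : ℕ := (t - D.r).val

lemma pos_lt (t : ZMod D.len) : pos t < D.len := ZMod.val_lt _

lemma pos_injective : Function.Injective (pos (D := D)) := fun _ _ h =>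
  sub_left_injective (ZMod.val_injective _ h)

lemma mem_u_iff {t : ZMod D.len} : t ∈ D.u ↔ pos t < pos D.l := Iff.rfl

lemma pos_r : pos D.r = 0 := by simp [pos]

lemma pos_add {t : ZMod D.len} {n : ℕ} (h : pos t + n < D.len) :
    pos (t + (n : ZMod D.len)) = pos t + n := by
  unfold pos at h ⊢
  rw [show t + (n : ZMod D.len) - D.r = (t - D.r) + n by ring, ZMod.val_add,
    ZMod.val_natCast_of_lt (by omega), Nat.mod_eq_of_lt h]

lemma pos_add_one {t : ZMod D.len} (h : pos t + 1 < D.len) : pos (t + 1) = pos t + 1 := by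
  have := pos_add (D := D) (t := t) (n := 1) h
  simpa using this

lemma pos_sub_one {t : ZMod D.len} (h : t ≠ D.r) : pos (t - 1) + 1 = pos t := by
  have h0 : pos t ≠ 0 := by
    unfold pos
    rw [ne_eq, ZMod.val_eq_zero, sub_eq_zero]; exact h
  have h2 : (1 : ZMod D.len).val = 1 := by
    rw [ZMod.val_one_eq_one_mod, Nat.mod_eq_of_lt one_lt_len]
  unfold pos at h0 ⊢
  rw [show t - 1 - D.r = (t - D.r) - 1 by ring, zmod_val_sub, h2, if_pos (by omega)]
  omega

lemma exists_add {s t : ZMod D.len} (h : pos s ≤ pos t) :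
    t = s + ((pos t - pos s : ℕ) : ZMod D.len) := by
  apply pos_injective
  have := pos_lt t
  rw [pos_add (by omega)]
  omega

namespace Crosscut

variable {c : D.Crosscut} {A B : Set (ZMod D.len)}

/-- The edges of a walk taken modulo two: the parity sees only the ends, whether or not the walk is
simple. -/
lemma exists_pathSet {a b : Vertex} (h : c.av.Reachable a b) : ∃ X : EdgeSet, IsSym X ∧
    (∀ v i, X v i = true → c.av.Adj v (nbr v i)) ∧
    ∀ v, par X v = (decide (v = a) ^^ decide (v = b)) := by
  obtain ⟨p⟩ := h
  induction p with
  | nil => exact ⟨fun _ _ => false, fun _ _ => rfl, by simp, fun v => by simp [par]⟩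
  | @cons a a' b h p ih =>
    obtain ⟨X, h1, h2, h3⟩ := ih
    obtain ⟨i, rfl, -⟩ := D.graph_adj.1 (av_adj.1 h).1
    refine ⟨fun v j => X v j ^^ oneEdge a i v j, h1.xor isSym_oneEdge, fun v j hv => ?_,
      fun v => ?_⟩
    · by_cases hX : X v j = true
      · exact h2 v j hX
      · beta_reduce at hv
        rw [bool_of_not hX, Bool.false_xor] at hv
        rcases oneEdge_iff.1 hv with ⟨rfl, rfl⟩ | ⟨rfl, rfl⟩
        · exact h
        · rw [nbr_nbr]; exact h.symm
    · rw [par_xor, h3, par_oneEdge]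
      cases decide (v = a) <;> cases decide (v = nbr a i) <;> cases decide (v = b) <;> rfl

/-- The two sides of a path of hexagons are not connected. -/
lemma Joins.not_reachable (hc : c.Joins A B) (hne : c.first ≠ c.last) :
    ¬ c.av.Reachable (D.bdry c.first) (D.bdry (c.first + 1)) := by
  intro hreach
  obtain ⟨X, h1, h2, h3⟩ := exists_pathSet hreach
  obtain ⟨i₀, e1, e2, e3⟩ := D.bdry_step c.first
  obtain ⟨i₁, g1, g2, g3⟩ := D.bdry_step c.last
  have hX : ∀ v j, s(v, nbr v j) ∈ c.crossed → X v j = false := fun v j hcr =>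
    bool_of_not fun h => (av_adj.1 (h2 v j h)).2 hcr
  -- Closed up by the entrance edge, the avoiding walk bounds a set `S` of faces. The first hexagon
  -- is in `S`, hence all are, since no later edge crossed by the path belongs to the cycle; but the
  -- exit leads out of the domain without meeting the cycle.
  obtain ⟨S, hS, hS'⟩ := D.exists_bd_eq (X := fun v j => X v j ^^ oneEdge (D.bdry c.first) i₀ v j)
    (h1.xor isSym_oneEdge) (fun v => by
      rw [par_xor, h3, par_oneEdge, ← e1, Bool.xor_self])
    (fun v j hv => by
      by_cases hX : X v j = true
      · obtain ⟨k, h4, h5⟩ := D.graph_adj.1 (av_adj.1 (h2 v j hX)).1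
        rwa [nbr_inj h4]
      · beta_reduce at hv
        rw [bool_of_not hX, Bool.false_xor] at hv
        rcases oneEdge_iff.1 hv with ⟨rfl, rfl⟩ | ⟨rfl, rfl⟩
        · exact Or.inr e2
        · rw [fc_nbr_add_one]; exact Or.inl e2)
  have hS0 : ∀ f ∉ D.faces, S f = false := fun f hf => bool_of_not fun h => hf (hS f h)
  have hbd := fun v j => congrFun (congrFun hS' v) j
  have hfirst : S (fc (D.bdry c.first) (i₀ + 2)) = true := by
    have := hbd (D.bdry c.first) i₀
    rw [hX _ _ (by rw [← e1]; exact Or.inl rfl), oneEdge_iff.2 (Or.inl ⟨rfl, rfl⟩)] at this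
    unfold bd at this
    rw [hS0 _ e3] at this
    simpa using this
  have hpath : ∀ (n : ℕ) (f : Face), c.path[n]? = some f → S f = true := by
    intro n
    induction n with
    | zero =>
      intro f hf
      obtain ⟨f', h4, h5⟩ := hc.first_edge
      cases h4.symm.trans hf
      unfold HasBdryEdge at h5
      rw [e1, leftOf_nbr_iff] at h5
      rw [h5]; exact hfirst
    | succ n ih =>
      intro f hf
      have hn : n < c.path.length := by
        have := (List.getElem?_eq_some_iff.1 hf).1
        omega
      have hg : c.path[n]? = some c.path[n] := List.getElem?_eq_getElem hn
      have hadj : FaceAdj c.path[n] f := by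
        obtain ⟨h5, rfl⟩ := List.getElem?_eq_some_iff.1 hf
        exact List.isChain_iff_getElem.1 hc.1.2 n h5
      have hS1 := ih _ hg
      have hD1 := hc.mem_faces hg
      have hD2 := hc.mem_faces hf
      have hinf : [c.path[n], f] <:+: c.path := infix_pair_iff.2 ⟨n, hg, hf⟩
      obtain ⟨v, j, h4, h5⟩ := faceAdj_iff.1 hadj
      rw [h4] at hS1 hD1 hinf
      rw [h5] at hD2 hinf ⊢
      have h6 := hbd v j
      rw [hX v j (by
        refine Or.inr (Or.inr ⟨_, _, nbr v j, v, hinf, leftOf_nbr_rev v j, leftOf_nbr v j,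
          Sym2.eq_swap⟩)), bool_of_not (b := oneEdge _ _ _ _) (fun h => ?_)] at h6
      · rw [← bool_of_bd_false h6]; exact hS1
      · rcases oneEdge_iff.1 h with ⟨rfl, rfl⟩ | ⟨rfl, rfl⟩
        · exact e3 hD1
        · rw [fc_nbr_add_two] at hD2; exact e3 hD2
  obtain ⟨f, h4, h5⟩ := hc.last_edge
  have hlast := hpath _ f h4
  unfold HasBdryEdge at h5
  rw [g1, leftOf_nbr_iff] at h5
  have h6 := hbd (D.bdry c.last) i₁
  rw [hX _ _ (by rw [← g1]; exact Or.inr (Or.inl rfl)),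
    bool_of_not (b := oneEdge _ _ _ _) (fun h => ?_)] at h6
  · have h7 := bool_of_bd_false h6
    rw [← h5, hlast, hS0 _ g3] at h7
    simp at h7
  · rcases oneEdge_iff.1 h with ⟨h', rfl⟩ | ⟨h', rfl⟩
    · exact hne (D.bdry_injective h').symm
    · rw [h', fc_nbr_add_two] at g2
      exact e3 g2

/-- Apart from the first and the last, crossed edges have faces of the domain on both sides. -/
lemma Joins.bdry_adj (hc : c.Joins A B) {t : ZMod D.len} (h1 : t ≠ c.first) (h2 : t ≠ c.last) :
    c.av.Adj (D.bdry t) (D.bdry (t + 1)) := by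
  obtain ⟨f, hf, hf'⟩ := D.exists_hasBdryEdge t
  refine av_adj.2 ⟨adj_of_leftOf hf hf', ?_⟩
  have key : ∀ s, s(D.bdry t, D.bdry (t + 1)) = s(D.bdry s, D.bdry (s + 1)) → t = s := by
    intro s hs
    rcases Sym2.eq_iff.1 hs with ⟨h, -⟩ | ⟨h, h'⟩
    · exact D.bdry_injective h
    · exfalso
      rw [HasBdryEdge, h, h'] at hf'
      exact not_leftOf_bdry hf' hf
  rintro (h | h | ⟨p, q, y, y', hpq, hy, hy', he⟩)
  · exact h1 (key _ h)
  · exact h2 (key _ h)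
  · have hp := hc.2.2.1 p (hpq.subset (by simp))
    have hq := hc.2.2.1 q (hpq.subset (by simp))
    rcases Sym2.eq_iff.1 he with ⟨rfl, rfl⟩ | ⟨rfl, rfl⟩
    · exact not_leftOf_bdry hy' hq
    · exact not_leftOf_bdry hy hp

lemma Joins.arc (hc : c.Joins A B) {s t : ZMod D.len} (hst : pos s ≤ pos t)
    (h : ∀ z, pos s ≤ pos z → pos z < pos t → z ≠ c.first ∧ z ≠ c.last) :
    c.av.Reachable (D.bdry s) (D.bdry t) := by
  have key : ∀ n : ℕ, pos s + n ≤ pos t → c.av.Reachable (D.bdry s) (D.bdry (s + n)) := by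
    intro n
    induction n with
    | zero => intro _; simp
    | succ n ih =>
      intro hn
      have h1 := pos_lt t
      have h2 := pos_add (t := s) (n := n) (by omega)
      obtain ⟨h3, h4⟩ := h (s + n) (by omega) (by omega)
      have := (ih (by omega)).trans (hc.bdry_adj h3 h4).reachable
      rwa [show s + (n : ZMod D.len) + 1 = s + ((n + 1 : ℕ) : ZMod D.len) by
        push_cast; ring] at this
  have := key (pos t - pos s) (by omega)
  rwa [← exists_add hst] at this

lemma ne_of_pos {s t : ZMod D.len} (h : pos s ≠ pos t) : s ≠ t := fun e => h (e ▸ rfl)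

/-- The vertices between the entrance and the exit. -/
lemma Joins.right_of_lt (hc : c.Joins A B) {t : ZMod D.len}
    (h1 : pos c.first < pos t) (h2 : pos t ≤ pos c.last) :
    c.av.Reachable (D.bdry t) (D.bdry (c.first + 1)) := by
  have h3 := pos_lt t
  have h4 := pos_add_one (t := c.first) (by omega)
  exact (hc.arc (s := c.first + 1) (t := t) (by omega) fun z hz hz' =>
    ⟨ne_of_pos (by omega), ne_of_pos (by omega)⟩).symm

/-- Follow uncrossed boundary edges to an end of the first or of the last edge; `last_sides` relates
these ends. The next two lemmas treat the opposite order of entrance and exit. -/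
lemma Joins.left_of_lt (hc : c.Joins A B) {t : ZMod D.len} (h : pos c.first < pos c.last)
    (h1 : pos t ≤ pos c.first ∨ pos c.last < pos t) :
    c.av.Reachable (D.bdry t) (D.bdry c.first) := by
  rcases h1 with h1 | h1
  · exact hc.arc h1 fun z hz hz' => ⟨ne_of_pos (by omega), ne_of_pos (by omega)⟩
  · have h3 := pos_lt t
    have h4 := pos_add_one (t := c.last) (by omega)
    exact (hc.arc (s := c.last + 1) (t := t) (by omega) fun z hz hz' =>
      ⟨ne_of_pos (by omega), ne_of_pos (by omega)⟩).symm.trans hc.last_sides.1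

lemma Joins.left_of_gt (hc : c.Joins A B) {t : ZMod D.len} (h1 : pos c.last < pos t)
    (h2 : pos t ≤ pos c.first) : c.av.Reachable (D.bdry t) (D.bdry c.first) := by
  have h3 := pos_lt t
  have h4 := pos_add_one (t := c.last) (by omega)
  exact (hc.arc (s := c.last + 1) (t := t) (by omega) fun z hz hz' =>
      ⟨ne_of_pos (by omega), ne_of_pos (by omega)⟩).symm.trans hc.last_sides.1

lemma Joins.right_of_gt (hc : c.Joins A B) {t : ZMod D.len} (h : pos c.last < pos c.first)
    (h1 : pos t ≤ pos c.last ∨ pos c.first < pos t) :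
    c.av.Reachable (D.bdry t) (D.bdry (c.first + 1)) := by
  rcases h1 with h1 | h1
  · exact (hc.arc h1 fun z hz hz' => ⟨ne_of_pos (by omega), ne_of_pos (by omega)⟩).trans
      hc.last_sides.2
  · have h3 := pos_lt t
    have h4 := pos_add_one (t := c.first) (by omega)
    exact (hc.arc (s := c.first + 1) (t := t) (by omega) fun z hz hz' =>
      ⟨ne_of_pos (by omega), ne_of_pos (by omega)⟩).symm

/-- Only one boundary edge is crossed, and `last_sides` joins its two ends. -/
lemma Joins.all_of_eq (hc : c.Joins A B) (h : c.first = c.last) (t : ZMod D.len) :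
    c.av.Reachable (D.bdry t) (D.bdry c.first) := by
  by_cases h1 : pos t ≤ pos c.first
  · refine hc.arc h1 fun z hz hz' => ?_
    rw [← h]
    exact ⟨ne_of_pos (by omega), ne_of_pos (by omega)⟩
  · have h3 := pos_lt t
    have h4 := pos_add_one (t := c.first) (by omega)
    have h5 := hc.last_sides.1
    rw [← h] at h5
    refine (hc.arc (s := c.first + 1) (t := t) (by omega) fun z hz hz' => ?_).symm.trans h5
    rw [← h]
    exact ⟨ne_of_pos (by omega), ne_of_pos (by omega)⟩

end Crosscut

end Domain
end HexPerc

/-! ### White paths and their surgery along interfaces. -/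

namespace HexPerc

lemma forall_of_chain {α : Type*} {T : α → α → Prop} {W : α → Prop} {l : List α}
    (h : l.IsChain T) {a : α} (h1 : l.head? = some a) (ha : W a) (hT : ∀ p q, T p q → W q) :
    ∀ f ∈ l, W f := by
  induction l generalizing a with
  | nil => simp
  | cons b l ih =>
    simp only [List.head?_cons, Option.some.injEq] at h1
    subst h1
    intro f hf
    rcases List.mem_cons.1 hf with rfl | hf
    · exact ha
    · cases l with
      | nil => simp at hf
      | cons d l =>
        rw [List.isChain_cons_cons] at h
        exact ih h.2 rfl (hT _ _ h.1) f hf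

lemma reflTransGen_mono {α : Type*} {R T : α → α → Prop} {a b : α}
    (h : Relation.ReflTransGen R a b) (hRT : ∀ p q, R p q → T p q) :
    Relation.ReflTransGen T a b := by
  induction h with
  | refl => exact .refl
  | tail _ h ih => exact ih.tail (hRT _ _ h)

/-- A step from a face to an adjacent one, counterclockwise around a vertex of `V`. -/
def CcwStep (V : Set Vertex) (p q : Face) : Prop :=
  ∃ v ∈ V, ∃ j, p = fc v (j + 1) ∧ q = fc v (j + 2)

lemma CcwStep.faceAdj {V : Set Vertex} {p q : Face} (h : CcwStep V p q) : FaceAdj p q := by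
  obtain ⟨v, -, j, rfl, rfl⟩ := h
  exact faceAdj_ccw v j

lemma CcwStep.mono {V V' : Set Vertex} (hV : V ⊆ V') {p q : Face} (h : CcwStep V p q) :
    CcwStep V' p q := by
  obtain ⟨v, hv, h⟩ := h
  exact ⟨v, hV hv, h⟩

section Legs

variable {X : EdgeSet} {Q : Set Vertex} {x : Vertex} {k : Fin 3} {d : Dart} {P : Face → Prop}

/-- The origins of the darts of a leg. -/
def legV (X : EdgeSet) (Q : Set Vertex) (x : Vertex) (k : Fin 3) : Set Vertex :=
  {v | ∃ d ∈ Leg X Q x k, d.1 = v}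

lemma start_mem_legV : x ∈ legV X Q x k := ⟨_, mem_leg_start, rfl⟩

/-- The right face changes only at left turns, and then by a counterclockwise step about the turning
vertex. -/
lemma leg_chain_right (hP : ∀ d ∈ Leg X Q x k, P (rf d)) (h : d ∈ Leg X Q x k) :
    Relation.ReflTransGen (fun p q => CcwStep (legV X Q x k) p q ∧ P p ∧ P q)
      (fc x (k + 1)) (rf d) := by
  induction h with
  | refl => exact .refl
  | @tail b c hb hbc ih =>
    have hc := mem_leg_step hb hbc
    rcases step_cases hbc with ⟨-, e2, -, -, -⟩ | ⟨-, -, -, e4, e5⟩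
    · rwa [e2]
    · refine ih.tail ⟨⟨hd b, ⟨c, hc, hbc.1⟩, b.2 + 1, ?_, ?_⟩, hP _ hb, hP _ hc⟩
      · rw [add_one_one]; exact e4
      · rw [add_one_two]; exact e5

/-- Read towards `x`, because at right turns the left face moves clockwise along the leg. -/
lemma leg_chain_left (hP : ∀ d ∈ Leg X Q x k, P (lf d)) (h : d ∈ Leg X Q x k) :
    Relation.ReflTransGen (fun p q => CcwStep (legV X Q x k) p q ∧ P p ∧ P q)
      (lf d) (fc x (k + 2)) := by
  induction h with
  | refl => exact .refl
  | @tail b c hb hbc ih =>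
    have hc := mem_leg_step hb hbc
    rcases step_cases hbc with ⟨-, -, -, e4, e5⟩ | ⟨-, e2, -, -, -⟩
    · refine .head ⟨⟨hd b, ⟨c, hc, hbc.1⟩, b.2 + 2, ?_, ?_⟩, hP _ hc, hP _ hb⟩ ih
      · rw [add_two_one]; exact e5
      · rw [add_two_two]; exact e4
    · rwa [e2]

end Legs

namespace Domain

variable {D : Domain} {ω : D.Config}

lemma White.mem {f : Face} (h : White ω f) : f ∈ D.faces := h.1

/-- Adjacent white faces. -/
def WAdj (ω : D.Config) (p q : Face) : Prop := FaceAdj p q ∧ White ω p ∧ White ω q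

lemma whiteConnected_iff {f g : Face} :
    WhiteConnected ω f g ↔ White ω f ∧ Relation.ReflTransGen (WAdj ω) f g := by
  constructor
  · rintro ⟨γ, ⟨-, h1⟩, h2, h3, h4⟩
    refine ⟨h2 _ h3, ?_⟩
    have := chain_const (fun p => Relation.ReflTransGen (WAdj ω) p g) h1 (fun p hp q hq hpq =>
      propext ⟨fun h => .head ⟨hpq.symm, h2 q hq, h2 p hp⟩ h,
        fun h => .head ⟨hpq, h2 p hp, h2 q hq⟩ h⟩) h3 h4
    rw [this]
  · rintro ⟨h1, h2⟩
    obtain ⟨l, h3, h4, h5, -⟩ := exists_simple_chain h2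
    have hf : f ∈ l := List.mem_of_head? h4
    exact ⟨l, ⟨List.ne_nil_of_mem hf, h3.imp fun _ _ h => h.1⟩,
      forall_of_chain h3 h4 h1 fun _ _ h => h.2.2, hf, List.mem_of_getLast? h5⟩

lemma WhiteConnected.symm {f g : Face} (h : WhiteConnected ω f g) : WhiteConnected ω g f := by
  obtain ⟨γ, h1, h2, h3, h4⟩ := h
  exact ⟨γ, h1, h2, h4, h3⟩

lemma WhiteConnected.trans {f g h : Face} (h1 : WhiteConnected ω f g)
    (h2 : WhiteConnected ω g h) : WhiteConnected ω f h := by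
  rw [whiteConnected_iff] at h1 h2 ⊢
  exact ⟨h1.1, h1.2.trans h2.2⟩

lemma WhiteConnected.white_right {f g : Face} (h : WhiteConnected ω f g) : White ω g :=
  (whiteConnected_iff.1 h.symm).1

lemma Crosscut.Joins.whiteConnected {c : D.Crosscut} {A B : Set (ZMod D.len)} (hc : c.Joins A B)
    (hw : ∀ f ∈ c.path, White ω f) {f g : Face} (hf : f ∈ c.path) (hg : g ∈ c.path) :
    WhiteConnected ω f g := ⟨c.path, hc.1, hw, hf, hg⟩

/-- A chain of white steps gives a simple path. -/
lemma exists_crosscut {T : Face → Face → Prop} (hT : ∀ p q, T p q → WAdj ω p q) {a b : Face}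
    (h : Relation.ReflTransGen T a b) (ha : White ω a) {A B : Set (ZMod D.len)}
    {s t : ZMod D.len} (hs : s ∈ A) (ht : t ∈ B) (has : D.HasBdryEdge a s)
    (hbt : D.HasBdryEdge b t) :
    ∃ c : D.Crosscut, c.Joins A B ∧ (∀ f ∈ c.path, White ω f) ∧ c.first = s ∧ c.last = t ∧
      c.path.IsChain T ∧ c.path.head? = some a ∧ c.path.getLast? = some b := by
  obtain ⟨l, h1, h2, h3, h4⟩ := exists_simple_chain h
  have hw := forall_of_chain h1 h2 ha fun p q h => (hT p q h).2.2
  exact ⟨⟨l, s, t⟩, ⟨⟨List.ne_nil_of_mem (List.mem_of_head? h2),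
    h1.imp fun p q h => (hT p q h).1⟩, h4, fun f hf => (hw f hf).1, hs, ht, ⟨a, h2, has⟩,
    ⟨b, h3, hbt⟩⟩, hw, rfl, rfl, h1, h2, h3⟩

/-- Edges between different colours are not crossed by white paths. -/
lemma Crosscut.Joins.cut_adj {c : D.Crosscut} {A B C : Set (ZMod D.len)} (hc : c.Joins B C)
    (hw : ∀ f ∈ c.path, White ω f) (h1 : c.first ∈ A) (h2 : c.last ∈ A) {v : Vertex} {j : Fin 3}
    (h : D.cut A (ext ω) v j = true) : c.av.Adj v (nbr v j) := by
  obtain ⟨h3, h4⟩ := cut_supp (ext_supp ω) h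
  refine Crosscut.av_adj.2 ⟨D.graph_adj.2 ⟨j, rfl, h3⟩, ?_⟩
  have key : ∀ t ∈ A, s(v, nbr v j) ≠ s(D.bdry t, D.bdry (t + 1)) := by
    intro t ht he
    rcases Sym2.eq_iff.1 he with ⟨rfl, e⟩ | ⟨e, e'⟩
    · rw [(free_out e).2 ht] at h4
      simp at h4
    · rw [← isSym_free, e', (free_out (i := j) (by rw [← e', nbr_nbr, e])).2 ht] at h4
      simp at h4
  have hbd : bd (ext ω) v j = true := by
    unfold cut at h
    rw [Bool.and_eq_true] at h
    exact h.1
  rintro (h | h | ⟨p, q, y, y', hpq, hy, hy', he⟩)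
  · exact key _ h1 h
  · exact key _ h2 h
  · have hp := ext_iff.2 (hw p (hpq.subset (by simp)))
    have hq := ext_iff.2 (hw q (hpq.subset (by simp)))
    unfold bd at hbd
    rcases Sym2.eq_iff.1 he with ⟨rfl, rfl⟩ | ⟨rfl, rfl⟩
    · rw [leftOf_nbr_iff] at hy
      rw [leftOf_nbr_rev_iff] at hy'
      rw [← hy, ← hy', hp, hq] at hbd
      simp at hbd
    · rw [leftOf_nbr_iff] at hy'
      rw [leftOf_nbr_rev_iff] at hy
      rw [← hy, ← hy', hp, hq] at hbd
      simp at hbd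

lemma leg_reachable {c : D.Crosscut} {X : EdgeSet} {Q : Set Vertex} {x : Vertex} {k : Fin 3}
    (h : ∀ d ∈ Leg X Q x k, c.av.Adj d.1 (hd d)) {d : Dart} (hd' : d ∈ Leg X Q x k) :
    c.av.Reachable x d.1 ∧ c.av.Reachable x (hd d) := by
  have key : c.av.Reachable x d.1 := by
    induction hd' with
    | refl => exact .rfl
    | @tail b e hb hbe ih =>
      rw [hbe.1]
      exact ih.trans (h b hb).reachable
  exact ⟨key, key.trans (h d hd').reachable⟩

/-- The faces along an inner edge which ends at the boundary are at the boundary. -/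
lemma hasBdryEdge_of_hd {d : Dart} (h1 : lf d ∈ D.faces) (h2 : rf d ∈ D.faces) {t : ZMod D.len}
    (ht : hd d = D.bdry t) : D.HasBdryEdge (rf d) (t - 1) ∧ D.HasBdryEdge (lf d) t := by
  obtain ⟨i, j, e1, e2, e3, e4, e5, e6, e7⟩ := D.bdry_vertex t
  have f1 : fc (D.bdry t) (d.2 + 1) = lf d := by
    rw [← ht]; unfold hd lf; rw [fc_nbr_add_one]
  have f2 : fc (D.bdry t) (d.2 + 2) = rf d := by
    rw [← ht]; unfold hd rf; rw [fc_nbr_add_two]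
  have ha : d.2 = i + 1 := by
    rcases fin3_cases i d.2 with h | h | h
    · rw [h] at f1; rw [f1] at e4; exact absurd h1 e4
    · exact h
    · rw [h, add_two_two] at f2; rw [f2] at e4; exact absurd h2 e4
  rw [ha, add_one_two] at f2
  rw [ha, add_one_one] at f1
  unfold HasBdryEdge
  rw [sub_add_cancel, ← e1, ← e2, leftOf_nbr_iff, leftOf_nbr_rev_iff]
  refine ⟨?_, f1.symm⟩
  rcases e7 with ⟨rfl, e7⟩ | ⟨rfl, e7⟩
  · rw [f2] at e7; exact absurd h2 e7
  · rw [add_two_one]; exact f2.symm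

/-- White counterclockwise steps around vertices of `V`. -/
def RStep (ω : D.Config) (V : Set Vertex) (p q : Face) : Prop :=
  CcwStep V p q ∧ White ω p ∧ White ω q

lemma RStep.wAdj {V : Set Vertex} {p q : Face} (h : RStep ω V p q) : WAdj ω p q :=
  ⟨h.1.faceAdj, h.2⟩

section Surgery

variable {c : D.Crosscut} {A B A' B' : Set (ZMod D.len)} (hc : c.Joins A B)
  (hw : ∀ f ∈ c.path, White ω f) {V : Set Vertex} {G₁ G₂ : Face} (hG : [G₂, G₁] <:+: c.path)

include hc hw hG

/-- If a path can be completed by counterclockwise steps around vertices of `V`, then there is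
a path which leaves a vertex of `V` on its left. -/
lemma surgery_bridge (h : Relation.ReflTransGen (RStep ω V) G₂ G₁) :
    ∃ c' : D.Crosscut, c'.Joins A B ∧ (∀ f ∈ c'.path, White ω f) ∧ c'.first = c.first ∧
      c'.last = c.last ∧ (∃ v ∈ V, c'.av.Reachable v (D.bdry c'.first)) ∧
      ∃ f ∈ c'.path, f ∈ c.path := by
  obtain ⟨s, t, hst⟩ := hG
  have hst' : c.path = (s ++ [G₂]) ++ (G₁ :: t) := by rw [← hst]; simp
  obtain ⟨a, ha, ha'⟩ := hc.2.2.2.2.2.1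
  obtain ⟨b, hb, hb'⟩ := hc.2.2.2.2.2.2
  -- Allowed steps are those of the bridge and those of the old path, except the step from `G₂` to
  -- `G₁`.
  set T : Face → Face → Prop := fun p q =>
    ([p, q] <:+: s ++ [G₂] ∨ RStep ω V p q) ∨ [p, q] <:+: G₁ :: t with hT
  have hsub1 : (s ++ [G₂]) <:+: c.path := by
    rw [hst']; exact (List.prefix_append _ _).isInfix
  have hsub2 : (G₁ :: t) <:+: c.path := by
    rw [hst']; exact (List.suffix_append _ _).isInfix
  have hinf : ∀ p q, [p, q] <:+: c.path → WAdj ω p q := by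
    intro p q h
    have h1 := hc.1.2.infix h
    rw [List.isChain_cons_cons] at h1
    exact ⟨h1.1, hw p (h.subset (by simp)), hw q (h.subset (by simp))⟩
  have hTW : ∀ p q, T p q → WAdj ω p q := by
    rintro p q ((h | h) | h)
    · exact hinf p q (h.trans hsub1)
    · exact h.wAdj
    · exact hinf p q (h.trans hsub2)
  have r1 : Relation.ReflTransGen T a G₂ := by
    refine reflTransGen_of_chain (l := s ++ [G₂])
      (isChain_infix.imp fun p q h => Or.inl (Or.inl h)) ?_ (by simp)
    rw [hst', List.head?_append] at ha
    cases s <;> simpa using ha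
  have r2 : Relation.ReflTransGen T G₁ b := by
    refine reflTransGen_of_chain (l := G₁ :: t)
      (isChain_infix.imp fun p q h => Or.inr h) rfl ?_
    rw [hst', List.getLast?_append] at hb
    rw [List.getLast?_eq_some_getLast (by simp)] at hb ⊢
    simpa using hb
  have r3 : Relation.ReflTransGen T G₂ G₁ := reflTransGen_mono h fun p q h => Or.inl (Or.inr h)
  obtain ⟨c', h1, h2, h3, h4, h5, h6, h7⟩ := exists_crosscut hTW ((r1.trans r3).trans r2)
    (hw a (List.mem_of_head? ha)) hc.2.2.2.1 hc.2.2.2.2.1 ha' hb'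
  have hdis : ∀ f, f ∈ s ++ [G₂] → f ∈ G₁ :: t → False := by
    intro f hf hf'
    have := hc.2.1
    rw [hst'] at this
    exact (List.nodup_append.1 this).2.2 f hf f hf' rfl
  have haP : a ∈ s ++ [G₂] := by
    rw [hst', List.head?_append] at ha
    cases s with
    | nil => simp at ha; simp [ha]
    | cons y s => simp at ha; simp [ha]
  have hbQ : b ∈ G₁ :: t := by
    rw [hst', List.getLast?_append] at hb
    rw [List.getLast?_eq_some_getLast (by simp)] at hb
    simp only [Option.some_or, Option.some.injEq] at hb
    rw [← hb]
    exact List.getLast_mem _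
  -- The new path must leave the first part of the old one. As the two parts are disjoint, it does
  -- so by a bridge step, counterclockwise about some `v` in `V`, and such a step has `v` on its
  -- left.
  obtain ⟨p, q, e1, e2, e3, e4⟩ := exists_exit (P := fun f => f ∈ s ++ [G₂]) h5 h6 h7 haP
    fun hbP => hdis b hbP hbQ
  refine ⟨c', h1, h2, h3, h4, ?_, a, List.mem_of_head? h6, List.mem_of_head? ha⟩
  rcases e2 with (e2 | e2) | e2
  · exact absurd (e2.subset (by simp)) e4
  · obtain ⟨⟨v, hv, j, rfl, rfl⟩, -⟩ := e2
    exact ⟨v, hv, (h1.step_sides e1).1⟩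
  · exact (hdis p e3 (e2.subset (by simp))).elim

lemma reflTransGen_head {a : Face} (ha : c.path.head? = some a) :
    Relation.ReflTransGen (WAdj ω) a G₂ ∧ White ω G₂ := by
  have h1 : G₂ ∈ c.path := hG.subset (by simp)
  exact ⟨(whiteConnected_iff.1 (hc.whiteConnected hw (List.mem_of_head? ha) h1)).2, hw _ h1⟩

/-- Another exit. -/
lemma surgery_exit {g : Face} (h : Relation.ReflTransGen (RStep ω V) G₂ g) {t : ZMod D.len}
    (ht : t ∈ B') (hgt : D.HasBdryEdge g t) :
    ∃ c' : D.Crosscut, c'.Joins A B' ∧ (∀ f ∈ c'.path, White ω f) ∧ c'.first = c.first ∧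
      c'.last = t ∧ ∃ f ∈ c'.path, f ∈ c.path := by
  obtain ⟨a, ha, ha'⟩ := hc.2.2.2.2.2.1
  have r1 := (reflTransGen_head hc hw hG ha).1
  obtain ⟨c', h1, h2, h3, h4, -, h6, -⟩ := exists_crosscut (fun _ _ h => h)
    (r1.trans (reflTransGen_mono h fun _ _ h => h.wAdj))
    (hw a (List.mem_of_head? ha)) hc.2.2.2.1 ht ha' hgt
  exact ⟨c', h1, h2, h3, h4, a, List.mem_of_head? h6, List.mem_of_head? ha⟩

/-- Another entrance. -/
lemma surgery_entrance {g : Face} (h : Relation.ReflTransGen (RStep ω V) g G₁) (hg : White ω g)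
    {t : ZMod D.len} (ht : t ∈ A') (hgt : D.HasBdryEdge g t) :
    ∃ c' : D.Crosscut, c'.Joins A' B ∧ (∀ f ∈ c'.path, White ω f) ∧ c'.first = t ∧
      c'.last = c.last ∧ ∃ f ∈ c'.path, f ∈ c.path := by
  obtain ⟨b, hb, hb'⟩ := hc.2.2.2.2.2.2
  have r1 := (whiteConnected_iff.1 (hc.whiteConnected hw (hG.subset (by simp : G₁ ∈ [G₂, G₁]))
    (List.mem_of_getLast? hb))).2
  obtain ⟨c', h1, h2, h3, h4, -, h6, h7⟩ := exists_crosscut (fun _ _ h => h)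
    ((reflTransGen_mono h fun _ _ h => h.wAdj).trans r1) hg ht hc.2.2.2.2.1 hgt hb'
  exact ⟨c', h1, h2, h3, h4, b, List.mem_of_getLast? h7, List.mem_of_getLast? hb⟩

end Surgery

end Domain
end HexPerc

/-! ### Tripods and white paths along interfaces. -/

namespace HexPerc
namespace Domain

variable {D : Domain} {ω : D.Config} {x : Vertex} {i : Fin 3} {A B C : Set (ZMod D.len)}

/-- The vertices of the two interfaces at `x` around the `i`-th face. -/
def legVs (A : Set (ZMod D.len)) (ω : D.Config) (x : Vertex) (i : Fin 3) : Set Vertex :=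
  legV (D.cut A (ext ω)) (D.stops A x) x (i + 1) ∪ legV (D.cut A (ext ω)) (D.stops A x) x (i + 2)

lemma mem_legVs : x ∈ legVs A ω x i := Or.inl start_mem_legV

section Colours

variable (hx : x ∉ Set.range D.bdry) (h0 : ext ω (fc x i) = false)
  (h1 : ext ω (fc x (i + 1)) = true) (h2 : ext ω (fc x (i + 2)) = true)
include hx h0 h1 h2

lemma rStep_right {d : Dart} (h : d ∈ Leg (D.cut A (ext ω)) (D.stops A x) x (i + 1)) :
    Relation.ReflTransGen (RStep ω (legVs A ω x i)) (fc x (i + 2)) (rf d) := by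
  have := leg_chain_right (P := White ω)
    (fun d hd => ext_iff.1 (cut_side₁ (ext_supp ω) hx h0 h1 h2 hd).2) h
  rw [add_one_one] at this
  exact reflTransGen_mono this fun p q h => ⟨h.1.mono Set.subset_union_left, h.2⟩

lemma rStep_left {d : Dart} (h : d ∈ Leg (D.cut A (ext ω)) (D.stops A x) x (i + 2)) :
    Relation.ReflTransGen (RStep ω (legVs A ω x i)) (lf d) (fc x (i + 1)) := by
  have := leg_chain_left (P := White ω)
    (fun d hd => ext_iff.1 (cut_side₂ (ext_supp ω) hx h0 h1 h2 hd).1) h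
  rw [add_two_two] at this
  exact reflTransGen_mono this fun p q h => ⟨h.1.mono Set.subset_union_right, h.2⟩

end Colours

/-- If the two white faces at `x` are not joined around the interfaces at `x`, these interfaces
form a tripod. -/
lemma tripod_of_not_bridge (hx : x ∉ Set.range D.bdry)
    (w1 : White ω (fc x (i + 1))) (w2 : White ω (fc x (i + 2)))
    (H : ¬ Relation.ReflTransGen (RStep ω (legVs A ω x i)) (fc x (i + 2)) (fc x (i + 1))) :
    D.Tripod A x i (ext ω) := by
  have h1 := ext_iff.2 w1
  have h2 := ext_iff.2 w2
  -- If the third face at `x` were white, going around `x` through it would be a bridge.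
  have h0 : ext ω (fc x i) = false := by
    refine bool_of_not fun h => H ?_
    have w0 := ext_iff.1 h
    have s1 : RStep ω (legVs A ω x i) (fc x (i + 2)) (fc x i) :=
      ⟨⟨x, mem_legVs, i + 1, by rw [add_one_one], by rw [add_one_two]⟩, w2, w0⟩
    have s2 : RStep ω (legVs A ω x i) (fc x i) (fc x (i + 1)) :=
      ⟨⟨x, mem_legVs, i + 2, by rw [add_two_one], by rw [add_two_two]⟩, w0, w1⟩
    exact .head s1 (.single s2)
  have hG := good_cut (A := A) (x := x) (ext_supp ω)
  have hret : ∀ {d : Dart}, hd d = x → d = rv (x, d.2) := by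
    intro d hq
    rw [← hq]; exact (rv_rv d).symm
  refine ⟨h0, h1, h2, ?_, ?_, ?_⟩
  · obtain ⟨d, hd', hq⟩ := hG.exists_leg_end ((cut_start hx h0 h1 h2 (i + 1)).2 (add_one_ne i))
    refine ⟨d, hd', ?_⟩
    rcases hq with hq | hq
    swap
    · exact hq
    exfalso
    -- By its colours an interface returning to `x` must arrive through the edge of the other one,
    -- and then the white faces along it form a bridge.
    have hs := cut_side₁ (ext_supp ω) hx h0 h1 h2 hd'
    have hr := rStep_right hx h0 h1 h2 hd'
    have e := hret hq
    rw [e, lf_rv, rf_rv] at hs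
    rw [e, rf_rv] at hr
    simp only [lf, rf] at hs hr
    rcases fin3_cases i d.2 with h | h | h
    · rw [h, h1] at hs; simp at hs
    · rw [h, add_one_two, h0] at hs; simp at hs
    · rw [h, add_two_two] at hr; exact H hr
  · obtain ⟨d, hd', hq⟩ := hG.exists_leg_end ((cut_start hx h0 h1 h2 (i + 2)).2 (add_two_ne i))
    refine ⟨d, hd', ?_⟩
    rcases hq with hq | hq
    swap
    · exact hq
    exfalso
    have hs := cut_side₂ (ext_supp ω) hx h0 h1 h2 hd'
    have hr := rStep_left hx h0 h1 h2 hd'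
    have e := hret hq
    rw [e, lf_rv, rf_rv] at hs
    rw [e, lf_rv] at hr
    simp only [lf, rf] at hs hr
    rcases fin3_cases i d.2 with h | h | h
    · rw [h, h2] at hs; simp at hs
    · rw [h, add_one_one] at hr; exact H hr
    · rw [h, add_two_one, h0] at hs; simp at hs
  -- A shared white face joins the chains along the two interfaces into a bridge.
  · intro d hd' e he hde
    have hr := rStep_right hx h0 h1 h2 hd'
    rw [hde] at hr
    exact H (hr.trans (rStep_left hx h0 h1 h2 he))

section Uncrossed

variable {c : D.Crosscut} (hc : c.Joins B C) (hw : ∀ f ∈ c.path, White ω f)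
include hc hw

/-- White paths do not cross interfaces, so the interfaces at `x` stay on one side of `c`. -/
lemma legVs_reachable (hf : c.first ∈ A) (hl : c.last ∈ A) {v : Vertex}
    (hv : v ∈ legVs A ω x i) (h0 : ext ω (fc x i) = false)
    (h1 : ext ω (fc x (i + 1)) = true) (h2 : ext ω (fc x (i + 2)) = true)
    (hx : x ∉ Set.range D.bdry) : c.av.Reachable x v := by
  have hs := cut_start (A := A) hx h0 h1 h2
  rcases hv with ⟨d, hd', rfl⟩ | ⟨d, hd', rfl⟩
  · exact (leg_reachable (fun e he => hc.cut_adj hw hf hl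
      (mem_of_mem_leg ((hs _).2 (add_one_ne i)) he)) hd').1
  · exact (leg_reachable (fun e he => hc.cut_adj hw hf hl
      (mem_of_mem_leg ((hs _).2 (add_two_ne i)) he)) hd').1

lemma hd_reachable (hf : c.first ∈ A) (hl : c.last ∈ A) {k : Fin 3} {d : Dart}
    (hk : D.cut A (ext ω) x k = true) (h : d ∈ Leg (D.cut A (ext ω)) (D.stops A x) x k) :
    c.av.Reachable x d.1 ∧ c.av.Reachable x (hd d) :=
  leg_reachable (fun _ he => hc.cut_adj hw hf hl (mem_of_mem_leg hk he)) h

end Uncrossed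

/-- A tripod yields a path along its two interfaces. -/
lemma Tripod.exists_crosscut (hx : x ∉ Set.range D.bdry) (hT : D.Tripod A x i (ext ω))
    {d₁ d₂ : Dart} (hd₁ : d₁ ∈ Leg (D.cut A (ext ω)) (D.stops A x) x (i + 1))
    (hd₂ : d₂ ∈ Leg (D.cut A (ext ω)) (D.stops A x) x (i + 2)) {s t : ZMod D.len}
    (hs : s ∈ B) (ht : t ∈ C) (hds : D.HasBdryEdge (rf d₁) s) (hdt : D.HasBdryEdge (lf d₂) t) :
    ∃ c : D.Crosscut, c.Joins B C ∧ (∀ f ∈ c.path, White ω f) ∧ c.first = s ∧ c.last = t ∧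
      [fc x (i + 2), fc x (i + 1)] <:+: c.path ∧
      ∀ p q, [p, q] <:+: c.path → CcwStep (legVs A ω x i) q p := by
  have hσ := ext_supp ω
  set L₁ := Leg (D.cut A (ext ω)) (D.stops A x) x (i + 1) with hL₁
  set L₂ := Leg (D.cut A (ext ω)) (D.stops A x) x (i + 2) with hL₂
  have w1 : ∀ d ∈ L₁, White ω (rf d) := fun d hd' => ext_iff.1 (hT.side₁ hσ hx hd').2
  have w2 : ∀ d ∈ L₂, White ω (lf d) := fun d hd' => ext_iff.1 (hT.side₂ hσ hx hd').1
  let P₁ : Face → Prop := fun f => ∃ d ∈ L₁, rf d = f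
  let P₂ : Face → Prop := fun f => ∃ d ∈ L₂, lf d = f
  -- Run back along the interface `i + 1` to `x`, pass between the two white faces there, then
  -- follow the interface `i + 2`. All steps are clockwise, so the interfaces stay on the right.
  let T : Face → Face → Prop := fun p q =>
    (CcwStep (legVs A ω x i) q p ∧ P₁ p ∧ P₁ q) ∨ (p = fc x (i + 2) ∧ q = fc x (i + 1)) ∨
      (CcwStep (legVs A ω x i) q p ∧ P₂ p ∧ P₂ q)
  have c1 := leg_chain_right (P := P₁) (fun d hd' => ⟨d, hd', rfl⟩) hd₁
  have c2 := leg_chain_left (P := P₂) (fun d hd' => ⟨d, hd', rfl⟩) hd₂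
  rw [add_one_one] at c1
  rw [add_two_two] at c2
  have r1 : Relation.ReflTransGen T (rf d₁) (fc x (i + 2)) := by
    rw [← Relation.reflTransGen_swap] at c1
    exact reflTransGen_mono c1 fun p q h =>
      Or.inl ⟨h.1.mono Set.subset_union_left, h.2.2, h.2.1⟩
  have r2 : Relation.ReflTransGen T (fc x (i + 1)) (lf d₂) := by
    rw [← Relation.reflTransGen_swap] at c2
    exact reflTransGen_mono c2 fun p q h =>
      Or.inr (Or.inr ⟨h.1.mono Set.subset_union_right, h.2.2, h.2.1⟩)
  have r3 : T (fc x (i + 2)) (fc x (i + 1)) := Or.inr (Or.inl ⟨rfl, rfl⟩)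
  have hTC : ∀ p q, T p q → CcwStep (legVs A ω x i) q p := by
    rintro p q (h | ⟨rfl, rfl⟩ | h)
    · exact h.1
    · exact ⟨x, mem_legVs, i, rfl, rfl⟩
    · exact h.1
  have hTW : ∀ p q, T p q → WAdj ω p q := by
    intro p q h
    refine ⟨(hTC p q h).faceAdj.symm, ?_⟩
    rcases h with ⟨-, ⟨d, h3, rfl⟩, e, h4, rfl⟩ | ⟨rfl, rfl⟩ | ⟨-, ⟨d, h3, rfl⟩, e, h4, rfl⟩
    · exact ⟨w1 d h3, w1 e h4⟩
    · exact ⟨ext_iff.1 hT.white₂, ext_iff.1 hT.white₁⟩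
    · exact ⟨w2 d h3, w2 e h4⟩
  obtain ⟨c, h1, h2, h3, h4, h5, h6, h7⟩ := Domain.exists_crosscut hTW
    ((r1.tail r3).trans r2) (w1 d₁ hd₁) hs ht hds hdt
  refine ⟨c, h1, h2, h3, h4, ?_, fun p q h => ?_⟩
  -- Loop erasure keeps the step at `x`: by `disj` it is the only way from the faces along the first
  -- interface to those along the second.
  · obtain ⟨p, q, e1, e2, e3, e4⟩ := exists_exit (P := P₁) h5 h6 h7 ⟨d₁, hd₁, rfl⟩ (by
      rintro ⟨d, h8, h9⟩
      exact hT.disj d h8 d₂ hd₂ h9)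
    rcases e2 with ⟨-, -, h8⟩ | ⟨rfl, rfl⟩ | ⟨-, ⟨e, h8, h8'⟩, -⟩
    · exact absurd h8 e4
    · exact e1
    · obtain ⟨d, h9, h9'⟩ := e3
      exact (hT.disj d h9 e h8 (h9'.trans h8'.symm)).elim
  · have := h5.infix h
    rw [List.isChain_cons_cons] at this
    exact hTC p q this.1

/-- The two sides of the edge after `x`. -/
lemma Crosscut.Joins.sides_at {c : D.Crosscut} (hc : c.Joins B C)
    (h : [fc x (i + 2), fc x (i + 1)] <:+: c.path) :
    c.av.Reachable x (D.bdry (c.first + 1)) ∧ c.av.Reachable (nbr x i) (D.bdry c.first) := by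
  rw [← fc_nbr_add_one, ← fc_nbr_add_two x i] at h
  have := hc.step_sides h
  rw [nbr_nbr] at this
  exact this.symm

/-- A path separating the ends of an inner edge crosses it. -/
lemma Crosscut.Joins.infix_of_sides {c : D.Crosscut} (hc : c.Joins B C)
    (hxf : fc x (i + 1) ∈ D.faces) (hxf' : fc x (i + 2) ∈ D.faces)
    (hne : c.first ≠ c.last) (h1 : c.av.Reachable x (D.bdry (c.first + 1)))
    (h2 : c.av.Reachable (nbr x i) (D.bdry c.first)) :
    [fc x (i + 2), fc x (i + 1)] <:+: c.path := by
  have hcr : s(x, nbr x i) ∈ c.crossed := by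
    by_contra h
    have h3 : c.av.Adj x (nbr x i) := Crosscut.av_adj.2 ⟨D.graph_adj.2 ⟨i, rfl, Or.inl hxf⟩, h⟩
    exact hc.not_reachable hne ((h2.symm.trans h3.reachable.symm).trans h1)
  have key : ∀ t, s(x, nbr x i) ≠ s(D.bdry t, D.bdry (t + 1)) := by
    intro t he
    rcases Sym2.eq_iff.1 he with ⟨e, e'⟩ | ⟨e, e'⟩
    · exact not_leftOf_bdry (t := t) (by rw [← e, ← e']; exact leftOf_nbr_rev x i) hxf
    · exact not_leftOf_bdry (t := t) (by rw [← e, ← e']; exact leftOf_nbr x i) hxf'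
  rcases hcr with h | h | ⟨p, q, y, y', hpq, hy, hy', he⟩
  · exact absurd h (key _)
  · exact absurd h (key _)
  · rcases Sym2.eq_iff.1 he with ⟨rfl, rfl⟩ | ⟨rfl, rfl⟩
    · rw [leftOf_nbr_iff] at hy
      rw [leftOf_nbr_rev_iff] at hy'
      rwa [hy, hy'] at hpq
    · rw [leftOf_nbr_iff] at hy'
      rw [leftOf_nbr_rev_iff] at hy
      rw [hy, hy'] at hpq
      -- Crossing the edge in the other direction would put `x` on the left.
      exact (hc.not_reachable hne ((hc.step_sides hpq).1.symm.trans h1)).elim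

lemma Crosscut.Joins.first_ne_last {c : D.Crosscut} (hc : c.Joins D.u D.d) :
    c.first ≠ c.last := fun h => mem_d_iff.1 hc.2.2.2.2.1 (h ▸ hc.2.2.2.1)

/-- A crossing has `l` on its right and `r` on its left. -/
lemma Crosscut.Joins.crossing_sides {c : D.Crosscut} (hc : c.Joins D.u D.d) :
    c.av.Reachable D.ptL (D.bdry (c.first + 1)) ∧ c.av.Reachable D.ptR (D.bdry c.first) := by
  have h1 := mem_u_iff.1 hc.2.2.2.1
  have h2 := mt mem_u_iff.2 (mem_d_iff.1 hc.2.2.2.2.1)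
  refine ⟨hc.right_of_lt h1 (by omega), hc.left_of_lt (by omega) (Or.inl ?_)⟩
  rw [pos_r]
  omega

lemma Crosscut.Joins.cover_vertex {c : D.Crosscut} (hc : c.Joins B C) {v : Vertex}
    (hv : ∃ k, fc v k ∈ D.faces) : c.av.Reachable v (D.bdry c.first) ∨
      c.av.Reachable v (D.bdry (c.first + 1)) := by
  obtain ⟨k, hk⟩ := hv
  obtain ⟨k', h'⟩ := (corner_iff _ v).2 ⟨k, rfl⟩
  have := hc.cover hk (k := k')
  rwa [← h'] at this

lemma reachable_face {c : D.Crosscut} {a b : Vertex} (h : c.av.Reachable a b)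
    (ha : ∃ k, fc a k ∈ D.faces) : ∃ k, fc b k ∈ D.faces := by
  obtain ⟨p⟩ := h
  induction p with
  | nil => exact ha
  | cons h p ih =>
    refine ih ?_
    obtain ⟨i, rfl, h1⟩ := D.graph_adj.1 (Crosscut.av_adj.1 h).1
    rcases h1 with h1 | h1
    · exact ⟨i + 2, by rwa [fc_nbr_add_two]⟩
    · exact ⟨i + 1, by rwa [fc_nbr_add_one]⟩

lemma bdry_face (t : ZMod D.len) : ∃ k, fc (D.bdry t) k ∈ D.faces :=
  (D.mem_range_bdry.1 ⟨t, rfl⟩).1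

end Domain
end HexPerc

/-! ### Left boundaries as tripods. -/

namespace HexPerc
namespace Domain

variable {D : Domain} {ω : D.Config} {x : Vertex} {i : Fin 3}

/-- The interfaces at an edge crossed by a left boundary. -/
lemma tripod_of_crossing (hl : D.IsCorner D.ptL) (hr : D.IsCorner D.ptR)
    (hx : x ∉ Set.range D.bdry) {c : D.Crosscut} (hc : c.Joins D.u D.d)
    (hw : ∀ f ∈ c.path, White ω f) (hinf : [fc x (i + 2), fc x (i + 1)] <:+: c.path)
    (hno : ∀ c' : D.Crosscut, c'.Joins D.u D.d → (∀ f ∈ c'.path, White ω f) →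
      (∃ f ∈ c'.path, f ∈ c.path) → ¬ c'.av.Reachable x (D.bdry c'.first)) :
    D.Tripod Set.univ x i (ext ω) ∧ HitsArc (D.cut Set.univ (ext ω)) x (i + 1) D.u ∧
      HitsArc (D.cut Set.univ (ext ω)) x (i + 2) D.d := by
  have w1 : White ω (fc x (i + 1)) := hw _ (hinf.subset (by simp))
  have w2 : White ω (fc x (i + 2)) := hw _ (hinf.subset (by simp))
  have e1 := ext_iff.2 w1
  have e2 := ext_iff.2 w2
  have hT : D.Tripod Set.univ x i (ext ω) := by
    by_cases h0 : ext ω (fc x i) = false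
    -- A bridge would give a crossing that meets `c` and has `x` on its left, contrary to `hno`.
    · refine tripod_of_not_bridge hx w1 w2 fun hb => ?_
      obtain ⟨c', h1, h2, h3, h4, ⟨v, hv, h5⟩, h6⟩ := surgery_bridge hc hw hinf hb
      exact hno c' h1 h2 h6
        ((legVs_reachable h1 h2 (Set.mem_univ _) (Set.mem_univ _) hv h0 e1 e2 hx).trans h5)
    · refine tripod_of_not_bridge hx w1 w2 fun _ => ?_
      rw [Bool.not_eq_false] at h0
      have w0 := ext_iff.1 h0
      have hb : Relation.ReflTransGen (RStep ω {x}) (fc x (i + 2)) (fc x (i + 1)) := by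
        refine .head (b := fc x i) ⟨⟨x, rfl, i + 1, ?_, ?_⟩, w2, w0⟩
          (.single ⟨⟨x, rfl, i + 2, ?_, ?_⟩, w0, w1⟩)
        · rw [add_one_one]
        · rw [add_one_two]
        · rw [add_two_one]
        · rw [add_two_two]
      obtain ⟨c', h1, h2, h3, h4, ⟨v, rfl, h5⟩, h6⟩ := surgery_bridge hc hw hinf hb
      exact hno c' h1 h2 h6 h5
  have hcs := hT.start hx
  have hint : ∀ {k : Fin 3} {d : Dart}, k ≠ i →
      d ∈ Leg (D.cut Set.univ (ext ω)) (D.stops Set.univ x) x k →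
      lf d ∈ D.faces ∧ rf d ∈ D.faces := by
    intro k d hk hd'
    have := cut_supp (ext_supp ω) (mem_of_mem_leg ((hcs k).2 hk) hd')
    exact (interior_of_not_free this.1 this.2).symm
  refine ⟨hT, ?_, ?_⟩
  · obtain ⟨d, hd', hd2⟩ := hT.hits₁
    rw [term_univ] at hd2
    obtain ⟨t, ht⟩ := hd2
    obtain ⟨f1, f2⟩ := hint (add_one_ne i) hd'
    refine ⟨d, hd', t, ?_, ht.symm⟩
    by_contra htu
    obtain ⟨n1, n2⟩ := ne_of_interior hl hr f1 f2 ht.symm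
    -- If the interface `i + 1` ended on `d`, leaving along its right side would again put `x` on
    -- the left.
    obtain ⟨c', h1, h2, h3, h4, h5⟩ := surgery_exit hc hw hinf
      (rStep_right hx hT.black e1 e2 hd') (B' := D.d)
      ((mem_d_sub_one n1 n2).2 (mem_d_iff.2 htu)) (hasBdryEdge_of_hd f1 f2 ht.symm).1
    refine hno c' h1 h2 h5 ?_
    have h6 := (hd_reachable h1 h2 (Set.mem_univ _) (Set.mem_univ _)
      ((hcs _).2 (add_one_ne i)) hd').2
    have h7 := h1.last_sides.1
    rw [h4, sub_add_cancel, ht] at h7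
    exact h6.trans h7
  · obtain ⟨d, hd', hd2⟩ := hT.hits₂
    rw [term_univ] at hd2
    obtain ⟨t, ht⟩ := hd2
    obtain ⟨f1, f2⟩ := hint (add_two_ne i) hd'
    refine ⟨d, hd', t, ?_, ht.symm⟩
    by_contra htd
    rw [mem_d_iff, not_not] at htd
    -- If the interface `i + 2` ended on `u`, entering along its left side would do the same.
    obtain ⟨c', h1, h2, h3, h4, h5⟩ := surgery_entrance hc hw hinf
      (rStep_left hx hT.black e1 e2 hd')
      (ext_iff.1 (hT.side₂ (ext_supp ω) hx hd').1) (A' := D.u)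
      htd (hasBdryEdge_of_hd f1 f2 ht.symm).2
    refine hno c' h1 h2 h5 ?_
    have h6 := (hd_reachable h1 h2 (Set.mem_univ _) (Set.mem_univ _)
      ((hcs _).2 (add_two_ne i)) hd').2
    rw [h3, ht]
    exact h6

/-- The path along the interfaces of a tripod is a left boundary. -/
lemma leftBoundary_of_tripod (hl : D.IsCorner D.ptL) (hr : D.IsCorner D.ptR)
    (hx : x ∉ Set.range D.bdry) (hT : D.Tripod Set.univ x i (ext ω))
    (h1 : HitsArc (D.cut Set.univ (ext ω)) x (i + 1) D.u)
    (h2 : HitsArc (D.cut Set.univ (ext ω)) x (i + 2) D.d) :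
    ∃ c ∈ leftBoundaries ω, c.av.Reachable D.ptL x ∧ c.av.Reachable D.ptR (nbr x i) := by
  obtain ⟨d₁, hd₁, t₁, ht₁, hdt₁⟩ := h1
  obtain ⟨d₂, hd₂, t₂, ht₂, hdt₂⟩ := h2
  have hcs := hT.start hx
  have hint : ∀ {k : Fin 3} {d : Dart}, k ≠ i →
      d ∈ Leg (D.cut Set.univ (ext ω)) (D.stops Set.univ x) x k →
      lf d ∈ D.faces ∧ rf d ∈ D.faces := by
    intro k d hk hd'
    have := cut_supp (ext_supp ω) (mem_of_mem_leg ((hcs k).2 hk) hd')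
    exact (interior_of_not_free this.1 this.2).symm
  obtain ⟨f1, f1'⟩ := hint (add_one_ne i) hd₁
  obtain ⟨f2, f2'⟩ := hint (add_two_ne i) hd₂
  obtain ⟨n1, n1'⟩ := ne_of_interior hl hr f1 f1' hdt₁
  have hu1 := (mem_u_sub_one n1 n1').2 ht₁
  obtain ⟨c, hc, hw, hf, hla, hinf, hccw⟩ := hT.exists_crosscut hx hd₁ hd₂ hu1 ht₂
    (hasBdryEdge_of_hd f1 f1' hdt₁).1 (hasBdryEdge_of_hd f2 f2' hdt₂).2
  have hp1 := pos_sub_one n1'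
  have hp2 := mem_u_iff.1 ht₁
  have hp3 := mt mem_u_iff.2 (mem_d_iff.1 ht₂)
  have hcl := hc.crossing_sides
  have hcx := hc.sides_at hinf
  refine ⟨c, ⟨{g | WhiteConnected ω (fc x (i + 1)) g}, ⟨_, ext_iff.1 hT.white₁, rfl⟩,
    ⟨hc, fun f hf' => hc.whiteConnected hw (hinf.subset (by simp)) hf'⟩, ?_⟩,
    hcl.1.trans hcx.1.symm, hcl.2.trans hcx.2.symm⟩
  rintro c' ⟨hc', hK⟩ z hz
  have hw' : ∀ f ∈ c'.path, White ω f := fun f hf' => (hK f hf').white_right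
  have hcl' := hc'.crossing_sides
  -- The interfaces join `t₁`, `x` and `t₂`, and no white path crosses them.
  have b1 : ∀ {c'' : D.Crosscut} {B C : Set (ZMod D.len)}, c''.Joins B C →
      (∀ f ∈ c''.path, White ω f) → c''.av.Reachable x (D.bdry t₁) ∧
        c''.av.Reachable x (D.bdry t₂) := by
    intro c'' B C h3 h4
    have r1 := (hd_reachable h3 h4 (Set.mem_univ _) (Set.mem_univ _)
      ((hcs _).2 (add_one_ne i)) hd₁).2
    have r2 := (hd_reachable h3 h4 (Set.mem_univ _) (Set.mem_univ _)
      ((hcs _).2 (add_two_ne i)) hd₂).2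
    rw [hdt₁] at r1
    rw [hdt₂] at r2
    exact ⟨r1, r2⟩
  have hm1 := mem_u_iff.1 hc'.2.2.2.1
  have hm2 := mt mem_u_iff.2 (mem_d_iff.1 hc'.2.2.2.2.1)
  -- the other path starts to the right of the interfaces
  have hlt : pos c'.first < pos t₁ := by
    by_contra hge
    -- Otherwise a white path from the entrance of `c'` to that of `c`, both on `u`, would separate
    -- `t₁` from `t₂`.
    obtain ⟨a, ha, ha'⟩ := hc'.2.2.2.2.2.1
    obtain ⟨b, hb, hb'⟩ := hc.2.2.2.2.2.1
    have hab : WhiteConnected ω a b := (hK a (List.mem_of_head? ha)).symm.trans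
      (hc.whiteConnected hw (hinf.subset (by simp)) (List.mem_of_head? hb))
    rw [whiteConnected_iff] at hab
    obtain ⟨c'', h3, h4, h5, h6, -⟩ := Domain.exists_crosscut (fun _ _ h => h) hab.2 hab.1
      hc'.2.2.2.1 hc.2.2.2.1 ha' hb'
    rw [hf] at h6
    obtain ⟨r1, r2⟩ := b1 h3 h4
    have q1 := h3.left_of_gt (t := t₁) (by rw [h6]; omega) (by rw [h5]; omega)
    have q2 := h3.right_of_gt (t := t₂) (by rw [h5, h6]; omega) (Or.inr (by rw [h5]; omega))
    refine h3.not_reachable (fun h => ?_) ((q1.symm.trans (r1.symm.trans r2)).trans q2)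
    have := congrArg pos h
    rw [h5, h6] at this
    omega
  have hxl : c'.av.Reachable x D.ptL :=
    ((b1 hc' hw').1.trans (hc'.right_of_lt hlt (by omega))).trans hcl'.1.symm
  have hlr : ¬ c'.av.Reachable D.ptL D.ptR := fun h =>
    hc'.not_reachable hc'.first_ne_last ((hcl'.2.symm.trans h.symm).trans hcl'.1)
  rw [Crosscut.separates_iff] at hz ⊢
  intro a ha b hb hlz
  rw [Set.mem_singleton_iff] at ha hb
  rw [ha, hb] at hlz
  clear ha hb
  have hlz' := hz _ rfl _ rfl
  -- Relative to `c'` the vertex `z` is with `r`, whereas `x` is with `l`. A walk from `r` to `z`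
  -- avoiding `c'` never meets the component of `x`, so it avoids `c` too, and then `c` does not
  -- separate `l` from `r`.
  have hrz : c'.av.Reachable D.ptR z := by
    rcases hc'.cover_vertex (reachable_face hlz (bdry_face _)) with h | h
    · exact hcl'.2.trans h.symm
    · exact absurd (hcl'.1.trans h.symm) hlz'
  -- every crossed edge of the path has an end which is connected to `x`
  have hcross : ∀ a b, s(a, b) ∈ c.crossed → c'.av.Reachable x a ∨ c'.av.Reachable x b := by
    intro a b hab
    have key : ∀ v, c'.av.Reachable x v → ∀ v', s(a, b) = s(v, v') →
        c'.av.Reachable x a ∨ c'.av.Reachable x b := by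
      intro v hv v' he
      rcases Sym2.eq_iff.1 he with ⟨rfl, -⟩ | ⟨-, rfl⟩
      · exact Or.inl hv
      · exact Or.inr hv
    rcases hab with h | h | ⟨p, q, y, y', hpq, hy, hy', he⟩
    · rw [hf, sub_add_cancel, Sym2.eq_swap] at h
      rw [Sym2.eq_swap] at h
      exact key _ (b1 hc' hw').1 _ (h.trans Sym2.eq_swap)
    · rw [hla] at h
      exact key _ (b1 hc' hw').2 _ h
    · obtain ⟨v, hv, j, rfl, rfl⟩ := hccw p q hpq
      have := leftOf_unique_edge hy hy' (leftOf_nbr v j) (leftOf_nbr_rev v j)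
      rw [this.1, this.2] at he
      exact key v (legVs_reachable hc' hw' (Set.mem_univ _) (Set.mem_univ _)
        hv hT.black hT.white₁ hT.white₂ hx) _ he
  have hmain : ∀ {a b}, c'.av.Walk a b → c'.av.Reachable D.ptR a → c.av.Reachable a b := by
    intro a b p
    induction p with
    | nil => exact fun _ => .rfl
    | @cons a a' b h p ih =>
      intro hra
      have hra' := hra.trans h.reachable
      refine SimpleGraph.Reachable.trans ?_ (ih hra')
      refine SimpleGraph.Adj.reachable
        (Crosscut.av_adj.2 ⟨(Crosscut.av_adj.1 h).1, fun hcr => ?_⟩)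
      rcases hcross a a' hcr with h5 | h5
      · exact hlr ((hxl.symm.trans h5).trans hra.symm)
      · exact hlr ((hxl.symm.trans h5).trans hra'.symm)
  obtain ⟨p⟩ := hrz
  have hrz2 := hmain p .rfl
  exact hc.not_reachable hc.first_ne_last
    ((hcl.2.symm.trans (hrz2.trans hlz.symm)).trans hcl.1)

/-- Left boundaries separating the ends of an inner edge correspond to tripods. -/
lemma leftBoundary_iff (hl : D.IsCorner D.ptL) (hr : D.IsCorner D.ptR)
    (hx : x ∉ Set.range D.bdry) (hxf : ∀ k, fc x k ∈ D.faces) :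
    (∃ c ∈ leftBoundaries ω, c.av.Reachable D.ptL x ∧ c.av.Reachable D.ptR (nbr x i)) ↔
      D.Tripod Set.univ x i (ext ω) ∧ HitsArc (D.cut Set.univ (ext ω)) x (i + 1) D.u ∧
        HitsArc (D.cut Set.univ (ext ω)) x (i + 2) D.d := by
  constructor
  · rintro ⟨c, ⟨K, ⟨f₀, hf₀, rfl⟩, ⟨hc, hK⟩, hleft⟩, h1, h2⟩
    have hw : ∀ f ∈ c.path, White ω f := fun f hf' => (hK f hf').white_right
    have hcl := hc.crossing_sides
    refine tripod_of_crossing hl hr hx hc hw (hc.infix_of_sides (hxf _) (hxf _) hc.first_ne_last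
      (h1.symm.trans hcl.1) (h2.symm.trans hcl.2)) ?_
    -- Such a crossing lies in the same cluster and separates `x` from `l`; the left boundary would
    -- have to do so as well.
    rintro c' hc' hw' ⟨f, hf, hf'⟩ hreach
    have hcl' := hc'.crossing_sides
    have hK' : ∀ g ∈ c'.path, g ∈ {g | WhiteConnected ω f₀ g} := fun g hg =>
      WhiteConnected.trans (hK f hf') (hc'.whiteConnected hw' hf hg)
    have := hleft c' ⟨hc', hK'⟩ x (by
      rw [Crosscut.separates_iff]
      rintro _ rfl _ rfl h
      exact hc'.not_reachable hc'.first_ne_last ((hreach.symm.trans h.symm).trans hcl'.1))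
    rw [Crosscut.separates_iff] at this
    exact this _ rfl _ rfl h1
  · rintro ⟨h1, h2, h3⟩
    exact leftBoundary_of_tripod hl hr hx h1 h2 h3

end Domain
end HexPerc

/-! ### White arcs from `u` to `u` and the increments of `Qd`. -/

namespace HexPerc
namespace Domain

variable {D : Domain} {ω : D.Config} {x : Vertex} {i : Fin 3} {A B : Set (ZMod D.len)}

/-- The reversed path. -/
def Crosscut.rev (c : D.Crosscut) : D.Crosscut := ⟨c.path.reverse, c.last, c.first⟩

lemma Crosscut.rev_rev (c : D.Crosscut) : c.rev.rev = c := by simp [Crosscut.rev]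

lemma _root_.HexPerc.pair_reverse_infix {α : Type*} {l : List α} {a b : α} :
    [a, b] <:+: l.reverse ↔ [b, a] <:+: l := by
  rw [← List.reverse_infix]; simp

lemma Crosscut.rev_crossed (c : D.Crosscut) : c.rev.crossed = c.crossed := by
  have key : ∀ c : D.Crosscut, c.rev.crossed ⊆ c.crossed := by
    rintro c e (h | h | ⟨f, g, y, y', hfg, h1, h2, rfl⟩)
    · exact Or.inr (Or.inl h)
    · exact Or.inl h
    · exact Or.inr (Or.inr ⟨g, f, y', y, pair_reverse_infix.1 hfg, h2, h1, Sym2.eq_swap⟩)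
  refine Set.Subset.antisymm (key c) ?_
  have := key c.rev
  rwa [rev_rev] at this

lemma Crosscut.Joins.rev {c : D.Crosscut} (hc : c.Joins A B) : c.rev.Joins B A := by
  obtain ⟨⟨h1, h2⟩, h3, h4, h5, h6, h7, h8⟩ := hc
  refine ⟨⟨by simpa [Crosscut.rev] using h1, ?_⟩, by simpa [Crosscut.rev] using h3,
    by simpa [Crosscut.rev] using h4, h6, h5, by simpa [Crosscut.rev] using h8,
    by simpa [Crosscut.rev] using h7⟩
  simp only [Crosscut.rev, List.isChain_reverse]
  exact h2.imp fun _ _ h => h.symm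

lemma Crosscut.rev_av (c : D.Crosscut) : c.rev.av = c.av := by
  ext a b
  rw [Crosscut.av_adj, Crosscut.av_adj, Crosscut.rev_crossed]

lemma Crosscut.rev_separates (c : D.Crosscut) {S T : Set Vertex} :
    c.rev.Separates S T ↔ c.Separates S T := by
  unfold Crosscut.Separates; rw [Crosscut.rev_crossed]

/-- A path from `u` to `u` with the orientation of the boundary has `l` and `r` on its right. -/
lemma Crosscut.Joins.arc_sides {c : D.Crosscut} (hc : c.Joins D.u D.u)
    (h : pos c.last < pos c.first) : c.av.Reachable D.ptL (D.bdry (c.first + 1)) ∧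
      c.av.Reachable D.ptR (D.bdry (c.first + 1)) := by
  refine ⟨hc.right_of_gt h (Or.inr (mem_u_iff.1 hc.2.2.2.1)), hc.right_of_gt h (Or.inl ?_)⟩
  rw [pos_r]; omega

/-- Reversing the path if necessary, `l` and `r` lie on its right; a path entering and leaving
through the same edge does not separate anything. -/
lemma mem_Qd_iff {z : Vertex} (hz : ∃ k, fc z k ∈ D.faces) : ω ∈ D.Qd z ↔
    ∃ c : D.Crosscut, c.Joins D.u D.u ∧ (∀ f ∈ c.path, White ω f) ∧ pos c.last < pos c.first ∧
      ¬ c.av.Reachable z (D.bdry (c.first + 1)) ∧ ∃ f ∈ c.path, WhiteConnectedTo ω f D.d := by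
  constructor
  · rintro ⟨c, hc, hw, hs, hconn⟩
    have key : ∀ c : D.Crosscut, c.Joins D.u D.u → c.Separates {z} {D.ptL, D.ptR} →
        pos c.last < pos c.first → ¬ c.av.Reachable z (D.bdry (c.first + 1)) := by
      intro c hc hs hlt hr
      rw [Crosscut.separates_iff] at hs
      exact hs z rfl D.ptL (by simp) (hr.trans (hc.arc_sides hlt).1.symm)
    rcases lt_trichotomy (pos c.last) (pos c.first) with h | h | h
    · exact ⟨c, hc, hw, h, key c hc hs h, hconn⟩
    · exfalso
      have he := (pos_injective h).symm
      rw [Crosscut.separates_iff] at hs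
      refine hs z rfl D.ptL (by simp) (SimpleGraph.Reachable.trans ?_ (hc.all_of_eq he _).symm)
      rcases hc.cover_vertex hz with h1 | h1
      · exact h1
      · exact h1.trans (hc.all_of_eq he _)
    · refine ⟨c.rev, hc.rev, by simpa [Crosscut.rev] using hw, h,
        key _ hc.rev (c.rev_separates.2 hs) h, by simpa [Crosscut.rev] using hconn⟩
  · rintro ⟨c, hc, hw, hlt, hs, hconn⟩
    refine ⟨c, hc, hw, ?_, hconn⟩
    have := hc.arc_sides hlt
    rw [Crosscut.separates_iff]
    rintro a rfl b hb hab
    rcases hb with rfl | hb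
    · exact hs (hab.trans this.1)
    · rw [Set.mem_singleton_iff] at hb
      rw [hb] at hab
      exact hs (hab.trans this.2)

/-- The interfaces at an edge crossed by an outermost path from `u` to `u`. -/
lemma tripod_of_arc (hl : D.IsCorner D.ptL) (hr : D.IsCorner D.ptR)
    (hx : x ∉ Set.range D.bdry) {c : D.Crosscut} (hc : c.Joins D.u D.u)
    (hw : ∀ f ∈ c.path, White ω f) (hlt : pos c.last < pos c.first)
    (hinf : [fc x (i + 2), fc x (i + 1)] <:+: c.path)
    (hconn : ∃ f ∈ c.path, WhiteConnectedTo ω f D.d)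
    (hno : ∀ c' : D.Crosscut, c'.Joins D.u D.u → (∀ f ∈ c'.path, White ω f) →
      pos c'.last < pos c'.first → (∃ f ∈ c'.path, f ∈ c.path) →
      c'.av.Reachable x (D.bdry (c'.first + 1))) :
    D.Tripod D.u x i (ext ω) ∧ D.Norm (D.cut D.u (ext ω)) x i := by
  have w1 : White ω (fc x (i + 1)) := hw _ (hinf.subset (by simp))
  have w2 : White ω (fc x (i + 2)) := hw _ (hinf.subset (by simp))
  have e1 := ext_iff.2 w1
  have e2 := ext_iff.2 w2
  have contra : ∀ c' : D.Crosscut, c'.Joins D.u D.u → (∀ f ∈ c'.path, White ω f) →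
      pos c'.last < pos c'.first → (∃ f ∈ c'.path, f ∈ c.path) →
      ¬ c'.av.Reachable x (D.bdry c'.first) := fun c' h1 h2 h3 h4 h5 =>
    h1.not_reachable (Crosscut.ne_of_pos (by omega)) (h5.symm.trans (hno c' h1 h2 h3 h4))
  have hT : D.Tripod D.u x i (ext ω) := by
    by_cases h0 : ext ω (fc x i) = false
    · refine tripod_of_not_bridge hx w1 w2 fun hb => ?_
      obtain ⟨c', h1, h2, h3, h4, ⟨v, hv, h5⟩, h6⟩ := surgery_bridge hc hw hinf hb
      exact contra c' h1 h2 (by rwa [h3, h4]) h6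
        ((legVs_reachable h1 h2 h1.2.2.2.1 h1.2.2.2.2.1 hv h0 e1 e2 hx).trans h5)
    · refine tripod_of_not_bridge hx w1 w2 fun _ => ?_
      rw [Bool.not_eq_false] at h0
      have w0 := ext_iff.1 h0
      have hb : Relation.ReflTransGen (RStep ω {x}) (fc x (i + 2)) (fc x (i + 1)) := by
        refine .head (b := fc x i) ⟨⟨x, rfl, i + 1, ?_, ?_⟩, w2, w0⟩
          (.single ⟨⟨x, rfl, i + 2, ?_, ?_⟩, w0, w1⟩)
        · rw [add_one_one]
        · rw [add_one_two]
        · rw [add_two_one]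
        · rw [add_two_two]
      obtain ⟨c', h1, h2, h3, h4, ⟨v, rfl, h5⟩, h6⟩ := surgery_bridge hc hw hinf hb
      exact contra c' h1 h2 (by rwa [h3, h4]) h6 h5
  refine ⟨hT, ?_⟩
  -- If neither interface runs along `d`, both end on `u` through inner edges. Extremality puts the
  -- end `τ₁` beyond the entrance of `c` and `τ₂` before its exit. A white path from `d` to the
  -- entrance of `c` then separates `τ₁` from `τ₂`, although the interfaces join them through `x`.
  by_contra hN
  simp only [Norm, not_or, not_exists, not_and, not_not] at hN
  obtain ⟨hN1, hN2⟩ := hN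
  have hcs := hT.start hx
  have hi1 : ∀ d ∈ Leg (D.cut D.u (ext ω)) (D.stops D.u x) x (i + 1),
      lf d ∈ D.faces ∧ rf d ∈ D.faces := fun d hd' =>
    ⟨hN1 d hd', ext_supp ω _ (hT.side₁ (ext_supp ω) hx hd').2⟩
  have hi2 : ∀ d ∈ Leg (D.cut D.u (ext ω)) (D.stops D.u x) x (i + 2),
      lf d ∈ D.faces ∧ rf d ∈ D.faces := fun d hd' =>
    ⟨ext_supp ω _ (hT.side₂ (ext_supp ω) hx hd').1, hN2 d hd'⟩
  obtain ⟨d₁, hd₁, τ₁, ht₁, hu₁⟩ := hT.hits₁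
  obtain ⟨d₂, hd₂, τ₂, ht₂, hu₂⟩ := hT.hits₂
  obtain ⟨f1, f1'⟩ := hi1 d₁ hd₁
  obtain ⟨f2, f2'⟩ := hi2 d₂ hd₂
  obtain ⟨n1, n1'⟩ := ne_of_interior hl hr f1 f1' ht₁
  replace hu₁ := (mem_term_u hl hr f1 f1' ht₁).1 ⟨τ₁, ht₁, hu₁⟩
  replace hu₂ := (mem_term_u hl hr f2 f2' ht₂).1 ⟨τ₂, ht₂, hu₂⟩
  have hps := pos_sub_one n1'
  have hlt1 : pos c.first < pos τ₁ := by
    by_contra hge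
    obtain ⟨c', h1, h2, h3, h4, h5⟩ := surgery_exit hc hw hinf
      (rStep_right hx hT.black e1 e2 hd₁) (B' := D.u)
      ((mem_u_sub_one n1 n1').2 hu₁) (hasBdryEdge_of_hd f1 f1' ht₁).1
    have h6 := (hd_reachable h1 h2 h1.2.2.2.1 h1.2.2.2.2.1 ((hcs _).2 (add_one_ne i)) hd₁).2
    rw [ht₁] at h6
    exact contra c' h1 h2 (by rw [h3, h4]; omega) h5
      (h6.trans (h1.left_of_gt (by rw [h4]; omega) (by rw [h3]; omega)))
  have hlt2 : pos τ₂ ≤ pos c.last := by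
    by_contra hge
    obtain ⟨c', h1, h2, h3, h4, h5⟩ := surgery_entrance hc hw hinf
      (rStep_left hx hT.black e1 e2 hd₂)
      (ext_iff.1 (hT.side₂ (ext_supp ω) hx hd₂).1) (A' := D.u)
      hu₂ (hasBdryEdge_of_hd f2 f2' ht₂).2
    have h6 := (hd_reachable h1 h2 h1.2.2.2.1 h1.2.2.2.2.1 ((hcs _).2 (add_two_ne i)) hd₂).2
    rw [ht₂] at h6
    exact contra c' h1 h2 (by rw [h3, h4]; omega) h5 (by rwa [h3])
  obtain ⟨f, hf, g, s, hs, hfg, hgs⟩ := hconn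
  obtain ⟨a, ha, ha'⟩ := hc.2.2.2.2.2.1
  have hga := (whiteConnected_iff.1
    (hfg.symm.trans (hc.whiteConnected hw hf (List.mem_of_head? ha))))
  obtain ⟨c', h1, h2, h3, h4, -⟩ := Domain.exists_crosscut (fun _ _ h => h) hga.2 hga.1
    hs hc.2.2.2.1 hgs ha'
  have hreach : ∀ {k : Fin 3} {d : Dart},
      (∀ d ∈ Leg (D.cut D.u (ext ω)) (D.stops D.u x) x k, lf d ∈ D.faces ∧ rf d ∈ D.faces) →
      k ≠ i → d ∈ Leg (D.cut D.u (ext ω)) (D.stops D.u x) x k →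
      c'.av.Reachable x (hd d) := by
    intro k d hi hk hd'
    refine (leg_reachable (fun e he => h1.cut_adj h2 (Set.mem_univ _) (Set.mem_univ _) ?_) hd').2
    rw [cut_interior (hi e he).2 (hi e he).1,
      ← cut_interior (A := D.u) (hi e he).2 (hi e he).1]
    exact mem_of_mem_leg ((hcs _).2 hk) he
  have r1 := hreach hi1 (add_one_ne i) hd₁
  have r2 := hreach hi2 (add_two_ne i) hd₂
  rw [ht₁] at r1
  rw [ht₂] at r2
  have hps' := mt mem_u_iff.2 (mem_d_iff.1 hs)
  have hpu := mem_u_iff.1 hu₁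
  have hne : c'.first ≠ c'.last := Crosscut.ne_of_pos (by rw [h3, h4]; omega)
  have q1 := h1.left_of_gt (t := τ₁) (by rw [h4]; omega) (by rw [h3]; omega)
  have q2 := h1.right_of_gt (t := τ₂) (by rw [h3, h4]; omega) (Or.inl (by rw [h4]; omega))
  exact h1.not_reachable hne ((q1.symm.trans (r1.symm.trans r2)).trans q2)

lemma free_rv {d : Dart} : D.free A (hd d) d.2 = D.free A d.1 d.2 := isSym_free d.1 d.2

lemma hasBdryEdge_of_right {d : Dart} (h1 : lf d ∈ D.faces) (h2 : rf d ∉ D.faces) :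
    ∃ t, d.1 = D.bdry t ∧ hd d = D.bdry (t + 1) ∧ D.HasBdryEdge (lf d) t ∧
      (D.free A d.1 d.2 = true ↔ t ∈ A) := by
  obtain ⟨t, e1, e2⟩ := D.exists_bdry (v := d.1) (i := d.2) h1 h2
  refine ⟨t, e1, e2, ?_, ?_⟩
  · unfold HasBdryEdge
    rw [← e1, ← e2]
    exact leftOf_nbr _ _
  · rw [e1] at e2 ⊢
    exact free_out e2

lemma hasBdryEdge_of_left {d : Dart} (h1 : rf d ∈ D.faces) (h2 : lf d ∉ D.faces) :
    ∃ t, hd d = D.bdry t ∧ d.1 = D.bdry (t + 1) ∧ D.HasBdryEdge (rf d) t ∧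
      (D.free A d.1 d.2 = true ↔ t ∈ A) := by
  obtain ⟨t, e1, e2, e3, e4⟩ := hasBdryEdge_of_right (A := A) (d := rv d)
    (by rwa [lf_rv]) (by rwa [rf_rv])
  rw [lf_rv] at e3
  rw [hd_rv] at e2
  refine ⟨t, e1, e2, e3, ?_⟩
  rw [← free_rv]
  exact e4

section Ends

variable (hl : D.IsCorner D.ptL) (hr : D.IsCorner D.ptR)
include hl hr

/-- The arcs change only at `l` and `r`, each of which belongs to a single face of the domain. -/
lemma face_unique_of_mem {t : ZMod D.len} (h : ¬ (t - 1 ∈ D.u ↔ t ∈ D.u)) {f g : Face}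
    (hf : f ∈ D.faces) (hg : g ∈ D.faces) (hf' : ∃ k, D.bdry t = corner f k)
    (hg' : ∃ k, D.bdry t = corner g k) : f = g := by
  have hlr : t = D.l ∨ t = D.r := by
    by_contra! h'
    exact h (mem_u_sub_one h'.1 h'.2)
  have : D.IsCorner (D.bdry t) := by
    rcases hlr with rfl | rfl
    · exact hl
    · exact hr
  obtain ⟨f₀, -, h0⟩ := this
  exact (h0 f ⟨hf, hf'⟩).trans (h0 g ⟨hg, hg'⟩).symm

/-- A leg reaches `u` through an inner edge or by running along `d` to its end. In the second case
the corner condition makes the last face own the adjacent boundary edge of `u` too. -/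
lemma exists_end_right {d : Dart} (h : rf d ∈ D.faces) (hf : D.free D.u d.1 d.2 = false)
    (ht : hd d ∈ D.term D.u) : ∃ t ∈ D.u, D.HasBdryEdge (rf d) t := by
  by_cases h' : lf d ∈ D.faces
  · obtain ⟨t, e, -⟩ := id ht
    obtain ⟨n1, n2⟩ := ne_of_interior hl hr h' h e
    exact ⟨t - 1, (mem_u_sub_one n1 n2).2 ((mem_term_u hl hr h' h e).1 ht),
      (hasBdryEdge_of_hd h' h e).1⟩
  · obtain ⟨t, e1, e2, e3, e4⟩ := hasBdryEdge_of_left (A := D.u) h h'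
    have htu : t ∉ D.u := fun h => by rw [e4.2 h] at hf; exact absurd hf (by simp)
    obtain ⟨t', e5, e6⟩ := ht
    rw [e1] at e5
    cases D.bdry_injective e5
    have hu := e6.resolve_left htu
    refine ⟨t - 1, hu, ?_⟩
    obtain ⟨g, hg, hg'⟩ := exists_hasBdryEdge (t - 1)
    have hg2 := id hg'
    obtain ⟨k, -, hk⟩ := hg'
    rw [sub_add_cancel] at hk
    obtain ⟨k', hk', -⟩ := e3
    rwa [face_unique_of_mem hl hr (fun h => htu (h.1 hu)) h hg ⟨_, hk'⟩ ⟨_, hk⟩]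

lemma exists_end_left {d : Dart} (h : lf d ∈ D.faces) (hf : D.free D.u d.1 d.2 = false)
    (ht : hd d ∈ D.term D.u) : ∃ t ∈ D.u, D.HasBdryEdge (lf d) t := by
  by_cases h' : rf d ∈ D.faces
  · obtain ⟨t, e, -⟩ := id ht
    exact ⟨t, (mem_term_u hl hr h h' e).1 ht, (hasBdryEdge_of_hd h h' e).2⟩
  · obtain ⟨t, e1, e2, e3, e4⟩ := hasBdryEdge_of_right (A := D.u) h h'
    have htu : t ∉ D.u := fun h => by rw [e4.2 h] at hf; exact absurd hf (by simp)
    obtain ⟨t', e5, e6⟩ := ht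
    rw [e2] at e5
    cases D.bdry_injective e5
    rw [add_sub_cancel_right] at e6
    have hu := e6.resolve_right htu
    refine ⟨t + 1, hu, ?_⟩
    obtain ⟨g, hg, hg'⟩ := exists_hasBdryEdge (t + 1)
    have hg2 := id hg'
    obtain ⟨k, hk, -⟩ := hg'
    obtain ⟨k', -, hk'⟩ := e3
    rwa [face_unique_of_mem hl hr (fun h => htu (by rw [add_sub_cancel_right] at h; exact h.2 hu))
      h hg ⟨_, hk'⟩ ⟨_, hk⟩]

/-- The events of arcs in terms of interfaces. -/
lemma mem_Qd_diff_iff (hx : x ∉ Set.range D.bdry) (hxf : ∀ k, fc x k ∈ D.faces) :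
    ω ∈ D.Qd (nbr x i) \ D.Qd x ↔
      D.Tripod D.u x i (ext ω) ∧ D.Norm (D.cut D.u (ext ω)) x i := by
  have hyf : ∃ k, fc (nbr x i) k ∈ D.faces := ⟨i + 1, by rw [fc_nbr_add_one]; exact hxf _⟩
  rw [Set.mem_sdiff, mem_Qd_iff hyf, mem_Qd_iff ⟨0, hxf 0⟩]
  constructor
  · rintro ⟨⟨c, hc, hw, hlt, hs, hconn⟩, hno⟩
    have hne : c.first ≠ c.last := Crosscut.ne_of_pos (by omega)
    have hno' : ∀ c' : D.Crosscut, c'.Joins D.u D.u → (∀ f ∈ c'.path, White ω f) →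
        pos c'.last < pos c'.first → (∃ f ∈ c'.path, f ∈ c.path) →
        c'.av.Reachable x (D.bdry (c'.first + 1)) := by
      rintro c' h1 h2 h3 ⟨f, hf, hf'⟩
      by_contra h4
      obtain ⟨g, hg, g', s, hs, hgg, hgs⟩ := hconn
      exact hno ⟨c', h1, h2, h3, h4, f, hf, g', s, hs, (hc.whiteConnected hw hf' hg).trans hgg, hgs⟩
    obtain ⟨f, hf⟩ : ∃ f, f ∈ c.path := List.exists_mem_of_ne_nil _ hc.1.1
    exact tripod_of_arc hl hr hx hc hw hlt
      (hc.infix_of_sides (hxf _) (hxf _) hne (hno' c hc hw hlt ⟨f, hf, hf⟩)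
        ((hc.cover_vertex hyf).resolve_right hs)) hconn hno'
  · rintro ⟨hT, hN⟩
    have hcs := hT.start hx
    have hσ := ext_supp ω
    have w1 : ∀ d ∈ Leg (D.cut D.u (ext ω)) (D.stops D.u x) x (i + 1), White ω (rf d) :=
      fun d hd' => ext_iff.1 (hT.side₁ hσ hx hd').2
    have w2 : ∀ d ∈ Leg (D.cut D.u (ext ω)) (D.stops D.u x) x (i + 2), White ω (lf d) :=
      fun d hd' => ext_iff.1 (hT.side₂ hσ hx hd').1
    have hfree : ∀ {k : Fin 3} {d : Dart}, k ≠ i →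
        d ∈ Leg (D.cut D.u (ext ω)) (D.stops D.u x) x k → D.free D.u d.1 d.2 = false :=
      fun hk hd' => (cut_supp hσ (mem_of_mem_leg ((hcs _).2 hk) hd')).2
    obtain ⟨d₁, hd₁, hu₁⟩ := hT.hits₁
    obtain ⟨d₂, hd₂, hu₂⟩ := hT.hits₂
    obtain ⟨t₁, ht₁, hb₁⟩ := exists_end_right hl hr (w1 d₁ hd₁).mem
      (hfree (add_one_ne i) hd₁) hu₁
    obtain ⟨t₂, ht₂, hb₂⟩ := exists_end_left hl hr (w2 d₂ hd₂).mem
      (hfree (add_two_ne i) hd₂) hu₂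
    obtain ⟨c, hc, hw, hf, hla, hinf, -⟩ := hT.exists_crosscut hx hd₁ hd₂ ht₁ ht₂ hb₁ hb₂
    have hne : c.first ≠ c.last := by
      rw [hf, hla]
      rintro rfl
      exact hT.disj d₁ hd₁ d₂ hd₂ (hb₁.unique hb₂)
    have hsd := hc.sides_at hinf
    -- `Norm` supplies a point of `d` on an interface. No white path from `u` to `u` cuts it off
    -- from `x`, and the white face next to it connects `c` to `d`.
    obtain ⟨s, hs, hsr, hconn⟩ : ∃ s ∈ D.d, (∀ c' : D.Crosscut, c'.Joins D.u D.u →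
        (∀ f ∈ c'.path, White ω f) → c'.av.Reachable x (D.bdry s)) ∧
        ∃ f ∈ c.path, WhiteConnectedTo ω f D.d := by
      rcases hN with ⟨e, he, he'⟩ | ⟨e, he, he'⟩
      · obtain ⟨s, e1, e2, e3, e4⟩ := hasBdryEdge_of_left (A := D.u) (w1 e he).mem he'
        have hsd : s ∈ D.d := by
          rw [mem_d_iff, ← e4, hfree (add_one_ne i) he]; simp
        refine ⟨s, hsd, fun c' h1 h2 => ?_, _, hinf.subset (by simp : fc x (i + 2) ∈ _), rf e, s,
          hsd, whiteConnected_iff.2 ⟨ext_iff.1 hT.white₂, ?_⟩, e3⟩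
        · rw [← e1]
          exact (hd_reachable h1 h2 h1.2.2.2.1 h1.2.2.2.2.1 ((hcs _).2 (add_one_ne i)) he).2
        · exact reflTransGen_mono (rStep_right hx hT.black hT.white₁ hT.white₂ he)
            fun _ _ h => h.wAdj
      · obtain ⟨s, e1, e2, e3, e4⟩ := hasBdryEdge_of_right (A := D.u) (w2 e he).mem he'
        have hsd : s ∈ D.d := by
          rw [mem_d_iff, ← e4, hfree (add_two_ne i) he]; simp
        refine ⟨s, hsd, fun c' h1 h2 => ?_, _, hinf.subset (by simp : fc x (i + 1) ∈ _), lf e, s,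
          hsd, WhiteConnected.symm (whiteConnected_iff.2 ⟨w2 e he, ?_⟩), e3⟩
        · rw [← e1]
          exact (hd_reachable h1 h2 h1.2.2.2.1 h1.2.2.2.2.1 ((hcs _).2 (add_two_ne i)) he).1
        · exact reflTransGen_mono (rStep_left hx hT.black hT.white₁ hT.white₂ he)
            fun _ _ h => h.wAdj
    have hps := mt mem_u_iff.2 (mem_d_iff.1 hs)
    constructor
    · have hcu1 := mem_u_iff.1 hc.2.2.2.1
      have hcu2 := mem_u_iff.1 hc.2.2.2.2.1
      -- In the other direction `d` would be on the left, while `x`, which is joined to it, is on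
      -- the right.
      have hlt : pos c.last < pos c.first := by
        by_contra hge
        have : pos c.first ≠ pos c.last := fun h => hne (pos_injective h)
        exact hc.not_reachable hne ((hc.left_of_lt (t := s) (by omega)
          (Or.inr (by omega))).symm.trans ((hsr c hc hw).symm.trans hsd.1))
      exact ⟨c, hc, hw, hlt, fun h => hc.not_reachable hne (hsd.2.symm.trans h), hconn⟩
    -- Every such arc has `d` on its right, and therefore `x`.
    · rintro ⟨c', h1, h2, h3, h4, -⟩
      have := mem_u_iff.1 h1.2.2.2.1
      exact h4 ((hsr c' h1 h2).trans (h1.right_of_gt h3 (Or.inr (by omega))))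

end Ends

end Domain
end HexPerc

/-! ### Increments of the signed counts. -/

namespace HexPerc
namespace Domain

variable {D : Domain} {ω : D.Config} {x y : Vertex} {i : Fin 3} {c c' : D.Crosscut}

section Sides

variable (hc : c.Joins D.u D.d)
include hc

lemma Crosscut.Joins.not_reachable_ptL_ptR : ¬ c.av.Reachable D.ptR D.ptL := fun h =>
  hc.not_reachable hc.first_ne_last
    ((hc.crossing_sides.2.symm.trans h).trans hc.crossing_sides.1)

lemma Crosscut.Joins.reachable_ptL_iff {z : Vertex} (hz : ∃ k, fc z k ∈ D.faces) :
    c.av.Reachable D.ptL z ↔ ¬ c.av.Reachable D.ptR z := by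
  constructor
  · exact fun h1 h2 => hc.not_reachable_ptL_ptR (h2.trans h1.symm)
  · intro h
    rcases hc.cover_vertex hz with h1 | h1
    · exact absurd (hc.crossing_sides.2.trans h1.symm) h
    · exact hc.crossing_sides.1.trans h1.symm

lemma Crosscut.Joins.reachable_iff {a b : Vertex} (ha : ∃ k, fc a k ∈ D.faces)
    (hb : ∃ k, fc b k ∈ D.faces) :
    c.av.Reachable a b ↔ (c.av.Reachable D.ptR a ↔ c.av.Reachable D.ptR b) := by
  constructor
  · exact fun h => ⟨fun h' => h'.trans h, fun h' => h'.trans h.symm⟩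
  · intro h
    by_cases h1 : c.av.Reachable D.ptR a
    · exact h1.symm.trans (h.1 h1)
    · exact ((hc.reachable_ptL_iff ha).2 h1).symm.trans
        ((hc.reachable_ptL_iff hb).2 (mt h.2 h1))

end Sides

lemma _root_.HexPerc.prefix_of_pairs {α : Type*} {l l' : List α} (hl' : l'.Nodup)
    (h0 : l[0]? = l'[0]?) (h : ∀ a b, [a, b] <:+: l → [a, b] <:+: l') :
    ∀ (n : ℕ) (a : α), l[n]? = some a → l'[n]? = some a := by
  intro n
  induction n with
  | zero => intro a ha; rwa [← h0]
  | succ n ih =>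
    intro a ha
    have hn : n < l.length := by
      have := (List.getElem?_eq_some_iff.1 ha).1
      omega
    have hb : l[n]? = some l[n] := List.getElem?_eq_getElem hn
    obtain ⟨m, hm, hm'⟩ := infix_pair_iff.1 (h _ _ (infix_pair_iff.2 ⟨n, hb, ha⟩))
    rwa [index_unique hl' (ih _ hb) hm]

/-- Crossings which separate the same vertices are equal. -/
lemma Crosscut.Joins.eq_of_sides (hc : c.Joins D.u D.d) (hc' : c'.Joins D.u D.d)
    (h : ∀ z, (∃ k, fc z k ∈ D.faces) → (c.av.Reachable D.ptR z ↔ c'.av.Reachable D.ptR z)) :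
    c = c' := by
  have hreach : ∀ {a b}, (∃ k, fc a k ∈ D.faces) → (∃ k, fc b k ∈ D.faces) →
      (c.av.Reachable a b ↔ c'.av.Reachable a b) := by
    intro a b ha hb
    rw [hc.reachable_iff ha hb, hc'.reachable_iff ha hb, h a ha, h b hb]
  -- Along `u` the side changes exactly at the entrance, along `d` exactly at the exit; inner edges
  -- joining different sides give the steps of the path with their direction.
  have e1 : c.first = c'.first := by
    by_contra hne
    have hadj := hc'.bdry_adj hne
      (fun e => mem_d_iff.1 hc'.2.2.2.2.1 (e ▸ hc.2.2.2.1))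
    exact hc.not_reachable hc.first_ne_last
      ((hreach (bdry_face _) (bdry_face _)).2 hadj.reachable)
  have e2 : c.last = c'.last := by
    by_contra hne
    have hadj := hc'.bdry_adj (t := c.last)
      (fun e => mem_d_iff.1 hc.2.2.2.2.1 (e ▸ hc'.2.2.2.1)) hne
    have := (hreach (bdry_face _) (bdry_face _)).2 hadj.reachable
    exact hc.not_reachable hc.first_ne_last
      ((hc.last_sides.1.symm.trans this.symm).trans hc.last_sides.2)
  have pairs : ∀ {c c' : D.Crosscut}, c.Joins D.u D.d → c'.Joins D.u D.d →
      (∀ z, (∃ k, fc z k ∈ D.faces) → (c.av.Reachable D.ptR z ↔ c'.av.Reachable D.ptR z)) →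
      ∀ f g, [f, g] <:+: c.path → [f, g] <:+: c'.path := by
    intro c c' hc hc' h f g hfg
    have hf := hc.2.2.1 f (hfg.subset (by simp))
    have hg := hc.2.2.1 g (hfg.subset (by simp))
    have hadj := hc.1.2.infix hfg
    rw [List.isChain_cons_cons] at hadj
    obtain ⟨v, j, rfl, rfl⟩ := faceAdj_iff.1 hadj.1
    have hs := hc.step_sides hfg
    have hn : ∃ k, fc (nbr v j) k ∈ D.faces := ⟨j + 1, by rwa [fc_nbr_add_one]⟩
    have r1 := (h v ⟨_, hf⟩).1 (hc.crossing_sides.2.trans hs.1.symm)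
    have r2 := mt (h _ hn).2
      ((hc.reachable_ptL_iff hn).1 (hc.crossing_sides.1.trans hs.2.symm))
    have := hc'.infix_of_sides (x := nbr v j) (i := j) (by rwa [fc_nbr_add_one])
      (by rwa [fc_nbr_add_two]) hc'.first_ne_last
      (((hc'.reachable_ptL_iff hn).2 r2).symm.trans hc'.crossing_sides.1)
      (by rw [nbr_nbr]; exact r1.symm.trans hc'.crossing_sides.2)
    rwa [fc_nbr_add_one, fc_nbr_add_two] at this
  obtain ⟨f, hf, hf'⟩ := hc.first_edge
  obtain ⟨g, hg, hg'⟩ := hc'.first_edge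
  rw [e1] at hf'
  have hfg : f = g := hf'.unique hg'
  have h0 : c.path[0]? = c'.path[0]? := by rw [hf, hg, hfg]
  have e3 : c.path = c'.path := by
    refine List.ext_getElem? fun n => ?_
    have k1 := prefix_of_pairs hc'.2.1 h0 (pairs hc hc' h) n
    have k2 := prefix_of_pairs hc.2.1 h0.symm (pairs hc' hc fun z hz => (h z hz).symm) n
    exact Option.ext fun a => ⟨k1 a, k2 a⟩
  cases c; cases c'; simp_all

lemma finite_crosscuts : {c : D.Crosscut | c.Joins D.u D.d}.Finite := by
  have h1 : {l : List D.faces | l.length ≤ D.faces.card}.Finite := List.finite_length_le _ _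
  have h2 := (h1.image (List.map Subtype.val)).prod (Set.finite_univ (α := ZMod D.len × ZMod D.len))
  refine (h2.image fun p => (⟨p.1, p.2.1, p.2.2⟩ : D.Crosscut)).subset ?_
  intro c hc
  refine ⟨(c.path, c.first, c.last), ⟨?_, trivial⟩, rfl⟩
  have hsub := hc.2.2.1
  have hlen : c.path.length ≤ D.faces.card := by
    rw [← List.toFinset_card_of_nodup hc.2.1]
    exact Finset.card_le_card fun f hf => hsub f (List.mem_toFinset.1 hf)
  generalize c.path = l at hsub hlen ⊢
  lift l to List D.faces using hsub
  exact ⟨l, by simpa using hlen, rfl⟩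

section Count

variable {B : Set D.Crosscut} (hB : ∀ c ∈ B, c.Joins D.u D.d)
include hB

lemma finite_of_joins : B.Finite := finite_crosscuts.subset hB

open Classical in
-- As `l` and `r` are on different sides of a crossing, the two counts combine into an indicator for
-- `z` minus the same one for `w`. The latter cancels in increments.
lemma signedCount_eq {z : Vertex} (hz : ∃ k, fc z k ∈ D.faces) :
    signedCount B z = ∑ c ∈ (finite_of_joins hB).toFinset,
      ((if c.av.Reachable D.ptR z then 1 else 0) -
        (if c.av.Reachable D.ptR D.ptW then 1 else 0) : ℤ) := by
  have hset : ∀ P : D.Crosscut → Prop, ({c ∈ B | P c}.ncard : ℤ) =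
      ∑ c ∈ (finite_of_joins hB).toFinset, if P c then 1 else 0 := by
    intro P
    rw [← Finset.natCast_card_filter, ← Set.ncard_coe_finset]
    congr 2
    ext c
    simp
  unfold signedCount
  rw [hset, hset, ← Finset.sum_sub_distrib]
  refine Finset.sum_congr rfl fun c hc => ?_
  rw [Set.Finite.mem_toFinset] at hc
  have hj := hB c hc
  have hw : ∃ k, fc D.ptW k ∈ D.faces := bdry_face _
  have hL : ∃ k, fc D.ptL k ∈ D.faces := bdry_face _
  have hR : ∃ k, fc D.ptR k ∈ D.faces := bdry_face _
  have hrr : c.av.Reachable D.ptR D.ptR := .rfl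
  have hnl := hj.not_reachable_ptL_ptR
  have k1 : c.Separates {D.ptL, D.ptW} {z, D.ptR} ↔
      ¬ c.av.Reachable D.ptR D.ptW ∧ c.av.Reachable D.ptR z := by
    rw [Crosscut.separates_iff]
    simp only [Set.mem_insert_iff, Set.mem_singleton_iff, forall_eq_or_imp, forall_eq]
    rw [hj.reachable_iff hL hz, hj.reachable_iff hL hR, hj.reachable_iff hw hz,
      hj.reachable_iff hw hR]
    tauto
  have k2 : c.Separates {D.ptL, z} {D.ptW, D.ptR} ↔
      c.av.Reachable D.ptR D.ptW ∧ ¬ c.av.Reachable D.ptR z := by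
    rw [Crosscut.separates_iff]
    simp only [Set.mem_insert_iff, Set.mem_singleton_iff, forall_eq_or_imp, forall_eq]
    rw [hj.reachable_iff hL hw, hj.reachable_iff hL hR, hj.reachable_iff hz hw,
      hj.reachable_iff hz hR]
    tauto
  rw [if_congr k1 rfl rfl, if_congr k2 rfl rfl]
  by_cases a : c.av.Reachable D.ptR D.ptW <;> by_cases b : c.av.Reachable D.ptR z <;> simp [a, b]

/-- The increments of the signed count along an edge crossed by at most one path. -/
lemma signedCount_step (hx : ∃ k, fc x k ∈ D.faces) (hy : ∃ k, fc y k ∈ D.faces)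
    (huniq : ∀ c ∈ B, ∀ c' ∈ B, ¬ c.av.Reachable x y → ¬ c'.av.Reachable x y → c = c') :
    (signedCount B y = signedCount B x + 1 ↔
      ∃ c ∈ B, c.av.Reachable D.ptL x ∧ c.av.Reachable D.ptR y) ∧
    (signedCount B y = signedCount B x - 1 ↔
      ∃ c ∈ B, c.av.Reachable D.ptR x ∧ c.av.Reachable D.ptL y) := by
  classical
  have hdiff : signedCount B y - signedCount B x = ∑ c ∈ (finite_of_joins hB).toFinset,
      ((if c.av.Reachable D.ptR y then 1 else 0) -
        (if c.av.Reachable D.ptR x then 1 else 0) : ℤ) := by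
    rw [signedCount_eq hB hx, signedCount_eq hB hy, ← Finset.sum_sub_distrib]
    refine Finset.sum_congr rfl fun c _ => ?_
    ring
  have hzero : ∀ c ∈ B, c.av.Reachable x y → ((if c.av.Reachable D.ptR y then 1 else 0) -
        (if c.av.Reachable D.ptR x then 1 else 0) : ℤ) = 0 := by
    intro c hc h
    rw [(hB c hc).reachable_iff hx hy] at h
    simp [h]
  have hcr : ∀ c ∈ B, c.av.Reachable D.ptL x ∧ c.av.Reachable D.ptR y ∨
      c.av.Reachable D.ptR x ∧ c.av.Reachable D.ptL y → ¬ c.av.Reachable x y := by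
    rintro c hc (⟨h1, h2⟩ | ⟨h1, h2⟩) h
    · exact (hB c hc).not_reachable_ptL_ptR (h2.trans (h1.trans h).symm)
    · exact (hB c hc).not_reachable_ptL_ptR ((h1.trans h).trans h2.symm)
  by_cases hex : ∃ c ∈ B, ¬ c.av.Reachable x y
  · obtain ⟨c, hc, hxy⟩ := hex
    rw [Finset.sum_eq_single_of_mem c (by simpa using hc)] at hdiff
    · have hj := hB c hc
      have e1 : (∃ c ∈ B, c.av.Reachable D.ptL x ∧ c.av.Reachable D.ptR y) ↔
          c.av.Reachable D.ptL x ∧ c.av.Reachable D.ptR y :=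
        ⟨fun ⟨c', h1, h2⟩ => huniq c hc c' h1 hxy (hcr c' h1 (Or.inl h2)) ▸ h2,
          fun h => ⟨c, hc, h⟩⟩
      have e2 : (∃ c ∈ B, c.av.Reachable D.ptR x ∧ c.av.Reachable D.ptL y) ↔
          c.av.Reachable D.ptR x ∧ c.av.Reachable D.ptL y :=
        ⟨fun ⟨c', h1, h2⟩ => huniq c hc c' h1 hxy (hcr c' h1 (Or.inr h2)) ▸ h2,
          fun h => ⟨c, hc, h⟩⟩
      rw [e1, e2, hj.reachable_ptL_iff hx, hj.reachable_ptL_iff hy]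
      rw [hj.reachable_iff hx hy] at hxy
      by_cases a : c.av.Reachable D.ptR x <;> by_cases b : c.av.Reachable D.ptR y <;>
        simp only [a, b, if_true, if_false] at hdiff hxy ⊢ <;>
        first
        | (simp at hxy; done)
        | (constructor <;> simp <;> omega)
    · intro c' hc' hne
      rw [Set.Finite.mem_toFinset] at hc'
      refine hzero c' hc' ?_
      by_contra h
      exact hne (huniq c' hc' c hc h hxy)
  · push Not at hex
    rw [Finset.sum_eq_zero fun c hc => hzero c (by simpa using hc) (hex c (by simpa using hc))]
      at hdiff
    constructor
    · refine ⟨fun h => by omega, ?_⟩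
      rintro ⟨c, hc, h⟩
      exact absurd (hex c hc) (hcr c hc (Or.inl h))
    · refine ⟨fun h => by omega, ?_⟩
      rintro ⟨c, hc, h⟩
      exact absurd (hex c hc) (hcr c hc (Or.inr h))

end Count

/-- Two paths crossing the same inner edge have a common face. -/
lemma Crosscut.Joins.mem_of_crossed (hc : c.Joins D.u D.d) (h1 : fc x (i + 1) ∈ D.faces)
    (h2 : fc x (i + 2) ∈ D.faces) (h : ¬ c.av.Reachable x (nbr x i)) :
    fc x (i + 1) ∈ c.path := by
  have hx : ∃ k, fc x k ∈ D.faces := ⟨_, h1⟩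
  have hn : ∃ k, fc (nbr x i) k ∈ D.faces := ⟨i + 1, by rwa [fc_nbr_add_one]⟩
  rcases hc.cover_vertex hx with h3 | h3 <;> rcases hc.cover_vertex hn with h4 | h4
  · exact absurd (h3.trans h4.symm) h
  · have := hc.infix_of_sides (x := nbr x i) (i := i) (by rwa [fc_nbr_add_one])
      (by rwa [fc_nbr_add_two]) hc.first_ne_last h4 (by rwa [nbr_nbr])
    rw [fc_nbr_add_two] at this
    exact this.subset (by simp)
  · exact (hc.infix_of_sides h1 h2 hc.first_ne_last h3 h4).subset (by simp)
  · exact absurd (h3.trans h4.symm) h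

lemma cluster_unique {K K' : Set Face} (hK : IsWhiteCluster ω K) (hK' : IsWhiteCluster ω K')
    {f : Face} (hf : f ∈ K) (hf' : f ∈ K') : K = K' := by
  obtain ⟨g, -, rfl⟩ := hK
  obtain ⟨g', -, rfl⟩ := hK'
  have h1 : WhiteConnected ω g f := hf
  have h2 : WhiteConnected ω g' f := hf'
  ext a
  exact ⟨fun h : WhiteConnected ω g a => (h2.trans h1.symm).trans h,
    fun h : WhiteConnected ω g' a => (h1.trans h2.symm).trans h⟩

variable (h1 : fc x (i + 1) ∈ D.faces) (h2 : fc x (i + 2) ∈ D.faces)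
include h1 h2

/-- Two left boundaries crossing the edge share a face, so they come from one cluster, separate the
same vertices by extremality, and are equal. Thus at most one crosses, as `signedCount_step`
requires. -/
lemma Nl_step_iff : Nl ω (nbr x i) = Nl ω x + 1 ↔
    ∃ c ∈ leftBoundaries ω, c.av.Reachable D.ptL x ∧ c.av.Reachable D.ptR (nbr x i) := by
  refine (signedCount_step ?_ ⟨_, h1⟩ ⟨i + 1, by rwa [fc_nbr_add_one]⟩ ?_).1
  · rintro c ⟨K, -, h, -⟩
    exact h.1
  · rintro c ⟨K, hK, hc, hmin⟩ c' ⟨K', hK', hc', hmin'⟩ hxy hxy'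
    have m1 := hc.1.mem_of_crossed h1 h2 hxy
    have m2 := hc'.1.mem_of_crossed h1 h2 hxy'
    cases cluster_unique hK hK' (hc.2 _ m1) (hc'.2 _ m2)
    refine hc.1.eq_of_sides hc'.1 fun z hz => ?_
    rw [← not_iff_not, ← hc.1.reachable_ptL_iff hz, ← hc'.1.reachable_ptL_iff hz, ← not_iff_not]
    have s1 := hmin c' hc' z
    have s2 := hmin' c hc z
    simp only [Crosscut.separates_iff, Set.mem_singleton_iff, forall_eq] at s1 s2
    exact ⟨s2, s1⟩

lemma Nr_step_iff : Nr ω (nbr x i) = Nr ω x - 1 ↔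
    ∃ c ∈ rightBoundaries ω, c.av.Reachable D.ptR x ∧ c.av.Reachable D.ptL (nbr x i) := by
  refine (signedCount_step ?_ ⟨_, h1⟩ ⟨i + 1, by rwa [fc_nbr_add_one]⟩ ?_).2
  · rintro c ⟨K, -, h, -⟩
    exact h.1
  · rintro c ⟨K, hK, hc, hmin⟩ c' ⟨K', hK', hc', hmin'⟩ hxy hxy'
    have m1 := hc.1.mem_of_crossed h1 h2 hxy
    have m2 := hc'.1.mem_of_crossed h1 h2 hxy'
    cases cluster_unique hK hK' (hc.2 _ m1) (hc'.2 _ m2)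
    refine hc.1.eq_of_sides hc'.1 fun z hz => ?_
    rw [← not_iff_not]
    have s1 := hmin c' hc' z
    have s2 := hmin' c hc z
    simp only [Crosscut.separates_iff, Set.mem_singleton_iff, forall_eq] at s1 s2
    exact ⟨s2, s1⟩

end Domain
end HexPerc

/-! ### Exchanging `l` and `r`, counting triples of legs, and the conclusion. -/

namespace HexPerc
namespace Domain

/-- The domain with the two marked points exchanged. -/
def swap (D : Domain) : Domain where
  faces := D.faces
  connected := D.connected
  len := D.len
  bdry := D.bdry
  bdry_injective := D.bdry_injective
  bdry_edges := D.bdry_edges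
  l := D.r
  r := D.l
  -- Any admissible vertex would do, as increments do not involve `w`.
  w := D.l
  l_ne_r := D.l_ne_r.symm
  w_mem := by simp

variable {D : Domain} {ω : D.Config} {x : Vertex} {i : Fin 3}

/-- The reversed path in the domain with the marked points exchanged. -/
def Crosscut.swap (c : D.Crosscut) : D.swap.Crosscut := ⟨c.path.reverse, c.last, c.first⟩

/-- The crossings of the domain with the marked points exchanged, reversed. -/
def Crosscut.unswap (c : D.swap.Crosscut) : D.Crosscut := ⟨c.path.reverse, c.last, c.first⟩

lemma Crosscut.swap_unswap (c : D.swap.Crosscut) : c.unswap.swap = c := by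
  simp [Crosscut.swap, Crosscut.unswap]

lemma Crosscut.swap_av (c : D.Crosscut) : c.swap.av = c.av := c.rev_av

lemma Crosscut.swap_separates (c : D.Crosscut) {S T : Set Vertex} :
    c.swap.Separates S T ↔ c.Separates S T := c.rev_separates

/-- Exchanging the marked points exchanges the arcs, so crossings have to be reversed; separation
ignores the direction. -/
lemma crossesIn_swap {K : Set Face} {c : D.Crosscut} :
    CrossesIn (D := D.swap) K c.swap ↔ CrossesIn K c := by
  constructor
  · rintro ⟨h1, h2⟩
    have h3 : c.rev.rev.Joins D.u D.d := Crosscut.Joins.rev (D := D) (A := D.d) (B := D.u) h1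
    rw [Crosscut.rev_rev] at h3
    exact ⟨h3, fun f hf => h2 f (by simpa [Crosscut.swap] using hf)⟩
  · rintro ⟨h1, h2⟩
    exact ⟨h1.rev, fun f hf => h2 f (by simpa [Crosscut.swap] using hf)⟩

lemma isLeftBoundary_swap {K : Set Face} {c : D.Crosscut} :
    IsLeftBoundary (D := D.swap) K c.swap ↔ IsRightBoundary K c := by
  unfold IsLeftBoundary IsRightBoundary
  rw [crossesIn_swap]
  refine and_congr_right fun _ => ⟨fun h c' hc' z hz => ?_, fun h c' hc' z hz => ?_⟩
  · exact c.swap_separates.1 (h c'.swap (crossesIn_swap.2 hc') z (c'.swap_separates.2 hz))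
  · rw [← c'.swap_unswap] at hc' hz
    exact c.swap_separates.2 (h _ (crossesIn_swap.1 hc') z (Crosscut.swap_separates _ |>.1 hz))

lemma mem_leftBoundaries_swap {c : D.Crosscut} :
    c.swap ∈ leftBoundaries (D := D.swap) ω ↔ c ∈ rightBoundaries ω :=
  exists_congr fun _ => and_congr_right fun _ => isLeftBoundary_swap

lemma rightBoundary_iff_swap :
    (∃ c ∈ rightBoundaries ω, c.av.Reachable D.ptR x ∧ c.av.Reachable D.ptL (nbr x i)) ↔
      ∃ c ∈ leftBoundaries (D := D.swap) ω,
        c.av.Reachable D.swap.ptL x ∧ c.av.Reachable D.swap.ptR (nbr x i) := by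
  constructor
  · rintro ⟨c, h1, h2, h3⟩
    refine ⟨c.swap, mem_leftBoundaries_swap.2 h1, ?_⟩
    rw [c.swap_av]
    exact ⟨h2, h3⟩
  · rintro ⟨c, h1, h2, h3⟩
    rw [← c.swap_unswap] at h1 h2 h3
    rw [Crosscut.swap_av] at h2 h3
    exact ⟨_, mem_leftBoundaries_swap.1 h1, h2, h3⟩

lemma Qu_eq_swap : D.Qu x = D.swap.Qd x := by
  ext ω
  constructor
  · rintro ⟨c, h1, h2, h3, h4⟩
    obtain ⟨f, hf, h4⟩ := h4
    refine ⟨c.swap, h1.rev, fun f hf => h2 f (by simpa [Crosscut.swap] using hf), ?_,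
      f, by simpa [Crosscut.swap] using hf, h4⟩
    rw [Set.pair_comm] at h3
    exact c.swap_separates.2 h3
  · rintro ⟨c, h1, h2, h3, h4⟩
    obtain ⟨f, hf, h4⟩ := h4
    refine ⟨c.unswap, h1.rev, fun f hf => h2 f (by simpa [Crosscut.unswap] using hf), ?_,
      f, by simpa [Crosscut.unswap] using hf, h4⟩
    rw [← c.swap_unswap, Crosscut.swap_separates, Set.pair_comm] at h3
    exact h3

lemma src_swap {ξ : EdgeSet} : D.swap.Src Set.univ x ξ ↔ D.Src Set.univ x ξ :=
  ⟨fun h => ⟨h.sym, h.supp, h.even, h.start, h.hits⟩,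
    fun h => ⟨h.sym, h.supp, h.even, h.start, h.hits⟩⟩

/-- With free boundary a leg ends at exactly one boundary vertex, and the two arcs partition the
indices. -/
lemma hitsArc_d_iff {ξ : EdgeSet} (hS : D.Src Set.univ x ξ) (k : Fin 3) :
    HitsArc ξ x k D.d ↔ ¬ HitsArc ξ x k D.u := by
  have hterm : ∀ t, D.bdry t ∈ D.stops Set.univ x := fun t => by
    refine Or.inr ?_
    rw [term_univ]
    exact ⟨t, rfl⟩
  constructor
  · rintro ⟨d, hd', t, ht, e⟩ ⟨d', hd'', t', ht', e'⟩
    have := hS.good.end_unique (hS.start k) hd' hd'' (e ▸ hterm t) (e' ▸ hterm t')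
    rw [this, e'] at e
    exact mem_d_iff.1 ht (D.bdry_injective e ▸ ht')
  · intro h
    obtain ⟨d, hd', ht⟩ := hS.hits k
    rw [term_univ] at ht
    obtain ⟨t, ht⟩ := ht
    exact ⟨d, hd', t, mem_d_iff.2 fun h' => h ⟨d, hd', t, h', ht.symm⟩, ht.symm⟩

section Ncard

variable (hx : x ∉ Set.range D.bdry) (hxf : ∀ k, fc x k ∈ D.faces)
include hx hxf

lemma bijOn_univ (P : Set Dart → Set Dart → Prop) :
    Set.BijOn (fun ω : D.Config => D.toSrc Set.univ x i (ext ω))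
      {ω | D.Tripod Set.univ x i (ext ω) ∧
        P (Leg (D.cut Set.univ (ext ω)) (D.stops Set.univ x) x (i + 1))
          (Leg (D.cut Set.univ (ext ω)) (D.stops Set.univ x) x (i + 2))}
      {ξ | D.Src Set.univ x ξ ∧ P (Leg ξ (D.stops Set.univ x) x (i + 1))
        (Leg ξ (D.stops Set.univ x) x (i + 2))} :=
  bijOn_toSrc hx hxf fun _ hS _ => exists_isCol_univ hx hxf hS

/-- Triples of legs are images of configurations. -/
lemma finite_src : {ξ | D.Src Set.univ x ξ}.Finite := by
  have := (bijOn_univ (i := 0) hx hxf fun _ _ => True).image_eq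
  simp only [and_true] at this
  rw [← this]
  exact Set.Finite.image _ (Set.toFinite _)

variable (hl : D.IsCorner D.ptL) (hr : D.IsCorner D.ptR)
include hl hr

/-- The increment is a left boundary between the ends of the edge, hence a tripod with interfaces
ending on `u` and `d`, and colour switching keeps these interfaces as legs. -/
lemma dPlusHl_eq : D.dPlusHl x (nbr x i) =
    {ξ | D.Src Set.univ x ξ ∧ HitsArc ξ x (i + 1) D.u ∧ HitsArc ξ x (i + 2) D.d}.ncard /
      2 ^ D.faces.card := by
  unfold dPlusHl prob
  have h := bijOn_univ (i := i) hx hxf fun L₁ L₂ =>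
    (∃ d ∈ L₁, ∃ t ∈ D.u, hd d = D.bdry t) ∧ ∃ d ∈ L₂, ∃ t ∈ D.d, hd d = D.bdry t
  rw [show {ξ | D.Src Set.univ x ξ ∧ HitsArc ξ x (i + 1) D.u ∧ HitsArc ξ x (i + 2) D.d} = _
    from h.image_eq.symm, h.injOn.ncard_image]
  congr 3
  ext ω
  exact (Nl_step_iff (hxf _) (hxf _)).trans (leftBoundary_iff hl hr hx hxf)

/-- Composes colour switching for the boundary condition on `u` with the restriction to inner edges.
-/
lemma dPlusHd_eq : D.dPlusHd x (nbr x i) =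
    {ξ | D.Src Set.univ x ξ ∧ HitsArc ξ x i D.u ∧
      ¬ (HitsArc ξ x (i + 1) D.u ∧ HitsArc ξ x (i + 2) D.u)}.ncard / 2 ^ D.faces.card := by
  unfold dPlusHd prob
  have h2 := bijOn_inner (i := i) hl hr hx hxf
  have h1 := bijOn_toSrc (A := D.u) (i := i) hx hxf
    (P := fun L₁ L₂ => (∃ d ∈ L₁, lf d ∉ D.faces) ∨ ∃ d ∈ L₂, rf d ∉ D.faces)
    fun ξ hS hN => exists_isCol_u hx hS hN
  have h := Set.BijOn.comp h2 h1
  rw [← h.image_eq, h.injOn.ncard_image]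
  congr 3
  ext ω
  exact mem_Qd_diff_iff hl hr hx hxf

lemma dMinusHr_eq : D.dMinusHr x (nbr x i) =
    {ξ | D.Src Set.univ x ξ ∧ HitsArc ξ x (i + 1) D.d ∧ HitsArc ξ x (i + 2) D.u}.ncard /
      2 ^ D.faces.card := by
  have h := dPlusHl_eq (D := D.swap) (i := i) hx hxf hr hl
  simp only [src_swap] at h
  refine Eq.trans ?_ h
  unfold dMinusHr dPlusHl prob
  congr 3
  ext ω
  exact ((Nr_step_iff (hxf _) (hxf _)).trans rightBoundary_iff_swap).trans
    (Nl_step_iff (D := D.swap) (hxf _) (hxf _)).symm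

lemma dPlusHu_eq : D.dPlusHu x (nbr x i) =
    {ξ | D.Src Set.univ x ξ ∧ HitsArc ξ x i D.d ∧
      ¬ (HitsArc ξ x (i + 1) D.d ∧ HitsArc ξ x (i + 2) D.d)}.ncard / 2 ^ D.faces.card := by
  have h := dPlusHd_eq (D := D.swap) (i := i) hx hxf hr hl
  simp only [src_swap] at h
  refine Eq.trans ?_ h
  unfold dPlusHu dPlusHd
  rw [Qu_eq_swap, Qu_eq_swap]
  rfl

/-- The discrete Cauchy–Riemann equations. -/
theorem cauchyRiemann : 2 * (D.dPlusHl x (nbr x i) - D.dMinusHr x (nbr x i)) =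
    (D.dPlusHd x (nbr x (i + 1)) - D.dPlusHu x (nbr x (i + 1))) -
      (D.dPlusHd x (nbr x (i + 2)) - D.dPlusHu x (nbr x (i + 2))) := by
  classical
  rw [dPlusHl_eq hx hxf hl hr, dMinusHr_eq hx hxf hl hr, dPlusHd_eq hx hxf hl hr,
    dPlusHu_eq hx hxf hl hr, dPlusHd_eq hx hxf hl hr, dPlusHu_eq hx hxf hl hr]
  simp only [add_one_one, add_one_two, add_two_one, add_two_two]
  have hfin := finite_src hx hxf
  have hset : ∀ Q : EdgeSet → Prop, ({ξ | D.Src Set.univ x ξ ∧ Q ξ}.ncard : ℝ) =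
      ∑ ξ ∈ hfin.toFinset, if Q ξ then 1 else 0 := by
    intro Q
    rw [← Finset.natCast_card_filter, ← Set.ncard_coe_finset]
    congr 2
    ext ξ
    simp
  simp only [hset, ← sub_div, mul_div_assoc']
  congr 1
  rw [← Finset.sum_sub_distrib, Finset.mul_sum, ← Finset.sum_sub_distrib, ← Finset.sum_sub_distrib,
    ← Finset.sum_sub_distrib]
  -- For a single triple both sides are twice the difference of the indicators that the legs `i + 1`
  -- and `i + 2` end on `u`: the contributions of triples ending on one arc cancel cyclically.
  refine Finset.sum_congr rfl fun ξ hξ => ?_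
  have hS : D.Src Set.univ x ξ := by simpa using hξ
  simp only [hitsArc_d_iff hS]
  by_cases a : HitsArc ξ x i D.u <;> by_cases b : HitsArc ξ x (i + 1) D.u <;>
    by_cases c : HitsArc ξ x (i + 2) D.u <;> simp [a, b, c] <;> norm_num

end Ncard

end Domain
end HexPerc


theorem mainTheorem2 (δ : ℝ) (hδ : 0 < δ) (D : HexPerc.Domain)
    (hl : D.IsCorner D.ptL) (hr : D.IsCorner D.ptR)
    (x y y₁ y₂ : HexPerc.Vertex)
    (hxy : D.graph.Adj x y) (hx : x ∉ Set.range D.bdry)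
    (h₁ : HexPerc.pos δ y₁ - HexPerc.pos δ x =
      Complex.exp (2 * Real.pi * Complex.I / 3) * (HexPerc.pos δ y - HexPerc.pos δ x))
    (h₂ : HexPerc.pos δ y₂ - HexPerc.pos δ x =
      Complex.exp (4 * Real.pi * Complex.I / 3) * (HexPerc.pos δ y - HexPerc.pos δ x)) :
    2 * (D.dPlusHl x y - D.dMinusHr x y) =
      (D.dPlusHd x y₁ - D.dPlusHu x y₁) - (D.dPlusHd x y₂ - D.dPlusHu x y₂) := by
  obtain ⟨i, rfl, hf⟩ := D.graph_adj.1 hxy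
  -- Being on an edge of the domain, `x` touches one of its faces; being off the boundary, it
  -- touches no other face.
  have hxf : ∀ k, HexPerc.fc x k ∈ D.faces := by
    by_contra! h
    exact hx (D.mem_range_bdry.2 ⟨hf.elim (fun h => ⟨_, h⟩) fun h => ⟨_, h⟩, h⟩)
  rw [← HexPerc.pos_nbr_add_one, sub_left_inj] at h₁
  rw [← HexPerc.pos_nbr_add_two, sub_left_inj] at h₂
  cases HexPerc.pos_injective hδ h₁
  cases HexPerc.pos_injective hδ h₂
  exact HexPerc.Domain.cauchyRiemann hx hxf hl hr
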